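/- Let $(X,d)$ be a non-empty metric space that is geometrically doubling: for some $N\in\mathbb N$ every open ball of radius $r$ can be covered by at most $N$ open balls of radius $r/2$. Let $\mu$ be a Borel measure on $X$ that is upper doubling with dominating function $\lambda:X\times(0,\infty)\to(0,\infty)$: $r\mapsto\lambda(x,r)$ is non-decreasing, $\lambda(x,2r)\le C_\lambda\lambda(x,r)$, $\mu(B(x,r))\le\lambda(x,r)$ for all $x\in X$, $r>0$, and $\lambda(x,r)\le C\lambda(y,r)$ whenever $d(x,y)\le r$. Functions are real-valued or complex-valued. A Calderón–Zygmund kernel is a function $K\in L^1_{\mathrm{loc}}(X\times X\setminus\{x=y\},\mu\times\mu)$ for which there are constants $C$, $c>0$ and $\delta\in(0,1]$ with $$|K(x,y)|\le C\min\Big\{\frac1{\lambda(x,d(x,y))},\frac1{\lambda(y,d(x,y))}\Big\}\quad (x\ne y),$$ $$|K(x,y)-K(x',y)|+|K(y,x)-K(y,x')|\le C\,\frac{d(x,x')^\delta}{d(x,y)^\delta\,\lambda(x,d(x,y))}\quad (x\neq y,\ x'\neq y,\ d(x,x')\le c\,d(x,y)).$$ A bounded linear operator $T$ on $L^2(\mu)$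 is an ($L^2$-bounded) Calderón–Zygmund operator with kernel $K$ if, for every $f\in L^\infty(\mu)$ with bounded support, $Tf(x)=\int_X K(x,y)f(y)\,d\mu(y)$ for $\mu$-a.e. $x\notin\operatorname{supp} f$. For balls $B\subset Q$ with given centres $x_B,x_Q$ and radii $r_B,r_Q$ put $K_{B,Q}=1+\int_{r_B\le d(x,x_B)\le r_Q}\lambda(x_B,d(x,x_B))^{-1}d\mu(x)$. Fix $\rho>1$. A function $b\in L^1(\mu)$ is an atomic block if it vanishes a.e. outside some ball $B$, $\int b\,d\mu=0$, and $b=\sum_{j}\lambda_ja_j$ in $L^1(\mu)$, where the $\lambda_j$ are scalars and each $a_j$ vanishes a.e. outside a ball $B_j\subset B$ and satisfies $\|a_j\|_{L^\infty(\mu)}\le(\mu(\rho B_j)K_{B_j,B})^{-1}$; put $|b|=\sum_j|\lambda_j|$. The space $H^{1,\infty}_{at}(\mu)$ consists of all $f=\sum_i b_i$ (convergence in $L^1(\mu)$) with atomic blocks $b_i$ such that $\sum_i|b_i|<\infty$, and $\|f\|_{H^{1,\infty}_{at}(\mu)}$ is the infimum of $\sum_i|b_i|$ over all such decompositions. Then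 every $L^2$-bounded Calderón–Zygmund operator $T$ is bounded from $H^{1,\infty}_{at}(\mu)$ into $L^1(\mu)$: there are a linear map $S:H^{1,\infty}_{at}(\mu)\to L^1(\mu)$ and a constant $C$ such that $\|Sf\|_{L^1(\mu)}\le C\|f\|_{H^{1,\infty}_{at}(\mu)}$ for all $f\in H^{1,\infty}_{at}(\mu)$, and $Sf=Tf$ for $f\in H^{1,\infty}_{at}(\mu)\cap L^2(\mu)$. Moreover $T$ is bounded on $L^p(\mu)$ for all $1<p<\infty$: for each such $p$ there is a bounded linear operator on $L^p(\mu)$ that agrees with $T$ on $L^p(\mu)\cap L^2(\mu)$. -/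

import Mathlib

open MeasureTheory Metric Set Filter Topology
open scoped ENNReal NNReal

namespace NonHomogeneous

/-- Geometrically doubling: for some `N`, every open ball of radius `r` is covered by at most `N`
open balls of radius `r / 2`. -/
def GeometricallyDoubling (X : Type*) [MetricSpace X] : Prop :=
  ∃ N : ℕ, ∀ (x : X) (r : ℝ), 0 < r →
    ∃ t : Finset X, t.card ≤ N ∧ ball x r ⊆ ⋃ y ∈ t, ball y (r / 2)

/-- `lam` is a dominating function for `μ`; only its values at radii `r > 0` are relevant. -/
structure IsUpperDoubling {X : Type*} [MetricSpace X] [MeasurableSpace X]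
    (μ : Measure X) (lam : X → ℝ → ℝ) : Prop where
  pos : ∀ x r, 0 < r → 0 < lam x r
  mono : ∀ x r s, 0 < r → r ≤ s → lam x r ≤ lam x s
  doubling : ∃ C : ℝ, 0 < C ∧ ∀ x r, 0 < r → lam x (2 * r) ≤ C * lam x r
  measure_ball_le : ∀ x r, 0 < r → μ (ball x r) ≤ ENNReal.ofReal (lam x r)
  comparable : ∃ C : ℝ, 0 < C ∧ ∀ x y r, 0 < r → dist x y ≤ r → lam x r ≤ C * lam y r

/-- The coefficient `K_{B,Q} = 1 + ∫_{r_B ≤ d(z, x_B) ≤ r_Q} dμ(z) / λ(x_B, d(z, x_B))`, for a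
ball `B` with centre `xB` and radius `rB`, and a ball `Q` of radius `rQ`. -/
noncomputable def coeffK {X : Type*} [MetricSpace X] [MeasurableSpace X]
    (μ : Measure X) (lam : X → ℝ → ℝ) (xB : X) (rB rQ : ℝ) : ℝ≥0∞ :=
  1 + ∫⁻ z in {z | rB ≤ dist z xB ∧ dist z xB ≤ rQ}, ENNReal.ofReal (1 / lam xB (dist z xB)) ∂μ

/-- Calderón–Zygmund kernels; the values on the diagonal are irrelevant. -/
structure IsCZKernel {X : Type*} [MetricSpace X] [MeasurableSpace X] {𝕜 : Type*} [RCLike 𝕜]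
    (μ : Measure X) (lam : X → ℝ → ℝ) (K : X → X → 𝕜) : Prop where
  locallyIntegrable :
    LocallyIntegrableOn (fun p : X × X => K p.1 p.2) {p | p.1 ≠ p.2} (μ.prod μ)
  size : ∃ C : ℝ, ∀ x y, x ≠ y →
    ‖K x y‖ ≤ C * min (1 / lam x (dist x y)) (1 / lam y (dist x y))
  regularity : ∃ δ C c : ℝ, 0 < δ ∧ δ ≤ 1 ∧ 0 < c ∧ ∀ x x' y, x ≠ y → x' ≠ y →
    dist x x' ≤ c * dist x y →
      ‖K x y - K x' y‖ + ‖K y x - K y x'‖ ≤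
        C * (dist x x' ^ δ / (dist x y ^ δ * lam x (dist x y)))

/-- An `L²(μ)`-bounded linear operator `T` is a Calderón–Zygmund operator with kernel `K`:
`T f (x) = ∫ K(x,y) f(y) dμ(y)` for a.e. `x` outside the support of `f`, whenever `f` is an
`L^∞(μ)` function with bounded support. -/
def IsCZOperator {X : Type*} [MetricSpace X] [MeasurableSpace X] {𝕜 : Type*} [RCLike 𝕜]
    {μ : Measure X} (lam : X → ℝ → ℝ) (K : X → X → 𝕜)
    (T : Lp 𝕜 2 μ →L[𝕜] Lp 𝕜 2 μ) : Prop :=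
  IsCZKernel μ lam K ∧
    ∀ (f : X → 𝕜) (hf : MemLp f 2 μ), MemLp f ∞ μ → Bornology.IsBounded (Function.support f) →
      ∀ᵐ x ∂μ, x ∉ tsupport f → T (hf.toLp f) x = ∫ y, K x y * f y ∂μ

/-- `b` is an atomic block with respect to `ρ`, written as `∑ⱼ cⱼ aⱼ` with coefficients `c`:
`b` lives on a ball `B`, has integral zero, and each `aⱼ` lives on a ball `Bⱼ ⊆ B` and satisfies
`‖aⱼ‖_∞ ≤ (μ(ρ Bⱼ) K_{Bⱼ,B})⁻¹`. -/
def IsAtomicBlock {X : Type*} [MetricSpace X] [MeasurableSpace X] {𝕜 : Type*} [RCLike 𝕜]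
    {μ : Measure X} (lam : X → ℝ → ℝ) (ρ : ℝ) (b : Lp 𝕜 1 μ) (c : ℕ → 𝕜) : Prop :=
  ∃ (x : X) (r : ℝ), 0 < r ∧
    (∀ᵐ z ∂μ, z ∉ ball x r → b z = 0) ∧
    ∫ z, b z ∂μ = 0 ∧
    ∃ (a : ℕ → Lp 𝕜 1 μ) (y : ℕ → X) (s : ℕ → ℝ),
      (∀ j, 0 < s j ∧ ball (y j) (s j) ⊆ ball x r ∧
        (∀ᵐ z ∂μ, z ∉ ball (y j) (s j) → a j z = 0) ∧
        eLpNorm (a j) ∞ μ ≤ (μ (ball (y j) (ρ * s j)) * coeffK μ lam (y j) (s j) r)⁻¹) ∧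
      HasSum (fun j => c j • a j) b

/-- `f = ∑ᵢ bᵢ` in `L¹(μ)`, where `bᵢ` is an atomic block with coefficients `c i`. -/
def IsAtomicDecomposition {X : Type*} [MetricSpace X] [MeasurableSpace X]
    {𝕜 : Type*} [RCLike 𝕜] {μ : Measure X} (lam : X → ℝ → ℝ) (ρ : ℝ)
    (f : Lp 𝕜 1 μ) (b : ℕ → Lp 𝕜 1 μ) (c : ℕ → ℕ → 𝕜) : Prop :=
  (∀ i, IsAtomicBlock lam ρ (b i) (c i)) ∧ HasSum b f

/-- The `H^{1,∞}_at(μ)` norm: the infimum of `∑ᵢ ∑ⱼ |cᵢⱼ|` over all decompositions into atomic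
blocks (`∞` if there is no decomposition with a finite sum). -/
noncomputable def hardyNorm {X : Type*} [MetricSpace X] [MeasurableSpace X]
    {𝕜 : Type*} [RCLike 𝕜] {μ : Measure X} (lam : X → ℝ → ℝ) (ρ : ℝ) (f : Lp 𝕜 1 μ) : ℝ≥0∞ :=
  ⨅ (b : ℕ → Lp 𝕜 1 μ) (c : ℕ → ℕ → 𝕜) (_ : IsAtomicDecomposition lam ρ f b c),
    ∑' i, ∑' j, ‖c i j‖ₑ

theorem hardyNorm_lt_top_iff {X : Type*} [MetricSpace X] [MeasurableSpace X]
    {𝕜 : Type*} [RCLike 𝕜] {μ : Measure X} {lam : X → ℝ → ℝ} {ρ : ℝ} {f : Lp 𝕜 1 μ} :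
    hardyNorm lam ρ f < ∞ ↔ ∃ (b : ℕ → Lp 𝕜 1 μ) (c : ℕ → ℕ → 𝕜),
      IsAtomicDecomposition lam ρ f b c ∧ ∑' i, ∑' j, ‖c i j‖ₑ < ∞ := by
  simp only [hardyNorm, iInf_lt_iff, exists_prop]

theorem IsAtomicBlock.smul {X : Type*} [MetricSpace X] [MeasurableSpace X]
    {𝕜 : Type*} [RCLike 𝕜] {μ : Measure X} {lam : X → ℝ → ℝ} {ρ : ℝ} {b : Lp 𝕜 1 μ}
    {c : ℕ → 𝕜} (h : IsAtomicBlock lam ρ b c) (k : 𝕜) :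
    IsAtomicBlock lam ρ (k • b) (fun j => k * c j) := by
  obtain ⟨x, r, hr, hb, hint, a, y, s, ha, hsum⟩ := h
  refine ⟨x, r, hr, ?_, ?_, a, y, s, ha, ?_⟩
  · filter_upwards [hb, Lp.coeFn_smul k b] with z hz hk hzB
    rw [hk, Pi.smul_apply, hz hzB, smul_zero]
  · rw [integral_congr_ae (Lp.coeFn_smul k b)]
    simp only [Pi.smul_apply]
    rw [integral_smul, hint, smul_zero]
  · simpa only [mul_smul] using hsum.const_smul k

theorem isAtomicBlock_zero {X : Type*} [MetricSpace X] [MeasurableSpace X] [Nonempty X]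
    {𝕜 : Type*} [RCLike 𝕜] {μ : Measure X} (lam : X → ℝ → ℝ) (ρ : ℝ) :
    IsAtomicBlock lam ρ (0 : Lp 𝕜 1 μ) (fun _ => 0) := by
  obtain ⟨x⟩ := ‹Nonempty X›
  have h0 : ∀ᵐ z ∂μ, (0 : Lp 𝕜 1 μ) z = 0 := Lp.coeFn_zero 𝕜 1 μ
  refine ⟨x, 1, one_pos, h0.mono fun z hz _ => hz, ?_, fun _ => 0, fun _ => x, fun _ => 1,
    fun j => ⟨one_pos, Subset.rfl, h0.mono fun z hz _ => hz, ?_⟩, ?_⟩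
  · rw [integral_congr_ae (g := fun _ => (0 : 𝕜)) h0, integral_zero]
  · rw [eLpNorm_congr_ae (g := fun _ => (0 : 𝕜)) h0, eLpNorm_zero']
    exact bot_le
  · simp

/-- The atomic Hardy space `H^{1,∞}_at(μ)`, as a linear subspace of `L¹(μ)`. -/
def hardySpace {X : Type*} [MetricSpace X] [MeasurableSpace X] [Nonempty X]
    (𝕜 : Type*) [RCLike 𝕜] (μ : Measure X) (lam : X → ℝ → ℝ) (ρ : ℝ) :
    Submodule 𝕜 (Lp 𝕜 1 μ) where
  carrier := {f | hardyNorm lam ρ f < ∞}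
  zero_mem' := hardyNorm_lt_top_iff.2 ⟨fun _ => 0, fun _ _ => 0,
    ⟨fun _ => isAtomicBlock_zero lam ρ, hasSum_zero⟩, by simp⟩
  add_mem' := by
    intro f g hf hg
    obtain ⟨b, c, ⟨hb, hbf⟩, hc⟩ := hardyNorm_lt_top_iff.1 hf
    obtain ⟨b', c', ⟨hb', hbg⟩, hc'⟩ := hardyNorm_lt_top_iff.1 hg
    let e : ℕ ≃ ℕ ⊕ ℕ := Equiv.natSumNatEquivNat.symm
    refine hardyNorm_lt_top_iff.2 ⟨fun n => Sum.elim b b' (e n), fun n => Sum.elim c c' (e n),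
      ⟨fun n => ?_, ?_⟩, ?_⟩
    · show IsAtomicBlock lam ρ (Sum.elim b b' (e n)) (Sum.elim c c' (e n))
      rcases e n with m | m
      · exact hb m
      · exact hb' m
    · exact (e.hasSum_iff (f := Sum.elim b b')).2 (HasSum.sum hbf hbg)
    · rw [e.tsum_eq (fun i => ∑' j, ‖Sum.elim c c' i j‖ₑ)]
      rw [Summable.tsum_sum ENNReal.summable ENNReal.summable]
      exact ENNReal.add_lt_top.2 ⟨hc, hc'⟩
  smul_mem' := by
    intro k f hf
    obtain ⟨b, c, ⟨hb, hbf⟩, hc⟩ := hardyNorm_lt_top_iff.1 hf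
    refine hardyNorm_lt_top_iff.2 ⟨fun i => k • b i, fun i j => k * c i j,
      ⟨fun i => (hb i).smul k, hbf.const_smul k⟩, ?_⟩
    simp only [enorm_mul, ENNReal.tsum_mul_left]
    exact ENNReal.mul_lt_top enorm_lt_top hc

end NonHomogeneous

/-! Everything rests on the weak type (1,1) inequality `HasStandardKernel.weak_type`, proved by a
Calderón–Zygmund decomposition that does not need `μ` to be doubling. Iterated covering shows that
almost every point is the centre of small doubling balls, which gives a weak density theorem
(`ae_exists_density`). So almost every point where `|f| > t` is the centre of a ball `B` with `t
μ(16 B) ≤ β ∫_B |f|`. `exists_stopping_balls` picks nearly maximal such balls, finitely many and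
disjoint, whose fivefold enlargements cover the points where `|f| > t` up to small measure; the
union of the balls `16 B` is the exceptional set.

Each piece of `f` on a ball `5 B` is balanced by a constant function on a much larger doubling ball
`R`. `exists_large_doubling` finds `R` so that `1/λ` has bounded integral over the annuli between
`16 B` and a dilate of `R`. The difference has mean zero, and its image is integrable off `16 B`:
kernel regularity handles the far region, kernel size and the `L²` bound the annulus
(`lintegral_app_sub_flat_le`). The balls `R` may overlap without bound, so their contribution to the
good part is estimated in `L²` rather than pointwise. By maximality the masses sitting on smaller
balls `R'` that meet `R` add up to at most a constant times `t μ(R)`, and expanding the square with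
the pairs ordered by radius suffices (`lintegral_sum_indicator_sq_le`).

For `1 < p < 2` the `L^p` bound follows by Marcinkiewicz interpolation with `L²`. For `p > 2` it
follows by duality, because the adjoint of `T` has the kernel `conj (K y x)` and satisfies the same
estimates (`adjoint_hasStandardKernel`).

For the Hardy space, `T` is extended through its graph: `h` is an image of `f` if nearby bounded
functions `g` with bounded support have `T g` near `h` in measure. The weak type inequality makes
this relation single valued, and it is a closed subspace of `L¹ × L¹`. It remains to bound images of
atomic blocks. On a bounded dilate of the block's ball each atom has image of bounded `L¹` norm,
since the coefficient `K_{B_j,B}` in its normalisation absorbs the integral of `1/λ` between `B_j`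
and `B`. Outside, the cancellation of the whole block is used. A block is only an `L¹` limit, so the
estimate is made for finite sums of atoms corrected to mean zero by one fixed bump. The correction
disappears in the limit because the block has integral zero (`exists_image_atomicBlock`). -/

namespace NonHomogeneous

/-! ### Dominating functions -/

/-- The dominating function with values in `ℝ≥0∞`. -/
noncomputable def dom {X : Type*} (lam : X → ℝ → ℝ) (x : X) (r : ℝ) : ℝ≥0∞ :=
  ENNReal.ofReal (lam x r)

theorem dom_ne_top {X : Type*} {lam : X → ℝ → ℝ} {x : X} {r : ℝ} : dom lam x r ≠ ∞ :=
  ENNReal.ofReal_ne_top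

namespace IsUpperDoubling

variable {X : Type*} [MetricSpace X] [MeasurableSpace X] {μ : Measure X} {lam : X → ℝ → ℝ}

theorem dom_pos (hμ : IsUpperDoubling μ lam) (x : X) {r : ℝ} (hr : 0 < r) : 0 < dom lam x r :=
  ENNReal.ofReal_pos.2 (hμ.pos x r hr)

theorem dom_ne_zero (hμ : IsUpperDoubling μ lam) (x : X) {r : ℝ} (hr : 0 < r) :
    dom lam x r ≠ 0 := (hμ.dom_pos x hr).ne'

theorem ofReal_one_div (hμ : IsUpperDoubling μ lam) (x : X) {r : ℝ} (hr : 0 < r) :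
    ENNReal.ofReal (1 / lam x r) = (dom lam x r)⁻¹ := by
  rw [one_div, ENNReal.ofReal_inv_of_pos (hμ.pos x r hr), dom]

theorem dom_mono (hμ : IsUpperDoubling μ lam) (x : X) {r s : ℝ} (hr : 0 < r) (h : r ≤ s) :
    dom lam x r ≤ dom lam x s := ENNReal.ofReal_le_ofReal (hμ.mono x r s hr h)

theorem dom_scale (hμ : IsUpperDoubling μ lam) {a : ℝ} (ha : 0 < a) :
    ∃ C : ℝ≥0, ∀ x r, 0 < r → dom lam x (a * r) ≤ C * dom lam x r := by
  obtain ⟨C, hC, h⟩ := hμ.doubling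
  obtain ⟨n, hn⟩ := pow_unbounded_of_one_lt a one_lt_two
  have key : ∀ n : ℕ, ∀ x r, 0 < r → lam x (2 ^ n * r) ≤ C ^ n * lam x r := by
    intro n
    induction n with
    | zero => intro x r _; simp
    | succ n ih =>
      intro x r hr
      calc lam x (2 ^ (n + 1) * r) = lam x (2 * (2 ^ n * r)) := by ring_nf
        _ ≤ C * lam x (2 ^ n * r) := h x _ (by positivity)
        _ ≤ C * (C ^ n * lam x r) := by gcongr; exact ih x r hr
        _ = _ := by ring
  refine ⟨Real.toNNReal (C ^ n), fun x r hr => ?_⟩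
  calc dom lam x (a * r) ≤ dom lam x (2 ^ n * r) := hμ.dom_mono x (by positivity) (by gcongr)
    _ ≤ ENNReal.ofReal (C ^ n * lam x r) := ENNReal.ofReal_le_ofReal (key n x r hr)
    _ = _ := by rw [ENNReal.ofReal_mul (by positivity)]; rfl

/-- Enlarge the radius to `a * r`, change the centre at that scale, and return to `r` by doubling.
This is how `λ` is moved between comparable centres and radii throughout. -/
theorem dom_le (hμ : IsUpperDoubling μ lam) {a : ℝ} (ha : 0 < a) :
    ∃ C : ℝ≥0, ∀ x y r s, 0 < r → 0 < s → dist x y ≤ a * r → s ≤ a * r →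
      dom lam x s ≤ C * dom lam y r := by
  obtain ⟨C, hC⟩ := hμ.dom_scale ha
  obtain ⟨D, hD, h⟩ := hμ.comparable
  refine ⟨Real.toNNReal D * C, fun x y r s hr hs hxy hsr => ?_⟩
  calc dom lam x s ≤ dom lam x (a * r) := hμ.dom_mono x hs hsr
    _ ≤ ENNReal.ofReal (D * lam y (a * r)) :=
      ENNReal.ofReal_le_ofReal (h x y _ (by positivity) hxy)
    _ = Real.toNNReal D * dom lam y (a * r) := by rw [ENNReal.ofReal_mul hD.le]; rfl
    _ ≤ Real.toNNReal D * (C * dom lam y r) := by gcongr; exact hC y r hr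
    _ = _ := by push_cast; ring

theorem measure_closedBall_le (hμ : IsUpperDoubling μ lam) {a : ℝ} (ha : 0 < a) :
    ∃ C : ℝ≥0, ∀ x y r s, 0 < r → dist x y ≤ a * r → s ≤ a * r →
      μ (closedBall x s) ≤ C * dom lam y r := by
  obtain ⟨C, hC⟩ := hμ.dom_le (a := 2 * a) (by positivity)
  refine ⟨C, fun x y r s hr hxy hsr => ?_⟩
  have h0 : 0 < a * r := by positivity
  calc μ (closedBall x s) ≤ μ (ball x (2 * a * r)) :=
        measure_mono (closedBall_subset_ball (by linarith))
    _ ≤ dom lam x (2 * a * r) := hμ.measure_ball_le x _ (by positivity)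
    _ ≤ _ := hC x y r _ hr (by positivity) (by linarith) le_rfl

theorem measure_closedBall_lt_top (hμ : IsUpperDoubling μ lam) (x : X) (r : ℝ) :
    μ (closedBall x r) < ∞ := by
  calc μ (closedBall x r) ≤ μ (ball x (|r| + 1)) :=
        measure_mono (closedBall_subset_ball (by linarith [le_abs_self r]))
    _ ≤ dom lam x (|r| + 1) := hμ.measure_ball_le x _ (by positivity)
    _ < ∞ := ENNReal.ofReal_lt_top

theorem measure_lt_top_of_isBounded (hμ : IsUpperDoubling μ lam) {s : Set X}
    (hs : Bornology.IsBounded s) : μ s < ∞ := by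
  rcases s.eq_empty_or_nonempty with rfl | ⟨x, hx⟩
  · simp
  obtain ⟨r, hr⟩ := hs.subset_closedBall x
  exact (measure_mono hr).trans_lt (hμ.measure_closedBall_lt_top x r)

theorem isLocallyFiniteMeasure (hμ : IsUpperDoubling μ lam) : IsLocallyFiniteMeasure μ :=
  ⟨fun x => ⟨closedBall x 1, closedBall_mem_nhds x one_pos, hμ.measure_closedBall_lt_top x 1⟩⟩

end IsUpperDoubling

/-! ### Geometrically doubling spaces -/

namespace GeometricallyDoubling

variable {X : Type*} [MetricSpace X]

theorem exists_cover (hX : GeometricallyDoubling X) :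
    ∃ N : ℕ, 0 < N ∧ ∀ (k : ℕ) (x : X) (r : ℝ), 0 < r →
      ∃ t : Finset X, t.card ≤ N ^ k ∧ ball x r ⊆ ⋃ y ∈ t, ball y (r / 2 ^ k) := by
  classical
  obtain ⟨N, hN⟩ := hX
  -- Passing to `N + 1` makes the covering number positive, so that its powers can later be
  -- cancelled.
  have hN' : ∀ (x : X) (r : ℝ), 0 < r →
    ∃ t : Finset X, t.card ≤ N + 1 ∧ ball x r ⊆ ⋃ y ∈ t, ball y (r / 2) := fun x r hr => by
      obtain ⟨t, ht, h⟩ := hN x r hr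
      exact ⟨t, ht.trans (Nat.le_succ N), h⟩
  refine ⟨N + 1, Nat.succ_pos N, fun k => ?_⟩
  induction k with
  | zero => exact fun x r _ => ⟨{x}, by simp, by simp⟩
  | succ k ih =>
    intro x r hr
    obtain ⟨t, ht, hcov⟩ := ih x r hr
    have hr' : 0 < r / 2 ^ k := by positivity
    choose u hu hucov using fun y => hN' y (r / 2 ^ k) hr'
    refine ⟨t.biUnion u, ?_, ?_⟩
    · calc (t.biUnion u).card ≤ t.card * (N + 1) := Finset.card_biUnion_le_card_mul _ _ _ fun y _ => hu y
        _ ≤ (N + 1) ^ k * (N + 1) := by gcongr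
        _ = _ := (pow_succ _ _).symm
    · intro z hz
      obtain ⟨y, hy, hzy⟩ := mem_iUnion₂.1 (hcov hz)
      obtain ⟨w, hw, hzw⟩ := mem_iUnion₂.1 (hucov y hzy)
      refine mem_iUnion₂.2 ⟨w, Finset.mem_biUnion.2 ⟨y, hy, hw⟩, ?_⟩
      rwa [pow_succ, ← div_div]

/-- Balls of integer radius about one point have finite nets at every scale, and the union of these
nets is countable and dense. -/
theorem secondCountableTopology (hX : GeometricallyDoubling X) : SecondCountableTopology X := by
  rcases isEmpty_or_nonempty X with h | ⟨⟨x0⟩⟩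
  · infer_instance
  obtain ⟨N, -, hN⟩ := hX.exists_cover
  choose! t _ ht using hN
  refine Metric.secondCountable_of_almost_dense_set fun ε hε => ?_
  refine ⟨⋃ (n : ℕ) (k : ℕ), (t k x0 (n + 1) : Set X),
    countable_iUnion fun n => countable_iUnion fun k => (t k x0 (n + 1)).countable_toSet,
    fun x => ?_⟩
  obtain ⟨n, hn⟩ := exists_nat_gt (dist x x0)
  obtain ⟨k, hk⟩ := pow_unbounded_of_one_lt ((n + 1) / ε) one_lt_two
  have hx : x ∈ ball x0 (n + 1) := by rw [mem_ball]; linarith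
  obtain ⟨y, hy, hxy⟩ := mem_iUnion₂.1 (ht k x0 (n + 1) (by positivity) hx)
  refine ⟨y, mem_iUnion₂.2 ⟨n, k, hy⟩, (mem_ball.1 hxy).le.trans ?_⟩
  rw [div_le_iff₀ (by positivity)]
  rw [div_lt_iff₀ hε] at hk
  linarith

end GeometricallyDoubling

/-! ### Bounded functions with bounded support -/

/-- Essentially bounded functions with bounded support. -/
structure BddSupp {X : Type*} [MetricSpace X] [MeasurableSpace X] {𝕜 : Type*} [RCLike 𝕜]
    (μ : Measure X) (f : X → 𝕜) : Prop where
  memLp_top : MemLp f ∞ μ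
  bounded : Bornology.IsBounded (Function.support f)

namespace BddSupp

variable {X : Type*} [MetricSpace X] [MeasurableSpace X] {𝕜 : Type*} [RCLike 𝕜]
  {μ : Measure X} {lam : X → ℝ → ℝ} {f g : X → 𝕜}

theorem zero : BddSupp μ (0 : X → 𝕜) := ⟨MemLp.zero', by simp⟩

theorem add (hf : BddSupp μ f) (hg : BddSupp μ g) : BddSupp μ (f + g) :=
  ⟨hf.1.add hg.1, (hf.2.union hg.2).subset (Function.support_add f g)⟩

theorem neg (hf : BddSupp μ f) : BddSupp μ (-f) :=
  ⟨hf.1.neg, by rw [Function.support_neg]; exact hf.2⟩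

theorem sub (hf : BddSupp μ f) (hg : BddSupp μ g) : BddSupp μ (f - g) := by
  rw [sub_eq_add_neg]; exact hf.add hg.neg

theorem const_smul (hf : BddSupp μ f) (c : 𝕜) : BddSupp μ (c • f) :=
  ⟨hf.1.const_smul c, hf.2.subset (Function.support_const_smul_subset c f)⟩

theorem sum {ι : Type*} {s : Finset ι} {F : ι → X → 𝕜} (h : ∀ i ∈ s, BddSupp μ (F i)) :
    BddSupp μ (∑ i ∈ s, F i) :=
  Finset.sum_induction _ _ (fun _ _ => add) zero h

theorem indicator (hf : BddSupp μ f) {s : Set X} (hs : MeasurableSet s) :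
    BddSupp μ (s.indicator f) :=
  ⟨hf.1.indicator hs, hf.2.subset (by rw [Set.support_indicator]; exact inter_subset_right)⟩

theorem indicator_const (c : 𝕜) {s : Set X} (hs : MeasurableSet s) (hb : Bornology.IsBounded s) :
    BddSupp μ (s.indicator fun _ => c) :=
  ⟨(memLp_top_const c).indicator hs, hb.subset Set.support_indicator_subset⟩

theorem memLp (hμ : IsUpperDoubling μ lam) (hf : BddSupp μ f) (p : ℝ≥0∞) : MemLp f p μ :=
  hf.1.mono_exponent_of_measure_support_ne_top (s := Function.support f)
    (fun _ hx => Function.notMem_support.1 hx) (hμ.measure_lt_top_of_isBounded hf.2).ne le_top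

theorem integrable (hμ : IsUpperDoubling μ lam) (hf : BddSupp μ f) : Integrable f μ :=
  memLp_one_iff_integrable.1 (hf.memLp hμ 1)

theorem aestronglyMeasurable (hf : BddSupp μ f) : AEStronglyMeasurable f μ := hf.1.1

end BddSupp

/-! ### Operators acting on functions -/

section app

open Classical in
/-- The function `T f`, for a function `f` in `ℒ²(μ)`. -/
noncomputable def app {X : Type*} [MeasurableSpace X] {𝕜 : Type*} [RCLike 𝕜] {μ : Measure X}
    (T : Lp 𝕜 2 μ →L[𝕜] Lp 𝕜 2 μ) (f : X → 𝕜) : X → 𝕜 :=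
  if h : MemLp f 2 μ then T (h.toLp f) else 0

variable {X : Type*} [MeasurableSpace X] {𝕜 : Type*} [RCLike 𝕜] {μ : Measure X}
  (T : Lp 𝕜 2 μ →L[𝕜] Lp 𝕜 2 μ) {f g : X → 𝕜}

theorem app_eq (h : MemLp f 2 μ) : app T f = T (h.toLp f) := by rw [app, dif_pos h]

theorem memLp_app : MemLp (app T f) 2 μ := by
  by_cases h : MemLp f 2 μ
  · rw [app_eq T h]; exact Lp.memLp _
  · rw [app, dif_neg h]; exact MemLp.zero

theorem app_coeFn (f : Lp 𝕜 2 μ) : app T f = T f := by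
  rw [app_eq T (Lp.memLp f), Lp.toLp_coeFn]

theorem app_congr (hf : MemLp f 2 μ) (h : f =ᵐ[μ] g) : app T f = app T g := by
  have hg := (memLp_congr_ae h).1 hf
  rw [app_eq T hf, app_eq T hg, (MemLp.toLp_eq_toLp_iff hf hg).2 h]

theorem app_add (hf : MemLp f 2 μ) (hg : MemLp g 2 μ) :
    app T (f + g) =ᵐ[μ] app T f + app T g := by
  rw [app_eq T hf, app_eq T hg, app_eq T (hf.add hg), MemLp.toLp_add, map_add]
  exact Lp.coeFn_add _ _

theorem app_sub (hf : MemLp f 2 μ) (hg : MemLp g 2 μ) :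
    app T (f - g) =ᵐ[μ] app T f - app T g := by
  rw [app_eq T hf, app_eq T hg, app_eq T (hf.sub hg), MemLp.toLp_sub, map_sub]
  exact Lp.coeFn_sub _ _

theorem app_const_smul (hf : MemLp f 2 μ) (c : 𝕜) : app T (c • f) =ᵐ[μ] c • app T f := by
  rw [app_eq T hf, app_eq T (hf.const_smul c), MemLp.toLp_const_smul, map_smul]
  exact Lp.coeFn_smul _ _

theorem app_zero : app T (0 : X → 𝕜) =ᵐ[μ] 0 := by
  rw [app_eq T MemLp.zero, MemLp.toLp_zero, map_zero]
  exact Lp.coeFn_zero _ _ _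

theorem app_sum {ι : Type*} {s : Finset ι} {F : ι → X → 𝕜} (h : ∀ i ∈ s, MemLp (F i) 2 μ) :
    app T (∑ i ∈ s, F i) =ᵐ[μ] ∑ i ∈ s, app T (F i) := by
  classical
  induction s using Finset.induction_on with
  | empty => simpa using app_zero T
  | insert a s ha ih =>
    rw [Finset.sum_insert ha, Finset.sum_insert ha]
    have h1 := h a (Finset.mem_insert_self a s)
    have h2 : ∀ i ∈ s, MemLp (F i) 2 μ := fun i hi => h i (Finset.mem_insert_of_mem hi)
    exact (app_add T h1 (memLp_finsetSum' s h2)).trans ((EventuallyEq.refl _ _).add (ih h2))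

theorem eLpNorm_app_le (hf : MemLp f 2 μ) : eLpNorm (app T f) 2 μ ≤ ‖T‖ₑ * eLpNorm f 2 μ := by
  rw [app_eq T hf, ← Lp.enorm_def, ← Lp.enorm_toLp hf]
  exact T.le_opENorm _

end app

/-! ### Small doubling balls and a density theorem -/

section SmallBalls

variable {X : Type*} [MetricSpace X] [MeasurableSpace X] {μ : Measure X} {lam : X → ℝ → ℝ}

/-- Almost every point is the centre of arbitrarily small doubling balls. -/
theorem ae_exists_small_doubling (hX : GeometricallyDoubling X) (hμ : IsUpperDoubling μ lam)
    (m : ℕ) : ∃ β : ℝ≥0, 0 < β ∧ ∀ᵐ x ∂μ, ∀ ε : ℝ, 0 < ε → ∃ r, 0 < r ∧ r < ε ∧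
      μ (closedBall x (2 ^ m * r)) ≤ β * μ (closedBall x r) := by
  obtain ⟨N, hN0, hN⟩ := hX.exists_cover
  -- Shrinking the radius by `2 ^ m` multiplies the number of covering balls by `N ^ m`; the extra
  -- factor `2` makes the total measure of a failing set tend to zero.
  refine ⟨2 * N ^ m, by positivity, ?_⟩
  rcases isEmpty_or_nonempty X with hE | ⟨⟨x0⟩⟩
  · exact Eventually.of_forall fun x => (hE.false x).elim
  set β : ℝ≥0 := 2 * N ^ m with hβ
  -- The points of a fixed ball at which the doubling inequality fails, or is at best an equality in
  -- reverse, at all scales up to `2 ^ (-n)`.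
  let E : ℕ → ℕ → Set X := fun n l => {x | x ∈ ball x0 (2 ^ l) ∧ ∀ r : ℝ, 0 < r →
    r ≤ (2 ^ n)⁻¹ → (β : ℝ≥0∞) * μ (closedBall x r) ≤ μ (closedBall x (2 ^ m * r))}
  have hE : ∀ n l, μ (E n l) = 0 := by
    intro n l
    set M := μ (closedBall x0 (2 ^ l + 1)) with hM
    have hMtop : M < ∞ := hμ.measure_closedBall_lt_top _ _
    -- decay of the measure of small balls
    have decay : ∀ k : ℕ, ∀ x ∈ E n l,
        (β : ℝ≥0∞) ^ k * μ (closedBall x ((2 ^ n)⁻¹ / (2 ^ m) ^ k)) ≤ M := by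
      intro k x hx
      induction k with
      | zero =>
        simp only [pow_zero, one_mul, div_one]
        refine measure_mono (closedBall_subset_closedBall' ?_)
        have h1 : ((2 : ℝ) ^ n)⁻¹ ≤ 1 := inv_le_one_of_one_le₀ (one_le_pow₀ one_le_two)
        have h2 := mem_ball.1 hx.1
        linarith
      | succ k ih =>
        refine le_trans ?_ ih
        rw [pow_succ, mul_assoc]
        gcongr
        have h1 : (1 : ℝ) ≤ (2 ^ m) ^ (k + 1) := one_le_pow₀ (one_le_pow₀ one_le_two)
        have := hx.2 ((2 ^ n)⁻¹ / (2 ^ m) ^ (k + 1)) (by positivity)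
          (div_le_self (by positivity) h1)
        refine this.trans (le_of_eq ?_)
        congr 2
        field_simp
        ring
    have hβ0 : (β : ℝ≥0∞) ≠ 0 := by
      rw [hβ]; exact_mod_cast (by positivity : (2 * (N : ℝ≥0) ^ m) ≠ 0)
    have bound : ∀ k : ℕ, μ (E n l) ≤ (N : ℝ≥0∞) ^ (l + n + 1) * M * (2⁻¹) ^ k := by
      intro k
      -- The covering balls have half the radius `2 ^ (-n) / (2 ^ m) ^ k` of `decay`, so each one
      -- that meets `E n l` lies in a ball of that radius about a point of `E n l`.
      obtain ⟨t, htc, ht⟩ := hN (l + n + 1 + m * k) x0 (2 ^ l) (by positivity)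
      have hcov : E n l ⊆ ⋃ y ∈ t, (ball y (2 ^ l / 2 ^ (l + n + 1 + m * k)) ∩ E n l) := by
        intro z hz
        obtain ⟨y, hy, hzy⟩ := mem_iUnion₂.1 (ht hz.1)
        exact mem_iUnion₂.2 ⟨y, hy, hzy, hz⟩
      have hpiece : ∀ y ∈ t, μ (ball y (2 ^ l / 2 ^ (l + n + 1 + m * k)) ∩ E n l) ≤
          ((β : ℝ≥0∞) ^ k)⁻¹ * M := by
        intro y _
        rcases (ball y (2 ^ l / 2 ^ (l + n + 1 + m * k)) ∩ E n l).eq_empty_or_nonempty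
          with h | ⟨x, hxy, hx⟩
        · simp [h]
        rw [mul_comm _ M, ← div_eq_mul_inv, ENNReal.le_div_iff_mul_le
          (Or.inl (pow_ne_zero _ hβ0)) (Or.inl (ENNReal.pow_ne_top ENNReal.coe_ne_top)), mul_comm _ ((β : ℝ≥0∞) ^ k)]
        refine le_trans ?_ (decay k x hx)
        gcongr
        refine inter_subset_left.trans ?_
        intro z hz
        rw [mem_closedBall]
        have h1 := mem_ball.1 hxy
        have h2 := mem_ball.1 hz
        have h3 : (2 : ℝ) ^ l / 2 ^ (l + n + 1 + m * k) = (2 ^ n)⁻¹ / (2 ^ m) ^ k / 2 := by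
          field_simp; ring
        rw [h3] at h1 h2
        linarith [dist_triangle_right z x y]
      calc μ (E n l) ≤ ∑ y ∈ t, μ (ball y (2 ^ l / 2 ^ (l + n + 1 + m * k)) ∩ E n l) :=
            (measure_mono hcov).trans (measure_biUnion_finset_le _ _)
        _ ≤ ∑ y ∈ t, ((β : ℝ≥0∞) ^ k)⁻¹ * M := Finset.sum_le_sum hpiece
        _ = t.card * (((β : ℝ≥0∞) ^ k)⁻¹ * M) := by rw [Finset.sum_const, nsmul_eq_mul]
        _ ≤ (N : ℝ≥0∞) ^ (l + n + 1 + m * k) * (((β : ℝ≥0∞) ^ k)⁻¹ * M) := by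
            gcongr; exact_mod_cast htc
        _ = (N : ℝ≥0∞) ^ (l + n + 1) * M * (2⁻¹) ^ k := by
            have hb : (β : ℝ≥0∞) ^ k = 2 ^ k * ((N : ℝ≥0∞) ^ m) ^ k := by
              rw [hβ]; push_cast; rw [mul_pow]
            have hn0 : ((N : ℝ≥0∞) ^ m) ^ k ≠ 0 := by
              have : (N : ℝ≥0∞) ≠ 0 := by exact_mod_cast hN0.ne'
              exact pow_ne_zero _ (pow_ne_zero _ this)
            have hnt : ((N : ℝ≥0∞) ^ m) ^ k ≠ ∞ :=
              ENNReal.pow_ne_top (ENNReal.pow_ne_top (ENNReal.natCast_ne_top N))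
            rw [hb, pow_add, pow_mul, ENNReal.mul_inv (Or.inr hnt) (Or.inr hn0), ENNReal.inv_pow]
            calc (N : ℝ≥0∞) ^ (l + n + 1) * ((N : ℝ≥0∞) ^ m) ^ k *
                  ((2⁻¹) ^ k * (((N : ℝ≥0∞) ^ m) ^ k)⁻¹ * M)
                = (N : ℝ≥0∞) ^ (l + n + 1) * M * (2⁻¹) ^ k *
                  (((N : ℝ≥0∞) ^ m) ^ k * (((N : ℝ≥0∞) ^ m) ^ k)⁻¹) := by ring
              _ = _ := by rw [ENNReal.mul_inv_cancel hn0 hnt, mul_one]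
    have hlim : Tendsto (fun k : ℕ => (N : ℝ≥0∞) ^ (l + n + 1) * M * (2⁻¹) ^ k) atTop (𝓝 0) := by
      have h2 : (2⁻¹ : ℝ≥0∞) < 1 := by simp
      have := ENNReal.Tendsto.const_mul (ENNReal.tendsto_pow_atTop_nhds_zero_of_lt_one h2)
        (a := (N : ℝ≥0∞) ^ (l + n + 1) * M) (Or.inr (ENNReal.mul_ne_top
          (ENNReal.pow_ne_top (ENNReal.natCast_ne_top N)) hMtop.ne))
      simpa using this
    exact le_antisymm (ge_of_tendsto' hlim bound) bot_le
  have hnull : μ (⋃ n, ⋃ l, E n l) = 0 :=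
    measure_iUnion_null fun n => measure_iUnion_null fun l => hE n l
  filter_upwards [measure_eq_zero_iff_ae_notMem.1 hnull] with x hx ε hε
  by_contra! hcon
  apply hx
  obtain ⟨n, hn⟩ := exists_pow_lt_of_lt_one hε (by norm_num : (2⁻¹ : ℝ) < 1)
  obtain ⟨l, hl⟩ := pow_unbounded_of_one_lt (dist x x0) one_lt_two
  refine mem_iUnion₂.2 ⟨n, l, hl, fun r hr hrn => (hcon r hr ?_).le⟩
  rw [inv_pow] at hn
  exact hrn.trans_lt hn

variable [BorelSpace X]

/-- A substitute for the Lebesgue density theorem: almost every point of `A` is the centre of a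
ball in which `A` has density at least `β⁻¹` with respect to an enlarged ball. -/
theorem ae_exists_density (hX : GeometricallyDoubling X) (hμ : IsUpperDoubling μ lam) (m : ℕ) :
    ∃ β : ℝ≥0, 0 < β ∧ ∀ A : Set X, μ A < ∞ → ∀ᵐ x ∂μ, x ∈ A →
      ∃ r, 0 < r ∧ μ (closedBall x (2 ^ m * r)) < β * μ (A ∩ closedBall x r) := by
  have := hX.secondCountableTopology
  have := hμ.isLocallyFiniteMeasure
  -- The extra `3` pays for the Vitali factor: `5 ≤ 2 ^ 3`.
  obtain ⟨β, hβ, hsmall⟩ := ae_exists_small_doubling hX hμ (m + 3)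
  refine ⟨2 * β, by positivity, fun A hA => ?_⟩
  set E : Set X := {x | x ∈ A ∧ (∀ r, 0 < r →
    ((2 * β : ℝ≥0) : ℝ≥0∞) * μ (A ∩ closedBall x r) ≤ μ (closedBall x (2 ^ m * r))) ∧
    ∀ ε : ℝ, 0 < ε → ∃ r, 0 < r ∧ r < ε ∧
      μ (closedBall x (2 ^ (m + 3) * r)) ≤ β * μ (closedBall x r)} with hEdef
  have hEA : E ⊆ A := fun x hx => hx.1
  have hEtop : μ E < ∞ := (measure_mono hEA).trans_lt hA
  -- Small doubling balls inside `U` are selected by Vitali; `A` is thin in their enlargements, so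
  -- `E` carries at most half of their total measure. Outer regularity then forces `μ E = 0`.
  have key : ∀ U : Set X, IsOpen U → E ⊆ U → 2 * μ E ≤ μ U := by
    intro U hU hEU
    have hex : ∀ x ∈ E, ∃ r, 0 < r ∧ r < 1 ∧ closedBall x r ⊆ U ∧
        μ (closedBall x (2 ^ (m + 3) * r)) ≤ β * μ (closedBall x r) := by
      intro x hx
      obtain ⟨ε, hε, hεU⟩ := Metric.nhds_basis_closedBall.mem_iff.1 (hU.mem_nhds (hEU hx))
      obtain ⟨r, hr, hrε, h⟩ := hx.2.2 (min ε 1) (by positivity)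
      exact ⟨r, hr, hrε.trans_le (min_le_right _ _),
        (closedBall_subset_closedBall (hrε.le.trans (min_le_left _ _))).trans hεU, h⟩
    choose! r hr0 hr1 hrU hrd using hex
    obtain ⟨u, huE, hdisj, hcov⟩ := Vitali.exists_disjoint_subfamily_covering_enlargement_closedBall
      E (fun x => x) r 1 (fun x hx => (hr1 x hx).le) 5 (by norm_num)
    have hucount : u.Countable := hdisj.countable_of_nonempty_interior fun x hx =>
      ⟨x, ball_subset_interior_closedBall (mem_ball_self (hr0 x (huE hx)))⟩
    have hβ0 : (β : ℝ≥0∞) ≠ 0 := by exact_mod_cast hβ.ne'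
    have hE1 : E ⊆ ⋃ x ∈ u, A ∩ closedBall x (5 * r x) := by
      intro z hz
      obtain ⟨b, hb, hzb⟩ := hcov z hz
      exact mem_iUnion₂.2 ⟨b, hb, hz.1, hzb (mem_closedBall_self (hr0 z hz).le)⟩
    have hpiece : ∀ x ∈ u, β * 2 * μ (A ∩ closedBall x (5 * r x)) ≤ β * μ (closedBall x (r x)) := by
      intro x hx
      have h0 := hr0 x (huE hx)
      calc (β : ℝ≥0∞) * 2 * μ (A ∩ closedBall x (5 * r x))
          = ((2 * β : ℝ≥0) : ℝ≥0∞) * μ (A ∩ closedBall x (5 * r x)) := by push_cast; ring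
        _ ≤ μ (closedBall x (2 ^ m * (5 * r x))) := (huE hx).2.1 _ (by positivity)
        _ ≤ μ (closedBall x (2 ^ (m + 3) * r x)) := by
            refine measure_mono (closedBall_subset_closedBall ?_)
            have : (0:ℝ) < 2 ^ m * r x := by positivity
            rw [pow_add]; nlinarith
        _ ≤ _ := hrd x (huE hx)
    have hdisjU : ∑' x : u, μ (closedBall (x : X) (r x)) ≤ μ U := by
      rw [← measure_biUnion hucount hdisj fun x _ => measurableSet_closedBall]
      exact measure_mono (iUnion₂_subset fun x hx => hrU x (huE hx))
    have : (β : ℝ≥0∞) * (2 * μ E) ≤ β * μ U := by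
      calc (β : ℝ≥0∞) * (2 * μ E) ≤ β * (2 * ∑' x : u, μ (A ∩ closedBall (x : X) (5 * r x))) := by
            gcongr
            exact (measure_mono hE1).trans (measure_biUnion_le μ hucount _)
        _ = ∑' x : u, β * 2 * μ (A ∩ closedBall (x : X) (5 * r x)) := by
            rw [ENNReal.tsum_mul_left, mul_assoc]
        _ ≤ ∑' x : u, β * μ (closedBall (x : X) (r x)) :=
            ENNReal.tsum_le_tsum fun x => hpiece x x.2
        _ = β * ∑' x : u, μ (closedBall (x : X) (r x)) := ENNReal.tsum_mul_left
        _ ≤ β * μ U := by gcongr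
    exact (ENNReal.mul_le_mul_iff_right hβ0 ENNReal.coe_ne_top).1 this
  have hE0 : μ E = 0 := by
    by_contra hne
    have hlt : μ E < 2 * μ E := by
      rw [two_mul]
      exact ENNReal.lt_add_right hEtop.ne hne
    obtain ⟨U, hEU, hU, hlt'⟩ := E.exists_isOpen_lt_of_lt _ hlt
    exact absurd (key U hU hEU) (not_le.2 hlt')
  filter_upwards [hsmall, measure_eq_zero_iff_ae_notMem.1 hE0] with x hx hxE hxA
  by_contra! hcon
  exact hxE ⟨hxA, fun r hr => hcon r hr, hx⟩

end SmallBalls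

/-! ### Integrals of `1/λ` over annuli and tails -/

section Annuli

variable {X : Type*} [MetricSpace X] [MeasurableSpace X] [BorelSpace X]
  {μ : Measure X} {lam : X → ℝ → ℝ}

theorem measurableSet_annulus (x : X) (s R : ℝ) :
    MeasurableSet {z | s ≤ dist z x ∧ dist z x ≤ R} := by
  have h : IsClosed {z | s ≤ dist z x ∧ dist z x ≤ R} :=
    (isClosed_le continuous_const (continuous_id.dist continuous_const)).inter
      (isClosed_le (continuous_id.dist continuous_const) continuous_const)
  exact h.measurableSet

theorem lintegral_annulus_le (hμ : IsUpperDoubling μ lam) (x : X) {s R : ℝ} (hs : 0 < s) :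
    ∫⁻ z in {z | s ≤ dist z x ∧ dist z x ≤ R}, (dom lam x (dist z x))⁻¹ ∂μ ≤
      μ (closedBall x R) * (dom lam x s)⁻¹ := by
  calc ∫⁻ z in {z | s ≤ dist z x ∧ dist z x ≤ R}, (dom lam x (dist z x))⁻¹ ∂μ
      ≤ ∫⁻ z in {z | s ≤ dist z x ∧ dist z x ≤ R}, (dom lam x s)⁻¹ ∂μ := by
        refine setLIntegral_mono' (measurableSet_annulus x s R) fun z hz => ?_
        exact ENNReal.inv_le_inv.2 (hμ.dom_mono x hs hz.1)
    _ = (dom lam x s)⁻¹ * μ {z | s ≤ dist z x ∧ dist z x ≤ R} := setLIntegral_const _ _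
    _ ≤ _ := by
        rw [mul_comm]
        gcongr
        exact fun z hz => hz.2

omit [BorelSpace X] in
theorem lintegral_annulus_add_le (x : X) (s R R' : ℝ) (g : X → ℝ≥0∞) :
    ∫⁻ z in {z | s ≤ dist z x ∧ dist z x ≤ R'}, g z ∂μ ≤
      ∫⁻ z in {z | s ≤ dist z x ∧ dist z x ≤ R}, g z ∂μ +
      ∫⁻ z in {z | R ≤ dist z x ∧ dist z x ≤ R'}, g z ∂μ := by
  refine (lintegral_mono_set fun z hz => ?_).trans (lintegral_union_le _ _ _)
  rcases le_total (dist z x) R with h | h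
  · exact Or.inl ⟨hz.1, h⟩
  · exact Or.inr ⟨h, hz.2⟩

/-- Along radii growing by `2 ^ m`, `λ` grows by at most a factor `A` per step. A measure growing by
more than `2 * A` at every step would outrun `λ`, so there is a first step without such growth.
Before it the ratio of `μ(B)` to `λ` at least doubles each time, and the integrals over the
successive annuli are dominated by the last one. -/
theorem exists_large_doubling (hμ : IsUpperDoubling μ lam) (m : ℕ) :
    ∃ β C : ℝ≥0, ∀ (x : X) (a : ℝ), 0 < a → 0 < μ (closedBall x a) →
      ∃ ρ, a ≤ ρ ∧ μ (closedBall x (2 ^ m * ρ)) ≤ β * μ (closedBall x ρ) ∧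
        ∫⁻ z in {z | a ≤ dist z x ∧ dist z x ≤ 2 ^ m * ρ}, (dom lam x (dist z x))⁻¹ ∂μ ≤ C := by
  obtain ⟨A', hA'⟩ := hμ.dom_scale (a := 2 ^ m) (by positivity)
  set A : ℝ≥0 := A' + 1 with hAdef
  have hA : ∀ x r, 0 < r → dom lam x (2 ^ m * r) ≤ A * dom lam x r := fun x r hr =>
    (hA' x r hr).trans (by gcongr; simp [hAdef])
  have hA1 : (1 : ℝ≥0∞) ≤ A := by simp [hAdef]
  have hA0 : (A : ℝ≥0∞) ≠ 0 := (zero_lt_one.trans_le hA1).ne'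
  obtain ⟨D, hD'⟩ := hμ.measure_closedBall_le one_pos
  have hD : ∀ x r, 0 < r → μ (closedBall x r) ≤ D * dom lam x r := fun x r hr =>
    hD' x x r r hr (by simpa using hr.le) (by simp)
  refine ⟨2 * A, 2 * A * D + A * D, fun x a ha hxa => ?_⟩
  set r : ℕ → ℝ := fun k => (2 ^ m) ^ k * a with hr
  have hr0 : ∀ k, 0 < r k := fun k => by positivity
  have hrs : ∀ k, r (k + 1) = 2 ^ m * r k := fun k => by simp only [hr]; ring
  set b : ℕ → ℝ≥0∞ := fun k => μ (closedBall x (r k)) with hb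
  set L : ℕ → ℝ≥0∞ := fun k => dom lam x (r k) with hL
  have hL0 : ∀ k, L k ≠ 0 := fun k => hμ.dom_ne_zero x (hr0 k)
  have hLt : ∀ k, L k ≠ ∞ := fun k => dom_ne_top
  have hLs : ∀ k, L (k + 1) ≤ A * L k := fun k => by
    simp only [hL, hrs]; exact hA x _ (hr0 k)
  have hbL : ∀ k, b k ≤ D * L k := fun k => hD x _ (hr0 k)
  have hex : ∃ k, b (k + 1) ≤ 2 * A * b k := by
    by_contra! hcon
    have h1 : ∀ k, (2 * A) ^ k * b 0 ≤ b k := by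
      intro k
      induction k with
      | zero => simp
      | succ k ih =>
        calc (2 * A : ℝ≥0∞) ^ (k + 1) * b 0 = 2 * A * ((2 * A) ^ k * b 0) := by ring
          _ ≤ 2 * A * b k := by gcongr
          _ ≤ _ := (hcon k).le
    have h2 : ∀ k, L k ≤ A ^ k * L 0 := by
      intro k
      induction k with
      | zero => simp
      | succ k ih =>
        calc L (k + 1) ≤ A * L k := hLs k
          _ ≤ A * (A ^ k * L 0) := by gcongr
          _ = _ := by ring
    have h3 : ∀ k : ℕ, 2 ^ k * b 0 ≤ D * L 0 := by
      intro k
      have hAk : (A : ℝ≥0∞) ^ k ≠ 0 := pow_ne_zero _ hA0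
      refine (ENNReal.mul_le_mul_iff_right hAk (ENNReal.pow_ne_top ENNReal.coe_ne_top)).1 ?_
      calc (A : ℝ≥0∞) ^ k * (2 ^ k * b 0) = (2 * A) ^ k * b 0 := by rw [mul_pow]; ring
        _ ≤ D * L k := (h1 k).trans (hbL k)
        _ ≤ D * (A ^ k * L 0) := by gcongr; exact h2 k
        _ = _ := by ring
    have hb0 : b 0 ≠ 0 := by simpa [hb, hr] using hxa.ne'
    have hDL : D * L 0 ≠ ∞ := ENNReal.mul_ne_top ENNReal.coe_ne_top (hLt 0)
    have hlt : D * L 0 / b 0 < ∞ := ENNReal.div_lt_top hDL hb0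
    obtain ⟨n, hn⟩ := ENNReal.exists_nat_gt hlt.ne
    have h4 : D * L 0 < n * b 0 := by
      rwa [ENNReal.div_lt_iff (Or.inl hb0)
        (Or.inl (hμ.measure_closedBall_lt_top x _).ne)] at hn
    refine absurd (h3 n) (not_le.2 (h4.trans_le ?_))
    gcongr
    exact_mod_cast (Nat.lt_two_pow_self).le
  classical
  set N := Nat.find hex
  have hN : b (N + 1) ≤ 2 * A * b N := Nat.find_spec hex
  have hmin : ∀ k < N, 2 * A * b k ≤ b (k + 1) := fun k hk =>
    (not_le.1 (Nat.find_min hex hk)).le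
  have hr00 : r 0 = a := by simp [hr]
  -- The bound reproduces itself: the old integral and the new annulus each contribute at most `b (j
  -- + 1) / L j`, and `1 / L j ≤ A / L (j + 1)`.
  have hI : ∀ j ≤ N, ∫⁻ z in {z | a ≤ dist z x ∧ dist z x ≤ r j}, (dom lam x (dist z x))⁻¹ ∂μ ≤
      2 * A * b j * (L j)⁻¹ := by
    intro j
    induction j with
    | zero =>
      intro _
      refine (lintegral_annulus_le hμ x ha).trans ?_
      simp only [hb, hL, hr00]
      gcongr
      calc μ (closedBall x a) = 1 * 1 * μ (closedBall x a) := by simp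
        _ ≤ _ := by gcongr; exact one_le_two
    | succ j ih =>
      intro hj
      have hstep : 2 * A * b j * (L j)⁻¹ ≤ b (j + 1) * (L j)⁻¹ := by
        gcongr; exact hmin j hj
      calc _ ≤ _ := lintegral_annulus_add_le x a (r j) (r (j + 1)) _
        _ ≤ b (j + 1) * (L j)⁻¹ + b (j + 1) * (L j)⁻¹ :=
          add_le_add ((ih (by omega)).trans hstep) (lintegral_annulus_le hμ x (hr0 j))
        _ = 2 * b (j + 1) * (L j)⁻¹ := by ring
        _ ≤ 2 * b (j + 1) * (A * (L (j + 1))⁻¹) := by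
          gcongr
          rw [← div_eq_mul_inv, ENNReal.le_div_iff_mul_le (Or.inl (hL0 _)) (Or.inl (hLt _)),
            mul_comm, ← div_eq_mul_inv, ENNReal.div_le_iff (hL0 _) (hLt _)]
          exact hLs j
        _ = _ := by ring
  refine ⟨r N, ?_, ?_, ?_⟩
  · have : (1 : ℝ) ≤ (2 ^ m) ^ N := one_le_pow₀ (one_le_pow₀ one_le_two)
    simp only [hr]
    nlinarith
  · have := hN
    simp only [hb, hrs] at this
    exact_mod_cast this
  · refine (lintegral_annulus_add_le x a (r N) _ _).trans ?_
    push_cast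
    refine add_le_add ((hI N le_rfl).trans ?_) ((lintegral_annulus_le hμ x (hr0 N)).trans ?_)
    · rw [← div_eq_mul_inv, ENNReal.div_le_iff (hL0 _) (hLt _), mul_assoc (2 * (A : ℝ≥0∞))]
      gcongr
      exact hbL N
    · rw [← div_eq_mul_inv, ENNReal.div_le_iff (hL0 _) (hLt _), ← hrs]
      calc μ (closedBall x (r (N + 1))) ≤ D * L (N + 1) := hbL _
        _ ≤ D * (A * L N) := by gcongr; exact hLs N
        _ = _ := by ring

/-- The tail integral controlling kernels with Hölder regularity. -/
theorem lintegral_tail_le (hμ : IsUpperDoubling μ lam) {δ : ℝ} (hδ : 0 < δ) :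
    ∃ C : ℝ≥0, ∀ (x : X) (r : ℝ), 0 < r →
      ∫⁻ z in {z | r ≤ dist z x},
        ENNReal.ofReal (r ^ δ / dist z x ^ δ) * (dom lam x (dist z x))⁻¹ ∂μ ≤ C := by
  obtain ⟨D, hD⟩ := hμ.measure_closedBall_le (a := 2) two_pos
  set q : ℝ≥0∞ := ENNReal.ofReal ((2 : ℝ) ^ (-δ)) with hq
  have hq1 : q < 1 := by
    rw [hq, ENNReal.ofReal_lt_one]
    exact Real.rpow_lt_one_of_one_lt_of_neg one_lt_two (by linarith)
  have hsum : ∑' k : ℕ, q ^ k ≠ ∞ := by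
    rw [ENNReal.tsum_geometric]
    exact ENNReal.inv_ne_top.2 (tsub_pos_of_lt hq1).ne'
  refine ⟨D * (∑' k : ℕ, q ^ k).toNNReal, fun x r hr => ?_⟩
  have hcov : {z | r ≤ dist z x} ⊆
      ⋃ k : ℕ, {z | 2 ^ k * r ≤ dist z x ∧ dist z x ≤ 2 * (2 ^ k * r)} := by
    intro z hz
    have h1 : 1 ≤ dist z x / r := by rw [le_div_iff₀ hr]; simpa using hz
    obtain ⟨k, hk1, hk2⟩ := exists_nat_pow_near h1 one_lt_two
    rw [le_div_iff₀ hr] at hk1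
    rw [div_lt_iff₀ hr] at hk2
    refine mem_iUnion.2 ⟨k, hk1, ?_⟩
    rw [pow_succ] at hk2; linarith
  have hpiece : ∀ k : ℕ, ∫⁻ z in {z | 2 ^ k * r ≤ dist z x ∧ dist z x ≤ 2 * (2 ^ k * r)},
      ENNReal.ofReal (r ^ δ / dist z x ^ δ) * (dom lam x (dist z x))⁻¹ ∂μ ≤ D * q ^ k := by
    intro k
    have h0 : 0 < 2 ^ k * r := by positivity
    have hqk : q ^ k = ENNReal.ofReal (r ^ δ / (2 ^ k * r) ^ δ) := by
      rw [hq, ← ENNReal.ofReal_pow (by positivity)]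
      congr 1
      rw [Real.mul_rpow (by positivity) hr.le, ← Real.rpow_natCast, ← Real.rpow_mul (by norm_num),
        ← Real.rpow_natCast, ← Real.rpow_mul (by norm_num), neg_mul, mul_comm δ,
        Real.rpow_neg (by norm_num)]
      have : r ^ δ ≠ 0 := (Real.rpow_pos_of_pos hr δ).ne'
      field_simp
    calc _ ≤ ∫⁻ z in {z | 2 ^ k * r ≤ dist z x ∧ dist z x ≤ 2 * (2 ^ k * r)},
          q ^ k * (dom lam x (dist z x))⁻¹ ∂μ := by
          refine setLIntegral_mono' (measurableSet_annulus x _ _) fun z hz => ?_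
          rw [hqk]
          gcongr
          exact hz.1
      _ = q ^ k * ∫⁻ z in {z | 2 ^ k * r ≤ dist z x ∧ dist z x ≤ 2 * (2 ^ k * r)},
          (dom lam x (dist z x))⁻¹ ∂μ := lintegral_const_mul' _ _
            (ENNReal.pow_ne_top ENNReal.ofReal_ne_top)
      _ ≤ q ^ k * (μ (closedBall x (2 * (2 ^ k * r))) * (dom lam x (2 ^ k * r))⁻¹) := by
          gcongr; exact lintegral_annulus_le hμ x h0
      _ ≤ q ^ k * D := by
          gcongr
          rw [← div_eq_mul_inv, ENNReal.div_le_iff (hμ.dom_ne_zero x h0) dom_ne_top]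
          exact hD x x _ _ h0 (by simpa using h0.le) le_rfl
      _ = _ := mul_comm _ _
  calc _ ≤ _ := lintegral_mono_set hcov
    _ ≤ _ := lintegral_iUnion_le _ _
    _ ≤ ∑' k : ℕ, D * q ^ k := ENNReal.tsum_le_tsum hpiece
    _ = _ := by rw [ENNReal.tsum_mul_left, ENNReal.coe_mul, ENNReal.coe_toNNReal hsum]

end Annuli

/-! ### Kernel estimates -/

/-- The properties of a Calderón–Zygmund operator used for the weak type `(1,1)` estimate. -/
structure HasStandardKernel {X : Type*} [MetricSpace X] [MeasurableSpace X] {𝕜 : Type*} [RCLike 𝕜]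
    {μ : Measure X} (lam : X → ℝ → ℝ) (K : X → X → 𝕜)
    (T : Lp 𝕜 2 μ →L[𝕜] Lp 𝕜 2 μ) : Prop where
  size : ∃ C : ℝ≥0, ∀ x y, x ≠ y → ‖K x y‖ₑ ≤ C * (dom lam y (dist x y))⁻¹
  regularity : ∃ (δ c : ℝ) (C : ℝ≥0), 0 < δ ∧ 0 < c ∧ ∀ x y z, x ≠ z → y ≠ z →
    dist x y ≤ c * dist x z →
      ‖K z y - K z x‖ₑ ≤ C * ENNReal.ofReal (dist x y ^ δ / dist x z ^ δ) *
        (dom lam x (dist x z))⁻¹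
  representation : ∀ f : X → 𝕜, BddSupp μ f →
    ∀ᵐ x ∂μ, x ∉ tsupport f → app T f x = ∫ y, K x y * f y ∂μ

/-- The hypothesis is the bare inequality rather than `IsCZKernel`, so that the conjugate transposed
kernel is covered without discussing its local integrability. -/
theorem exists_enorm_le_of_size {X : Type*} [MetricSpace X] [MeasurableSpace X]
    {𝕜 : Type*} [RCLike 𝕜] {μ : Measure X} {lam : X → ℝ → ℝ} {K : X → X → 𝕜}
    (hμ : IsUpperDoubling μ lam) (h : ∃ C : ℝ, ∀ x y, x ≠ y →
      ‖K x y‖ ≤ C * min (1 / lam x (dist x y)) (1 / lam y (dist x y))) :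
    ∃ C : ℝ≥0, ∀ x y, x ≠ y → ‖K x y‖ₑ ≤ C * (dom lam y (dist x y))⁻¹ := by
  obtain ⟨C, hC⟩ := h
  refine ⟨Real.toNNReal C, fun x y hxy => ?_⟩
  have hd : 0 < dist x y := dist_pos.2 hxy
  have h0 : 0 ≤ min (1 / lam x (dist x y)) (1 / lam y (dist x y)) :=
    le_min (one_div_nonneg.2 (hμ.pos x _ hd).le) (one_div_nonneg.2 (hμ.pos y _ hd).le)
  rw [← hμ.ofReal_one_div y hd, ← ofReal_norm]
  calc ENNReal.ofReal ‖K x y‖ ≤ ENNReal.ofReal (C * _) := ENNReal.ofReal_le_ofReal (hC x y hxy)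
    _ = ENNReal.ofReal C * ENNReal.ofReal _ := ENNReal.ofReal_mul' h0
    _ ≤ _ := by
      rw [ENNReal.ofReal]
      gcongr
      exact min_le_right _ _

theorem exists_enorm_sub_le_of_regularity {X : Type*} [MetricSpace X] [MeasurableSpace X]
    {𝕜 : Type*} [RCLike 𝕜] {μ : Measure X} {lam : X → ℝ → ℝ} {K : X → X → 𝕜}
    (hμ : IsUpperDoubling μ lam) (h : ∃ δ C c : ℝ, 0 < δ ∧ δ ≤ 1 ∧ 0 < c ∧ ∀ x x' y, x ≠ y →
      x' ≠ y → dist x x' ≤ c * dist x y → ‖K x y - K x' y‖ + ‖K y x - K y x'‖ ≤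
        C * (dist x x' ^ δ / (dist x y ^ δ * lam x (dist x y)))) :
    ∃ (δ c : ℝ) (C : ℝ≥0), 0 < δ ∧ 0 < c ∧ ∀ x y z, x ≠ z → y ≠ z → dist x y ≤ c * dist x z →
      ‖K z y - K z x‖ₑ ≤ C * ENNReal.ofReal (dist x y ^ δ / dist x z ^ δ) *
        (dom lam x (dist x z))⁻¹ := by
  obtain ⟨δ, C, c, hδ, -, hc, h⟩ := h
  refine ⟨δ, c, Real.toNNReal C, hδ, hc, fun x y z hxz hyz hd => ?_⟩
  have hd0 : 0 < dist x z := dist_pos.2 hxz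
  have h1 := h x y z hxz hyz hd
  rw [← hμ.ofReal_one_div x hd0, ← ofReal_norm, mul_assoc,
    ← ENNReal.ofReal_mul (by positivity)]
  have h0 : 0 ≤ dist x y ^ δ / dist x z ^ δ * (1 / lam x (dist x z)) :=
    mul_nonneg (by positivity) (one_div_nonneg.2 (hμ.pos x _ hd0).le)
  calc ENNReal.ofReal ‖K z y - K z x‖
      ≤ ENNReal.ofReal (C * (dist x y ^ δ / dist x z ^ δ * (1 / lam x (dist x z)))) := by
        refine ENNReal.ofReal_le_ofReal ?_
        rw [norm_sub_rev]
        rw [← div_div, div_eq_mul_one_div (_ / _) (lam x _)] at h1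
        exact (le_add_of_nonneg_left (norm_nonneg _)).trans h1
    _ = _ := ENNReal.ofReal_mul' h0

theorem IsCZOperator.hasStandardKernel {X : Type*} [MetricSpace X] [MeasurableSpace X]
    {𝕜 : Type*} [RCLike 𝕜] {μ : Measure X} {lam : X → ℝ → ℝ} {K : X → X → 𝕜}
    {T : Lp 𝕜 2 μ →L[𝕜] Lp 𝕜 2 μ} (hμ : IsUpperDoubling μ lam) (hT : IsCZOperator lam K T) :
    HasStandardKernel lam K T where
  size := exists_enorm_le_of_size hμ hT.1.size
  regularity := exists_enorm_sub_le_of_regularity hμ hT.1.regularity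
  representation := fun f hf => by
    have h2 := hf.memLp hμ 2
    rw [app_eq T h2]
    exact hT.2 f h2 hf.1 hf.2

namespace HasStandardKernel

variable {X : Type*} [MetricSpace X] [MeasurableSpace X] [BorelSpace X] {𝕜 : Type*} [RCLike 𝕜]
  {μ : Measure X} {lam : X → ℝ → ℝ} {K : X → X → 𝕜} {T : Lp 𝕜 2 μ →L[𝕜] Lp 𝕜 2 μ}

-- For `y` in the support, `dist z y ≥ (1 - 1 / ρ) * dist z x`, so `λ` at `y` and at `x` are
-- comparable and the size condition applies uniformly in `y`.
omit [BorelSpace X] in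
theorem enorm_app_le (hT : HasStandardKernel lam K T) (hμ : IsUpperDoubling μ lam) {ρ : ℝ}
    (hρ : 1 < ρ) : ∃ C : ℝ≥0, ∀ (x : X) (s : ℝ) (f : X → 𝕜), 0 < s → BddSupp μ f →
      Function.support f ⊆ closedBall x s → ∀ᵐ z ∂μ, ρ * s ≤ dist z x →
        ‖app T f z‖ₑ ≤ C * (∫⁻ y, ‖f y‖ₑ ∂μ) * (dom lam x (dist z x))⁻¹ := by
  obtain ⟨C, hC⟩ := hT.size
  set θ : ℝ := 1 - 1 / ρ with hθ
  have hρ0 : 0 < ρ := by linarith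
  have hθ0 : 0 < θ := by rw [hθ, sub_pos, div_lt_one hρ0]; exact hρ
  have hθ1 : θ ≤ 1 := by rw [hθ]; linarith [one_div_pos.2 hρ0]
  obtain ⟨D, hD⟩ := hμ.dom_le (a := 1 / θ) (by positivity)
  refine ⟨C * D, fun x s f hs hf hsupp => ?_⟩
  have hts : tsupport f ⊆ closedBall x s := closure_minimal hsupp isClosed_closedBall
  filter_upwards [hT.representation f hf] with z hz hzx
  have hzs : s < dist z x := lt_of_lt_of_le (by nlinarith) hzx
  have hd0 : 0 < dist z x := hs.trans hzs
  rw [hz fun h => absurd (mem_closedBall.1 (hts h)) (not_le.2 hzs)]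
  have hne := hμ.dom_ne_zero x hd0
  have hint : ∫⁻ y, ‖f y‖ₑ ∂μ ≠ ∞ := (hf.integrable hμ).2.ne
  calc ‖∫ y, K z y * f y ∂μ‖ₑ ≤ ∫⁻ y, ‖K z y * f y‖ₑ ∂μ := enorm_integral_le_lintegral_enorm _
    _ ≤ ∫⁻ y, (C * D * (dom lam x (dist z x))⁻¹) * ‖f y‖ₑ ∂μ := by
      refine lintegral_mono fun y => ?_
      rw [enorm_mul]
      by_cases hy : f y = 0
      · simp [hy]
      gcongr
      have hyx : dist y x ≤ s := hsupp hy
      have hzy : θ * dist z x ≤ dist z y := by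
        have h1 : s ≤ dist z x / ρ := by rw [le_div_iff₀ hρ0]; linarith
        have h2 := dist_triangle z y x
        have h3 : θ * dist z x = dist z x - dist z x / ρ := by rw [hθ]; ring
        linarith
      have hzy0 : 0 < dist z y := lt_of_lt_of_le (by positivity) hzy
      have hzy1 : dist z x ≤ 1 / θ * dist z y := by
        rw [one_div, ← div_eq_inv_mul, le_div_iff₀ hθ0]; linarith
      refine (hC z y (dist_pos.1 hzy0)).trans ?_
      rw [mul_assoc]
      gcongr
      rw [← div_eq_mul_inv, ENNReal.le_div_iff_mul_le (Or.inl hne) (Or.inl dom_ne_top), mul_comm,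
        ← div_eq_mul_inv, ENNReal.div_le_iff (hμ.dom_ne_zero y hzy0) dom_ne_top]
      refine hD x y _ _ hzy0 hd0 ?_ hzy1
      rw [dist_comm]
      linarith
    _ = C * D * (dom lam x (dist z x))⁻¹ * ∫⁻ y, ‖f y‖ₑ ∂μ := lintegral_const_mul' _ _
        (ENNReal.mul_ne_top (by finiteness) (ENNReal.inv_ne_top.2 hne))
    _ = _ := by push_cast; ring

/-- Mean zero allows `K z x` to be subtracted from the kernel; regularity then gives a decay that is
integrable at infinity. The dilation `2 ^ m` exceeds `1 / c`, which puts every point outside the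
dilated ball in the range of the regularity condition. -/
theorem lintegral_app_compl_le (hT : HasStandardKernel lam K T) (hμ : IsUpperDoubling μ lam) :
    ∃ (m : ℕ) (C : ℝ≥0), ∀ (x : X) (r : ℝ) (f : X → 𝕜), 0 < r → BddSupp μ f →
      Function.support f ⊆ closedBall x r → ∫ y, f y ∂μ = 0 →
        ∫⁻ z in (closedBall x (2 ^ m * r))ᶜ, ‖app T f z‖ₑ ∂μ ≤ C * ∫⁻ y, ‖f y‖ₑ ∂μ := by
  obtain ⟨δ, c, C, hδ, hc, hC⟩ := hT.regularity
  obtain ⟨D, hD⟩ := lintegral_tail_le hμ hδ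
  obtain ⟨m, hm⟩ := pow_unbounded_of_one_lt (max 1 (1 / c)) one_lt_two
  have hm1 : 1 < (2 : ℝ) ^ m := (le_max_left _ _).trans_lt hm
  have hmc : 1 < 2 ^ m * c := by
    have := (le_max_right _ _).trans_lt hm
    rwa [div_lt_iff₀ hc] at this
  refine ⟨m, C * D, fun x r f hr hf hsupp hf0 => ?_⟩
  have hts : tsupport f ⊆ closedBall x r := closure_minimal hsupp isClosed_closedBall
  have hint : ∫⁻ y, ‖f y‖ₑ ∂μ ≠ ∞ := (hf.integrable hμ).2.ne
  have hpt : ∀ᵐ z ∂μ, z ∈ (closedBall x (2 ^ m * r))ᶜ → ‖app T f z‖ₑ ≤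
      (C * ∫⁻ y, ‖f y‖ₑ ∂μ) *
        (ENNReal.ofReal (r ^ δ / dist z x ^ δ) * (dom lam x (dist z x))⁻¹) := by
    filter_upwards [hT.representation f hf] with z hz hzx
    rw [mem_compl_iff, mem_closedBall, not_le] at hzx
    have hzr : r < dist z x := lt_trans (by nlinarith) hzx
    have hd0 : 0 < dist z x := hr.trans hzr
    have hne := hμ.dom_ne_zero x hd0
    rw [hz fun h => absurd (mem_closedBall.1 (hts h)) (not_le.2 hzr)]
    have hsub : ∫ y, K z y * f y ∂μ = ∫ y, (K z y - K z x) * f y ∂μ := by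
      have hconst : Integrable (fun y => K z x * f y) μ := (hf.integrable hμ).const_mul _
      have heq : (fun y => (K z y - K z x) * f y) =
          (fun y => K z y * f y) - fun y => K z x * f y := by
        ext y; simp [sub_mul]
      -- No measurability of `K z ·` is available here. If the integrand is not integrable, neither
      -- is the modified one, and both integrals are zero by convention.
      by_cases hi : Integrable (fun y => K z y * f y) μ
      · rw [heq]
        rw [integral_sub' hi hconst, integral_const_mul, hf0, mul_zero, sub_zero]
      · rw [integral_undef hi, integral_undef]
        rw [heq]
        intro h
        apply hi
        have := h.add hconst
        simpa using this
    rw [hsub]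
    calc ‖∫ y, (K z y - K z x) * f y ∂μ‖ₑ ≤ ∫⁻ y, ‖(K z y - K z x) * f y‖ₑ ∂μ :=
          enorm_integral_le_lintegral_enorm _
      _ ≤ ∫⁻ y, C * (ENNReal.ofReal (r ^ δ / dist z x ^ δ) * (dom lam x (dist z x))⁻¹) *
            ‖f y‖ₑ ∂μ := by
        refine lintegral_mono fun y => ?_
        rw [enorm_mul]
        by_cases hy : f y = 0
        · simp [hy]
        gcongr
        have hyx : dist y x ≤ r := hsupp hy
        have hyz : y ≠ z := by rintro rfl; linarith
        refine (hC x y z (dist_pos.1 (by rwa [dist_comm])) hyz ?_).trans ?_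
        · rw [dist_comm x y, dist_comm x z]
          nlinarith
        · rw [dist_comm x y, dist_comm x z, mul_assoc]
          gcongr
      _ = C * (ENNReal.ofReal (r ^ δ / dist z x ^ δ) * (dom lam x (dist z x))⁻¹) *
            ∫⁻ y, ‖f y‖ₑ ∂μ := lintegral_const_mul' _ _ (ENNReal.mul_ne_top ENNReal.coe_ne_top
              (ENNReal.mul_ne_top ENNReal.ofReal_ne_top (ENNReal.inv_ne_top.2 hne)))
      _ = _ := by ring
  calc ∫⁻ z in (closedBall x (2 ^ m * r))ᶜ, ‖app T f z‖ₑ ∂μ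
      ≤ ∫⁻ z in (closedBall x (2 ^ m * r))ᶜ, (C * ∫⁻ y, ‖f y‖ₑ ∂μ) *
        (ENNReal.ofReal (r ^ δ / dist z x ^ δ) * (dom lam x (dist z x))⁻¹) ∂μ := by
        refine lintegral_mono_ae ?_
        rw [ae_restrict_iff' measurableSet_closedBall.compl]
        exact hpt
    _ = (C * ∫⁻ y, ‖f y‖ₑ ∂μ) * ∫⁻ z in (closedBall x (2 ^ m * r))ᶜ,
        (ENNReal.ofReal (r ^ δ / dist z x ^ δ) * (dom lam x (dist z x))⁻¹) ∂μ :=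
        lintegral_const_mul' _ _ (ENNReal.mul_ne_top ENNReal.coe_ne_top hint)
    _ ≤ (C * ∫⁻ y, ‖f y‖ₑ ∂μ) * D := by
        gcongr
        refine (lintegral_mono_set fun z hz => ?_).trans (hD x r hr)
        rw [mem_compl_iff, mem_closedBall, not_le] at hz
        exact (lt_trans (by nlinarith) hz).le
    _ = _ := by push_cast; ring

omit [MetricSpace X] [BorelSpace X] in
/-- The local `L¹` estimate coming from the `L²` boundedness. -/
theorem setLIntegral_app_le (T : Lp 𝕜 2 μ →L[𝕜] Lp 𝕜 2 μ) {f : X → 𝕜} (hf : MemLp f 2 μ)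
    (s : Set X) : ∫⁻ z in s, ‖app T f z‖ₑ ∂μ ≤ ‖T‖ₑ * eLpNorm f 2 μ * (μ s) ^ (1 / 2 : ℝ) := by
  have h := eLpNorm_le_eLpNorm_mul_rpow_measure_univ (μ := μ.restrict s) (p := 1) (q := 2)
    (by norm_num) (memLp_app T (f := f)).1.restrict
  rw [eLpNorm_one_eq_lintegral_enorm, Measure.restrict_apply_univ] at h
  norm_num at h
  refine h.trans ?_
  gcongr
  exact (eLpNorm_mono_measure _ Measure.restrict_le_self).trans (eLpNorm_app_le T hf)

end HasStandardKernel

/-! ### Packing and disjoint pieces -/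

/-- A square function bound for sums of normalised indicators, ordered by a size `ρ`, in terms of
a packing condition. -/
theorem lintegral_sum_indicator_sq_le {X ι : Type*} [MeasurableSpace X] {μ : Measure X}
    (s : Finset ι) (R : ι → Set X) (hR : ∀ i ∈ s, MeasurableSet (R i)) (ρ : ι → ℝ)
    (w : ι → ℝ≥0∞) (M : ℝ≥0∞)
    (h : ∀ k ∈ s, ∀ t ⊆ s, (∀ i ∈ t, ρ i ≤ ρ k ∧ (R i ∩ R k).Nonempty) →
      ∑ i ∈ t, w i ≤ M * μ (R k)) :
    ∫⁻ z, (∑ i ∈ s, (R i).indicator (fun _ => w i / μ (R i)) z) ^ 2 ∂μ ≤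
      2 * M * ∑ i ∈ s, w i := by
  classical
  set α : ι → ℝ≥0∞ := fun i => w i / μ (R i) with hα
  -- As an inequality this also holds when `μ (R i)` is zero or infinite.
  have hαw : ∀ i, α i * μ (R i) ≤ w i := fun i => ENNReal.mul_le_of_le_div le_rfl
  -- By symmetry the pairs with `ρ i ≤ ρ k` suffice. For these, `μ (R i ∩ R k)` is replaced by `μ (R
  -- i)`, and packing is applied to the larger set `R k`.
  have half : ∀ k ∈ s, ∑ i ∈ s, (if ρ i ≤ ρ k then α i * α k * μ (R i ∩ R k) else 0) ≤
      M * w k := by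
    intro k hk
    calc ∑ i ∈ s, (if ρ i ≤ ρ k then α i * α k * μ (R i ∩ R k) else 0)
        ≤ ∑ i ∈ s, (if ρ i ≤ ρ k ∧ (R i ∩ R k).Nonempty then α k * w i else 0) := by
          refine Finset.sum_le_sum fun i _ => ?_
          by_cases h1 : ρ i ≤ ρ k
          · rcases (R i ∩ R k).eq_empty_or_nonempty with h2 | h2
            · simp [h2]
            · rw [if_pos h1, if_pos ⟨h1, h2⟩]
              calc α i * α k * μ (R i ∩ R k) ≤ α i * α k * μ (R i) := by
                    gcongr; exact inter_subset_left
                _ = α k * (α i * μ (R i)) := by ring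
                _ ≤ α k * w i := by gcongr; exact hαw i
          · simp [h1]
      _ = α k * ∑ i ∈ s with ρ i ≤ ρ k ∧ (R i ∩ R k).Nonempty, w i := by
          rw [Finset.mul_sum, Finset.sum_filter]
      _ ≤ α k * (M * μ (R k)) := by
          gcongr
          exact h k hk _ (Finset.filter_subset _ _) fun i hi => (Finset.mem_filter.1 hi).2
      _ = M * (α k * μ (R k)) := by ring
      _ ≤ M * w k := by gcongr; exact hαw k
  calc ∫⁻ z, (∑ i ∈ s, (R i).indicator (fun _ => α i) z) ^ 2 ∂μ
      = ∫⁻ z, ∑ i ∈ s, ∑ k ∈ s, (R i ∩ R k).indicator (fun _ => α i * α k) z ∂μ := by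
        refine lintegral_congr fun z => ?_
        rw [sq, Finset.sum_mul_sum]
        refine Finset.sum_congr rfl fun i _ => Finset.sum_congr rfl fun k _ => ?_
        by_cases h1 : z ∈ R i <;> by_cases h2 : z ∈ R k <;> simp [h1, h2]
    _ = ∑ i ∈ s, ∑ k ∈ s, α i * α k * μ (R i ∩ R k) := by
        rw [lintegral_finsetSum' _ fun i hi => ?_]
        · refine Finset.sum_congr rfl fun i hi => ?_
          rw [lintegral_finsetSum' _ fun k hk =>
            (measurable_const.indicator ((hR i hi).inter (hR k hk))).aemeasurable]
          refine Finset.sum_congr rfl fun k hk => ?_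
          rw [lintegral_indicator_const ((hR i hi).inter (hR k hk))]
        · exact Finset.aemeasurable_fun_sum _ fun k hk =>
            (measurable_const.indicator ((hR i hi).inter (hR k hk))).aemeasurable
    _ ≤ ∑ i ∈ s, ∑ k ∈ s, ((if ρ i ≤ ρ k then α i * α k * μ (R i ∩ R k) else 0) +
          (if ρ k ≤ ρ i then α k * α i * μ (R k ∩ R i) else 0)) := by
        refine Finset.sum_le_sum fun i _ => Finset.sum_le_sum fun k _ => ?_
        rcases le_total (ρ i) (ρ k) with h1 | h1
        · rw [if_pos h1]; exact le_self_add
        · rw [if_pos h1, inter_comm, mul_comm (α i)]; exact le_add_self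
    _ = ∑ k ∈ s, ∑ i ∈ s, (if ρ i ≤ ρ k then α i * α k * μ (R i ∩ R k) else 0) +
        ∑ i ∈ s, ∑ k ∈ s, (if ρ k ≤ ρ i then α k * α i * μ (R k ∩ R i) else 0) := by
        simp_rw [Finset.sum_add_distrib]
        rw [Finset.sum_comm]
    _ ≤ ∑ k ∈ s, M * w k + ∑ k ∈ s, M * w k :=
        add_le_add (Finset.sum_le_sum half) (Finset.sum_le_sum half)
    _ = _ := by rw [← Finset.mul_sum]; ring

/-- The enlarged stopping balls overlap; splitting `f` over disjoint pieces keeps the sum of the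
masses below `∫ |f|`. -/
theorem exists_disjoint_refinement {X ι : Type*} [MeasurableSpace X] (s : Finset ι)
    (E : ι → Set X) (hE : ∀ i, MeasurableSet (E i)) :
    ∃ D : ι → Set X, (∀ i, MeasurableSet (D i) ∧ D i ⊆ E i) ∧
      (s : Set ι).PairwiseDisjoint D ∧ ⋃ i ∈ s, D i = ⋃ i ∈ s, E i := by
  classical
  induction s using Finset.induction_on with
  | empty => exact ⟨E, fun i => ⟨hE i, Subset.rfl⟩, by simp, rfl⟩
  | insert a s ha ih =>
    obtain ⟨D, hD, hdisj, hU⟩ := ih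
    have hne : ∀ i ∈ s, i ≠ a := fun i hi h => ha (h ▸ hi)
    have hD' : ∀ i ∈ s, Function.update D a (E a \ ⋃ i ∈ s, E i) i = D i := fun i hi =>
      Function.update_of_ne (hne i hi) _ _
    refine ⟨Function.update D a (E a \ ⋃ i ∈ s, E i), fun i => ?_, ?_, ?_⟩
    · rcases eq_or_ne i a with rfl | hi
      · rw [Function.update_self]
        exact ⟨(hE i).diff (Finset.measurableSet_biUnion _ fun j _ => hE j), sdiff_subset⟩
      · rw [Function.update_of_ne hi]; exact hD i
    · rw [Finset.coe_insert, Set.pairwiseDisjoint_insert]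
      refine ⟨fun i hi j hj hij => ?_, fun j hj _ => ?_⟩
      · show Disjoint _ _
        rw [hD' i hi, hD' j hj]; exact hdisj hi hj hij
      · rw [Function.update_self, hD' j hj, ← hU]
        exact disjoint_sdiff_left.mono_right (subset_biUnion_of_mem (u := D) hj)
    · rw [Finset.set_biUnion_insert, Finset.set_biUnion_insert, Function.update_self,
        iUnion₂_congr hD', hU, sdiff_union_self]

/-! ### Stopping balls -/

section Selection

variable {X : Type*} [MetricSpace X] [MeasurableSpace X] [BorelSpace X] {𝕜 : Type*} [RCLike 𝕜]
  {μ : Measure X} {lam : X → ℝ → ℝ}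

/-- Selection of the stopping balls of the Calderón–Zygmund decomposition at height `t`. -/
theorem exists_stopping_balls (hX : GeometricallyDoubling X) (hμ : IsUpperDoubling μ lam) (m : ℕ) :
    ∃ β : ℝ≥0, 0 < β ∧ ∀ (f : X → 𝕜) (t : ℝ≥0), BddSupp μ f → 0 < t →
      β * ∫⁻ y, ‖f y‖ₑ ∂μ < t * μ univ → ∀ ε : ℝ≥0∞, 0 < ε →
      ∃ (F : Finset X) (r : X → ℝ), (∀ x ∈ F, 0 < r x) ∧
        (F : Set X).PairwiseDisjoint (fun x => closedBall x (r x)) ∧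
        (∀ x ∈ F, t * μ (closedBall x (2 ^ m * r x)) < β * ∫⁻ y in closedBall x (r x), ‖f y‖ₑ ∂μ) ∧
        (∀ x ∈ F, ∀ s, 2 * r x ≤ s →
          β * ∫⁻ y in closedBall x s, ‖f y‖ₑ ∂μ ≤ t * μ (closedBall x (2 ^ m * s))) ∧
        μ ({z | t < ‖f z‖ₑ} \ ⋃ x ∈ F, closedBall x (5 * r x)) < ε := by
  obtain ⟨β, hβ, hdens⟩ := ae_exists_density hX hμ m
  have := hX.secondCountableTopology
  refine ⟨β, hβ, fun f t hf ht hbig ε hε => ?_⟩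
  set A : Set X := {z | t < ‖f z‖ₑ} with hA
  have hAsupp : A ⊆ Function.support f := fun z hz hz0 => by simp [A, hz0] at hz
  have hAtop : μ A < ∞ := (measure_mono hAsupp).trans_lt (hμ.measure_lt_top_of_isBounded hf.2)
  have hAmeas : NullMeasurableSet A μ :=
    nullMeasurableSet_lt aemeasurable_const hf.aestronglyMeasurable.enorm
  let S : X → Set ℝ := fun x => {r | 0 < r ∧
    t * μ (closedBall x (2 ^ m * r)) < β * ∫⁻ y in closedBall x r, ‖f y‖ₑ ∂μ}
  have ht0 : (t : ℝ≥0∞) ≠ 0 := by exact_mod_cast ht.ne'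
  -- almost every point of `A` has a stopping radius
  have hS : ∀ᵐ x ∂μ, x ∈ A → (S x).Nonempty := by
    filter_upwards [hdens A hAtop] with x hx hxA
    obtain ⟨r, hr, h⟩ := hx hxA
    refine ⟨r, hr, ?_⟩
    calc (t : ℝ≥0∞) * μ (closedBall x (2 ^ m * r)) < t * (β * μ (A ∩ closedBall x r)) :=
          (ENNReal.mul_lt_mul_iff_right ht0 ENNReal.coe_ne_top).2 h
      _ = β * (t * μ (A ∩ closedBall x r)) := by ring
      _ ≤ β * ∫⁻ y in closedBall x r, ‖f y‖ₑ ∂μ := by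
          gcongr
          calc (t : ℝ≥0∞) * μ (A ∩ closedBall x r)
              = t * (μ.restrict (closedBall x r)) A := by
                rw [Measure.restrict_apply' measurableSet_closedBall]
            _ ≤ t * (μ.restrict (closedBall x r)) {z | t ≤ ‖f z‖ₑ} := by
                gcongr; exact fun z hz => (show (t : ℝ≥0∞) < ‖f z‖ₑ from hz).le
            _ ≤ _ := mul_meas_ge_le_lintegral₀ hf.aestronglyMeasurable.enorm.restrict _
  -- stopping radii are bounded
  obtain ⟨R, hR⟩ : ∃ R : ℝ, ∀ x ∈ A, ∀ r ∈ S x, r ≤ R := by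
    rcases A.eq_empty_or_nonempty with hAe | ⟨x0, hx0⟩
    · exact ⟨0, fun x hx => by simp [hAe] at hx⟩
    obtain ⟨R1, hR1⟩ := hf.2.subset_closedBall x0
    -- Since `β ∫ |f| < t μ(X)`, some fixed ball already has `t μ > β ∫ |f|`, and a very large
    -- stopping ball would contain it after dilation.
    have hlim : Tendsto (fun n : ℕ => t * μ (closedBall x0 n)) atTop (𝓝 (t * μ univ)) := by
      refine ENNReal.Tendsto.const_mul ?_ (Or.inr ENNReal.coe_ne_top)
      rw [← iUnion_closedBall_nat x0]
      exact tendsto_measure_iUnion_atTop fun i j hij =>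
        closedBall_subset_closedBall (by exact_mod_cast hij)
    obtain ⟨n, hn⟩ := (hlim.eventually (lt_mem_nhds hbig)).exists
    refine ⟨n + R1, fun x hx r hr => ?_⟩
    by_contra! hcon
    have hxx0 : dist x x0 ≤ R1 := hR1 (hAsupp hx)
    have h1 : (1 : ℝ) ≤ 2 ^ m := one_le_pow₀ one_le_two
    have hrpos := hr.1
    refine absurd (hn.trans_le ?_) (not_lt.2 ((hr.2.trans_le ?_).le))
    · gcongr
      refine closedBall_subset_closedBall' ?_
      rw [dist_comm]
      nlinarith
    · gcongr
      exact Measure.restrict_le_self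
  -- The supremum of the stopping radii need not be attained, so a radius above half of it is taken.
  have hex : ∀ x, x ∈ A ∧ (S x).Nonempty → ∃ r ∈ S x, ∀ s, 2 * r ≤ s → s ∉ S x := by
    rintro x ⟨hxA, hne⟩
    have hbdd : BddAbove (S x) := ⟨R, fun r hr => hR x hxA r hr⟩
    have hpos : 0 < sSup (S x) := by
      obtain ⟨r, hr⟩ := hne
      exact hr.1.trans_le (le_csSup hbdd hr)
    obtain ⟨r, hr, hlt⟩ := exists_lt_of_lt_csSup hne (half_lt_self hpos)
    refine ⟨r, hr, fun s hs hsS => ?_⟩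
    have := le_csSup hbdd hsS
    linarith
  choose! r hrS hrmax using hex
  obtain ⟨u, huA, hdisj, hcov⟩ := Vitali.exists_disjoint_subfamily_covering_enlargement_closedBall
    {x | x ∈ A ∧ (S x).Nonempty} (fun x => x) r R (fun x hx => hR x hx.1 _ (hrS x hx)) 5
    (by norm_num)
  have hr0 : ∀ x ∈ u, 0 < r x := fun x hx => (hrS x (huA hx)).1
  have hucount : u.Countable := hdisj.countable_of_nonempty_interior fun x hx =>
    ⟨x, ball_subset_interior_closedBall (mem_ball_self (hr0 x hx))⟩
  have := hucount.to_subtype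
  have hnull : μ (A \ ⋃ x ∈ u, closedBall x (5 * r x)) = 0 := by
    rw [measure_eq_zero_iff_ae_notMem]
    filter_upwards [hS] with z hz hzmem
    have hzA := And.intro hzmem.1 (hz hzmem.1)
    obtain ⟨b, hb, hzb⟩ := hcov z hzA
    exact hzmem.2 (mem_iUnion₂.2 ⟨b, hb, hzb (mem_closedBall_self (hrS z hzA).1.le)⟩)
  -- Continuity from above along finite subfamilies: a finite one already leaves less than `ε`
  -- uncovered, and `T` then only has to be applied to finite sums.
  let Q : Finset u → Set X := fun G => A \ ⋃ x ∈ G, closedBall (x : X) (5 * r x)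
  have hQinf : μ (⋂ G, Q G) = ⨅ G, μ (Q G) := by
    refine Directed.measure_iInter (fun G => ?_) ?_ ⟨∅, ?_⟩
    · exact hAmeas.diff (Finset.measurableSet_biUnion _
        fun x _ => measurableSet_closedBall).nullMeasurableSet
    · classical
      intro G H
      refine ⟨G ∪ H, ?_, ?_⟩
      · exact sdiff_subset_sdiff_right (biUnion_mono (fun x hx => Finset.mem_union_left _ hx)
          fun _ _ => Subset.rfl)
      · exact sdiff_subset_sdiff_right (biUnion_mono (fun x hx => Finset.mem_union_right _ hx)
          fun _ _ => Subset.rfl)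
    · exact ((measure_mono sdiff_subset).trans_lt hAtop).ne
  have hQ0 : ⨅ G, μ (Q G) < ε := by
    rw [← hQinf]
    refine lt_of_le_of_lt ((measure_mono fun z hz => ?_).trans hnull.le) hε
    rw [mem_iInter] at hz
    refine ⟨(hz ∅).1, fun hzU => ?_⟩
    obtain ⟨x, hx, hzx⟩ := mem_iUnion₂.1 hzU
    exact (hz {⟨x, hx⟩}).2 (by simpa using hzx)
  obtain ⟨G, hG⟩ := iInf_lt_iff.1 hQ0
  have hGu : ∀ x ∈ G.map (Function.Embedding.subtype _), x ∈ u := by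
    intro x hx
    obtain ⟨y, -, rfl⟩ := Finset.mem_map.1 hx
    exact y.2
  refine ⟨G.map (Function.Embedding.subtype _), r, fun x hx => hr0 x (hGu x hx), ?_, ?_, ?_, ?_⟩
  · exact fun x hx y hy hxy => hdisj (hGu x hx) (hGu y hy) hxy
  · exact fun x hx => (hrS x (huA (hGu x hx))).2
  · intro x hx s hs
    have := hrmax x (huA (hGu x hx)) s hs
    by_contra! hcon
    exact this ⟨by linarith [hr0 x (hGu x hx)], hcon⟩
  · convert hG using 3
    simp

end Selection

/-! ### Balancing functions constant on a ball -/

section Flat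

variable {X : Type*} [MeasurableSpace X] {𝕜 : Type*} [RCLike 𝕜]

/-- The function that is constant on `R`, vanishes elsewhere and has the same integral as `f`. -/
noncomputable def flat (μ : Measure X) (f : X → 𝕜) (R : Set X) : X → 𝕜 :=
  R.indicator fun _ => (μ.real R)⁻¹ • ∫ y, f y ∂μ

variable {μ : Measure X} {f : X → 𝕜} {R : Set X}

theorem enorm_flat_const (h0 : μ R ≠ 0) (ht : μ R ≠ ∞) :
    ‖(μ.real R)⁻¹ • ∫ y, f y ∂μ‖ₑ = ‖∫ y, f y ∂μ‖ₑ / μ R := by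
  have hr : 0 < μ.real R := ENNReal.toReal_pos h0 ht
  rw [enorm_smul, enorm_inv hr.ne', Real.enorm_eq_ofReal hr.le, measureReal_def,
    ENNReal.ofReal_toReal ht, mul_comm, div_eq_mul_inv]

theorem enorm_flat (h0 : μ R ≠ 0) (ht : μ R ≠ ∞) (z : X) :
    ‖flat μ f R z‖ₑ = R.indicator (fun _ => ‖∫ y, f y ∂μ‖ₑ / μ R) z := by
  rw [flat, enorm_indicator_eq_indicator_enorm]
  simp only [enorm_flat_const h0 ht]

theorem integral_flat (hR : MeasurableSet R) (h0 : μ R ≠ 0) (ht : μ R ≠ ∞) :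
    ∫ z, flat μ f R z ∂μ = ∫ y, f y ∂μ := by
  have hr : μ.real R ≠ 0 := (ENNReal.toReal_pos h0 ht).ne'
  rw [flat, integral_indicator_const _ hR, smul_inv_smul₀ hr]

theorem lintegral_enorm_flat_le (hR : MeasurableSet R) (h0 : μ R ≠ 0) (ht : μ R ≠ ∞) :
    ∫⁻ z, ‖flat μ f R z‖ₑ ∂μ ≤ ∫⁻ y, ‖f y‖ₑ ∂μ := by
  simp only [enorm_flat h0 ht]
  rw [lintegral_indicator_const hR]
  exact (ENNReal.mul_le_of_le_div le_rfl).trans (enorm_integral_le_lintegral_enorm _)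

theorem eLpNorm_flat_le (hR : MeasurableSet R) (h0 : μ R ≠ 0) (ht : μ R ≠ ∞) :
    eLpNorm (flat μ f R) 2 μ ≤ (∫⁻ y, ‖f y‖ₑ ∂μ) / μ R * μ R ^ (1 / 2 : ℝ) := by
  rw [flat, eLpNorm_indicator_const hR (by norm_num) (by norm_num), enorm_flat_const h0 ht]
  norm_num
  gcongr
  exact enorm_integral_le_lintegral_enorm _

theorem lintegral_app_sq_le (T : Lp 𝕜 2 μ →L[𝕜] Lp 𝕜 2 μ) (hf : MemLp f 2 μ) :
    ∫⁻ z, ‖app T f z‖ₑ ^ 2 ∂μ ≤ ‖T‖ₑ ^ 2 * ∫⁻ z, ‖f z‖ₑ ^ 2 ∂μ := by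
  have h := fun g : X → 𝕜 => eLpNorm_nnreal_pow_eq_lintegral (μ := μ) (f := g)
    (p := 2) two_ne_zero
  norm_num at h
  rw [← h, ← h, ← mul_pow]
  gcongr
  exact eLpNorm_app_le T hf

end Flat

/-! ### Weak type (1,1): one bad term -/

section WeakType

variable {X : Type*} [MetricSpace X] [MeasurableSpace X] [BorelSpace X] {𝕜 : Type*} [RCLike 𝕜]
  {μ : Measure X} {lam : X → ℝ → ℝ} {K : X → X → 𝕜} {T : Lp 𝕜 2 μ →L[𝕜] Lp 𝕜 2 μ}

omit [BorelSpace X] in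
theorem BddSupp.flat (f : X → 𝕜) {R : Set X} (hR : MeasurableSet R)
    (hb : Bornology.IsBounded R) : BddSupp μ (flat μ f R) :=
  BddSupp.indicator_const _ hR hb

/-- The estimate for one term of the bad part of the Calderón–Zygmund decomposition. -/
theorem HasStandardKernel.lintegral_app_sub_flat_le (hT : HasStandardKernel lam K T)
    (hμ : IsUpperDoubling μ lam) :
    ∃ m₀ : ℕ, ∀ m, m₀ ≤ m → ∀ β D : ℝ≥0, ∃ C : ℝ≥0, ∀ (x : X) (r ρ : ℝ) (f : X → 𝕜),
      0 < r → 2 ^ 4 * r ≤ ρ → BddSupp μ f → Function.support f ⊆ closedBall x (5 * r) →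
      0 < μ (closedBall x ρ) → μ (closedBall x (2 ^ m * ρ)) ≤ β * μ (closedBall x ρ) →
      ∫⁻ z in {z | 2 ^ 4 * r ≤ dist z x ∧ dist z x ≤ 2 ^ m * ρ}, (dom lam x (dist z x))⁻¹ ∂μ ≤ D →
      ∫⁻ z in (closedBall x (2 ^ 4 * r))ᶜ, ‖app T (f - flat μ f (closedBall x ρ)) z‖ₑ ∂μ ≤
        C * ∫⁻ y, ‖f y‖ₑ ∂μ := by
  obtain ⟨m₀, C₁, h₁⟩ := hT.lintegral_app_compl_le hμ
  obtain ⟨C₂, h₂⟩ := hT.enorm_app_le hμ (ρ := 2) one_lt_two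
  refine ⟨m₀, fun m hm β D => ⟨C₁ * 2 + C₂ * D + ‖T‖₊ * NNReal.sqrt β, ?_⟩⟩
  intro x r ρ f hr hrρ hf hsupp hpos hdoub hann
  set R := closedBall x ρ with hRdef
  have hRm : MeasurableSet R := measurableSet_closedBall
  have hRt : μ R ≠ ∞ := (hμ.measure_closedBall_lt_top x ρ).ne
  have hρ : 0 < ρ := lt_of_lt_of_le (by positivity) hrρ
  have hφ : BddSupp μ (NonHomogeneous.flat μ f R) := BddSupp.flat f hRm isBounded_closedBall
  have hI : ∫⁻ y, ‖f y‖ₑ ∂μ ≠ ∞ := (hf.integrable hμ).2.ne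
  set I := ∫⁻ y, ‖f y‖ₑ ∂μ with hIdef
  have hm1 : (1 : ℝ) ≤ 2 ^ m := one_le_pow₀ one_le_two
  have hh : ∫⁻ y, ‖(f - NonHomogeneous.flat μ f R) y‖ₑ ∂μ ≤ 2 * I := by
    calc _ ≤ ∫⁻ y, (‖f y‖ₑ + ‖NonHomogeneous.flat μ f R y‖ₑ) ∂μ :=
          lintegral_mono fun y => enorm_sub_le
      _ = I + ∫⁻ y, ‖NonHomogeneous.flat μ f R y‖ₑ ∂μ :=
          lintegral_add_left' hf.aestronglyMeasurable.enorm _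
      _ ≤ I + I := by gcongr; exact lintegral_enorm_flat_le hRm hpos.ne' hRt
      _ = _ := (two_mul _).symm
  -- far away from `x`
  have far : ∫⁻ z in (closedBall x (2 ^ m * ρ))ᶜ,
      ‖app T (f - NonHomogeneous.flat μ f R) z‖ₑ ∂μ ≤ C₁ * 2 * I := by
    have hsup : Function.support (f - NonHomogeneous.flat μ f R) ⊆ closedBall x ρ := by
      refine (Function.support_sub _ _).trans (union_subset (hsupp.trans ?_) ?_)
      · exact closedBall_subset_closedBall (by linarith)
      · exact Set.support_indicator_subset
    have hint : ∫ y, (f - NonHomogeneous.flat μ f R) y ∂μ = 0 := by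
      rw [integral_sub' (hf.integrable hμ) (hφ.integrable hμ), integral_flat hRm hpos.ne' hRt,
        sub_self]
    calc _ ≤ ∫⁻ z in (closedBall x (2 ^ m₀ * ρ))ᶜ,
          ‖app T (f - NonHomogeneous.flat μ f R) z‖ₑ ∂μ := by
          refine lintegral_mono_set (compl_subset_compl.2 (closedBall_subset_closedBall ?_))
          gcongr
          exact one_le_two
      _ ≤ C₁ * ∫⁻ y, ‖(f - NonHomogeneous.flat μ f R) y‖ₑ ∂μ :=
          h₁ x ρ _ hρ (hf.sub hφ) hsup hint
      _ ≤ C₁ * (2 * I) := by gcongr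
      _ = _ := by ring
  -- the contribution of `f` at intermediate distances
  set S := {z | 2 ^ 4 * r ≤ dist z x ∧ dist z x ≤ 2 ^ m * ρ} with hS
  have hSm : MeasurableSet S := measurableSet_annulus x _ _
  have mid : ∫⁻ z in S, ‖app T f z‖ₑ ∂μ ≤ C₂ * D * I := by
    calc _ ≤ ∫⁻ z in S, C₂ * I * (dom lam x (dist z x))⁻¹ ∂μ := by
          refine lintegral_mono_ae ?_
          rw [ae_restrict_iff' hSm]
          -- The pointwise bound holds from distance `2 * (5 * r)` on, and `10 ≤ 2 ^ 4`.
          filter_upwards [h₂ x (5 * r) f (by positivity) hf hsupp] with z hz hzS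
          exact hz (by linarith [hzS.1])
      _ = C₂ * I * ∫⁻ z in S, (dom lam x (dist z x))⁻¹ ∂μ :=
          lintegral_const_mul' _ _ (ENNReal.mul_ne_top ENNReal.coe_ne_top hI)
      _ ≤ C₂ * I * D := by gcongr
      _ = _ := by ring
  -- On the same annulus the flat function is treated by Cauchy–Schwarz and the `L²` bound; the
  -- doubling of `R` replaces `μ S` by a multiple of `μ R`.
  have near : ∫⁻ z in S, ‖app T (NonHomogeneous.flat μ f R) z‖ₑ ∂μ ≤
      ‖T‖ₑ * NNReal.sqrt β * I := by
    have hSle : μ S ≤ β * μ R := (measure_mono fun z hz => hz.2).trans hdoub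
    calc _ ≤ ‖T‖ₑ * eLpNorm (NonHomogeneous.flat μ f R) 2 μ * (μ S) ^ (1 / 2 : ℝ) :=
          setLIntegral_app_le T (hφ.memLp hμ 2) S
      _ ≤ ‖T‖ₑ * (I / μ R * μ R ^ (1 / 2 : ℝ)) * (β * μ R) ^ (1 / 2 : ℝ) := by
          gcongr
          exact eLpNorm_flat_le hRm hpos.ne' hRt
      _ = ‖T‖ₑ * (β : ℝ≥0∞) ^ (1 / 2 : ℝ) *
          (I / μ R * (μ R ^ (1 / 2 : ℝ) * μ R ^ (1 / 2 : ℝ))) := by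
          rw [ENNReal.mul_rpow_of_nonneg _ _ (by norm_num)]; ring
      _ = ‖T‖ₑ * NNReal.sqrt β * I := by
          rw [← ENNReal.rpow_add _ _ hpos.ne' hRt]
          norm_num
          rw [ENNReal.div_mul_cancel hpos.ne' hRt, NNReal.sqrt_eq_rpow,
            ENNReal.coe_rpow_of_nonneg _ (by norm_num)]
  have hcov : (closedBall x (2 ^ 4 * r))ᶜ ⊆ (closedBall x (2 ^ m * ρ))ᶜ ∪ S := by
    intro z hz
    rw [mem_compl_iff, mem_closedBall, not_le] at hz
    rcases le_or_gt (dist z x) (2 ^ m * ρ) with h | h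
    · exact Or.inr ⟨hz.le, h⟩
    · exact Or.inl (by simpa using h)
  calc _ ≤ _ := lintegral_mono_set hcov
    _ ≤ _ := lintegral_union_le _ _ _
    _ ≤ C₁ * 2 * I + (C₂ * D * I + ‖T‖ₑ * NNReal.sqrt β * I) := by
        refine add_le_add far (le_trans ?_ (add_le_add mid near))
        rw [← lintegral_add_left' (memLp_app T).1.enorm.restrict]
        refine lintegral_mono_ae (ae_restrict_of_ae ?_)
        filter_upwards [app_sub T (hf.memLp hμ 2) (hφ.memLp hμ 2)] with z hz
        rw [hz]
        exact enorm_sub_le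
    _ = _ := by push_cast; rw [← enorm_eq_nnnorm]; ring

end WeakType

theorem ennreal_add_sq_le (a b : ℝ≥0∞) : (a + b) ^ 2 ≤ 4 * (a ^ 2 + b ^ 2) := by
  rcases le_total a b with h | h
  · calc (a + b) ^ 2 ≤ (b + b) ^ 2 := by gcongr
      _ = 4 * b ^ 2 := by ring
      _ ≤ _ := by gcongr; exact le_add_self
  · calc (a + b) ^ 2 ≤ (a + a) ^ 2 := by gcongr
      _ = 4 * a ^ 2 := by ring
      _ ≤ _ := by gcongr; exact le_self_add

/-! ### Weak type (1,1): decomposition and conclusion -/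

section WeakType

variable {X : Type*} [MetricSpace X] [MeasurableSpace X] [BorelSpace X] {𝕜 : Type*} [RCLike 𝕜]
  {μ : Measure X} {lam : X → ℝ → ℝ} {K : X → X → 𝕜} {T : Lp 𝕜 2 μ →L[𝕜] Lp 𝕜 2 μ}

/-- Properties of a Calderón–Zygmund decomposition `f = g + ∑ h` at height `t`, as seen by `T`. -/
theorem HasStandardKernel.exists_decomposition (hT : HasStandardKernel lam K T)
    (hX : GeometricallyDoubling X) (hμ : IsUpperDoubling μ lam) :
    ∃ β C C' : ℝ≥0, ∀ (f : X → 𝕜) (t : ℝ≥0), BddSupp μ f → 0 < t → ∫⁻ y, ‖f y‖ₑ ∂μ ≠ 0 →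
      β * ∫⁻ y, ‖f y‖ₑ ∂μ < t * μ univ →
      ∃ (Ω : Set X) (F : Finset X) (g : X → 𝕜) (h : X → X → 𝕜),
        MeasurableSet Ω ∧ BddSupp μ g ∧ (∀ x ∈ F, BddSupp μ (h x)) ∧ f = g + ∑ x ∈ F, h x ∧
        t * μ Ω ≤ β * ∫⁻ y, ‖f y‖ₑ ∂μ ∧
        ∫⁻ y, ‖g y‖ₑ ^ 2 ∂μ ≤ t * (C * ∫⁻ y, ‖f y‖ₑ ∂μ) ∧
        ∑ x ∈ F, ∫⁻ z in Ωᶜ, ‖app T (h x) z‖ₑ ∂μ ≤ C' * ∫⁻ y, ‖f y‖ₑ ∂μ := by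
  classical
  obtain ⟨m₀, hbad⟩ := hT.lintegral_app_sub_flat_le hμ
  obtain ⟨β, hβ, hballs⟩ := exists_stopping_balls (𝕜 := 𝕜) hX hμ 4
  -- The packing estimate below needs `2 ^ 4 * 3 ≤ 2 ^ m`, whence the `6`.
  set m := max m₀ 6 with hm
  obtain ⟨β₂, D₂, hlarge⟩ := exists_large_doubling hμ m
  obtain ⟨C₃, hC₃⟩ := hbad m (le_max_left _ _) β₂ D₂
  refine ⟨β, 4 * (2 + 2 * (β₂ / β)), C₃, fun f t hf ht hI0 hbig => ?_⟩
  have hI : ∫⁻ y, ‖f y‖ₑ ∂μ ≠ ∞ := (hf.integrable hμ).2.ne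
  set I := ∫⁻ y, ‖f y‖ₑ ∂μ with hIdef
  have ht0 : (t : ℝ≥0∞) ≠ 0 := by exact_mod_cast ht.ne'
  have hβ0 : (β : ℝ≥0∞) ≠ 0 := by exact_mod_cast hβ.ne'
  set B := eLpNorm f ∞ μ with hB
  have hBt : B ^ 2 + 1 ≠ ∞ := by
    have : B ≠ ∞ := hf.1.2.ne
    finiteness
  -- Chosen so that the points with `|f| > t` missed by the finite cover contribute at most `t * I`
  -- to the square integral; the `1` keeps the denominator nonzero.
  set ε := t * I / (B ^ 2 + 1) with hε
  have hε0 : 0 < ε := ENNReal.div_pos (mul_ne_zero ht0 hI0) hBt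
  have hBε : B ^ 2 * ε ≤ t * I := by
    calc B ^ 2 * ε ≤ (B ^ 2 + 1) * ε := by gcongr; exact le_self_add
      _ = t * I := ENNReal.mul_div_cancel (by simp) hBt
  obtain ⟨F, r, hr0, hdisj, hin, hmax, hrem⟩ := hballs f t hf ht hbig ε hε0
  have hpos : ∀ x ∈ F, 0 < μ (closedBall x (2 ^ 4 * r x)) := by
    intro x hx
    by_contra hcon
    have h0 : μ (closedBall x (r x)) = 0 := by
      refine measure_mono_null (closedBall_subset_closedBall ?_) (nonpos_iff_eq_zero.1 (not_lt.1 hcon))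
      linarith [hr0 x hx]
    have := hin x hx
    rw [setLIntegral_measure_zero _ _ h0, mul_zero] at this
    exact not_lt_bot this
  have hex : ∀ x ∈ F, ∃ ρ, 2 ^ 4 * r x ≤ ρ ∧
      μ (closedBall x (2 ^ m * ρ)) ≤ β₂ * μ (closedBall x ρ) ∧
      ∫⁻ z in {z | 2 ^ 4 * r x ≤ dist z x ∧ dist z x ≤ 2 ^ m * ρ},
        (dom lam x (dist z x))⁻¹ ∂μ ≤ D₂ := fun x hx =>
    hlarge x _ (mul_pos (by positivity) (hr0 x hx)) (hpos x hx)
  choose! ρ hρr hρd hρa using hex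
  obtain ⟨D, hD, hDdisj, hDU⟩ := exists_disjoint_refinement F (fun x => closedBall x (5 * r x))
    fun x => measurableSet_closedBall
  set U := ⋃ x ∈ F, closedBall x (5 * r x) with hU
  have hUm : MeasurableSet U := Finset.measurableSet_biUnion _ fun x _ => measurableSet_closedBall
  set R : X → Set X := fun x => closedBall x (ρ x) with hR
  have hRm : ∀ x, MeasurableSet (R x) := fun x => measurableSet_closedBall
  have hRpos : ∀ x ∈ F, 0 < μ (R x) := fun x hx => (hpos x hx).trans_le
    (measure_mono (closedBall_subset_closedBall (hρr x hx)))
  have hRt : ∀ x, μ (R x) ≠ ∞ := fun x => (hμ.measure_closedBall_lt_top x _).ne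
  set fD : X → X → 𝕜 := fun x => (D x).indicator f with hfD
  have hfDb : ∀ x, BddSupp μ (fD x) := fun x => hf.indicator (hD x).1
  have hfDsupp : ∀ x, Function.support (fD x) ⊆ closedBall x (5 * r x) := fun x =>
    Set.support_indicator_subset.trans (hD x).2
  have hfDI : ∀ x, ∫⁻ y, ‖fD x y‖ₑ ∂μ = ∫⁻ y in D x, ‖f y‖ₑ ∂μ := fun x => by
    rw [← lintegral_indicator (hD x).1]
    refine lintegral_congr fun y => ?_
    simp only [hfD, enorm_indicator_eq_indicator_enorm]
  have hsumle : ∀ t ⊆ F, ∑ x ∈ t, ∫⁻ y, ‖fD x y‖ₑ ∂μ = ∫⁻ y in ⋃ x ∈ t, D x, ‖f y‖ₑ ∂μ := by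
    intro t htF
    rw [lintegral_biUnion_finset (hDdisj.subset (by exact_mod_cast htF)) fun x _ => (hD x).1]
    exact Finset.sum_congr rfl fun x _ => hfDI x
  have hsumI : ∑ x ∈ F, ∫⁻ y, ‖fD x y‖ₑ ∂μ ≤ I := by
    rw [hsumle F Finset.Subset.rfl]
    exact setLIntegral_le_lintegral _ _
  set φ : X → X → 𝕜 := fun x => flat μ (fD x) (R x) with hφ
  have hφb : ∀ x, BddSupp μ (φ x) := fun x => BddSupp.flat _ (hRm x) isBounded_closedBall
  set M : ℝ≥0∞ := t * (β₂ / β) with hM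
  -- The pieces belonging to smaller balls `R i` meeting `R k` lie in `3 R k`. The radius `3 * ρ k`
  -- exceeds twice the stopping radius, so maximality bounds the mass of `f` there, and doubling
  -- returns to `μ (R k)`.
  have hpack : ∀ k ∈ F, ∀ s ⊆ F, (∀ i ∈ s, ρ i ≤ ρ k ∧ (R i ∩ R k).Nonempty) →
      ∑ i ∈ s, ‖∫ y, fD i y ∂μ‖ₑ ≤ M * μ (R k) := by
    intro k hk s hs hmeet
    have hk0 := hr0 k hk
    have hsub : ⋃ i ∈ s, D i ⊆ closedBall k (3 * ρ k) := by
      refine iUnion₂_subset fun i hi => (hD i).2.trans ?_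
      obtain ⟨h1, p, hpi, hpk⟩ := hmeet i hi
      have h2 := hρr i (hs hi)
      have h3 := hr0 i (hs hi)
      refine closedBall_subset_closedBall' ?_
      have h4 : dist i k ≤ dist p i + dist p k := by rw [dist_comm p i]; exact dist_triangle _ _ _
      linarith [mem_closedBall.1 hpi, mem_closedBall.1 hpk]
    have h1 : ∑ i ∈ s, ‖∫ y, fD i y ∂μ‖ₑ ≤ ∫⁻ y in closedBall k (3 * ρ k), ‖f y‖ₑ ∂μ := by
      calc _ ≤ ∑ i ∈ s, ∫⁻ y, ‖fD i y‖ₑ ∂μ :=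
            Finset.sum_le_sum fun i _ => enorm_integral_le_lintegral_enorm _
        _ = _ := hsumle s hs
        _ ≤ _ := lintegral_mono_set hsub
    have h2 : β * ∫⁻ y in closedBall k (3 * ρ k), ‖f y‖ₑ ∂μ ≤ t * (β₂ * μ (R k)) := by
      have h5 := hρr k hk
      refine (hmax k hk (3 * ρ k) (by linarith)).trans ?_
      gcongr
      refine le_trans (measure_mono (closedBall_subset_closedBall ?_)) (hρd k hk)
      have h6 : (2 : ℝ) ^ 6 ≤ 2 ^ m := pow_le_pow_right₀ one_le_two (le_max_right _ _)
      have h7 : 0 < ρ k := by linarith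
      nlinarith
    calc _ ≤ t * (β₂ * μ (R k)) / β := by
          rw [ENNReal.le_div_iff_mul_le (Or.inl hβ0) (Or.inl ENNReal.coe_ne_top), mul_comm]
          exact (mul_le_mul_right h1 _).trans h2
      _ = M * μ (R k) := by rw [hM]; simp only [div_eq_mul_inv]; ring
  set g₀ : X → 𝕜 := Uᶜ.indicator f with hg₀
  have hg₀b : BddSupp μ g₀ := hf.indicator hUm.compl
  -- Off `U`, either `|f| ≤ t` and `|f|² ≤ t |f|`, or the point lies in the uncovered remainder,
  -- where `|f| ≤ B` almost everywhere.
  have hg₀sq : ∫⁻ y, ‖g₀ y‖ₑ ^ 2 ∂μ ≤ t * I + t * I := by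
    set A := {z | (t : ℝ≥0∞) < ‖f z‖ₑ} with hA
    have hpt : ∀ᵐ y ∂μ, ‖g₀ y‖ₑ ^ 2 ≤ t * ‖f y‖ₑ + (A \ U).indicator (fun _ => B ^ 2) y := by
      filter_upwards [enorm_ae_le_eLpNormEssSup f μ] with y hy
      by_cases hyU : y ∈ U
      · simp [hg₀, hyU]
      have h1 : g₀ y = f y := indicator_of_mem hyU f
      rw [h1]
      by_cases hyA : y ∈ A
      · rw [indicator_of_mem (show y ∈ A \ U from ⟨hyA, hyU⟩)]
        refine le_add_left ?_
        gcongr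
        rw [hB, eLpNorm_exponent_top]
        exact hy
      · refine le_add_right ?_
        rw [sq]
        gcongr
        exact not_lt.1 hyA
    calc _ ≤ ∫⁻ y, (t * ‖f y‖ₑ + (A \ U).indicator (fun _ => B ^ 2) y) ∂μ := lintegral_mono_ae hpt
      _ = t * I + ∫⁻ y, (A \ U).indicator (fun _ => B ^ 2) y ∂μ := by
          rw [lintegral_add_left' (hf.aestronglyMeasurable.enorm.const_mul _),
            lintegral_const_mul' _ _ ENNReal.coe_ne_top]
      _ ≤ t * I + B ^ 2 * ε := by
          gcongr
          exact (lintegral_indicator_const_le _ _).trans (mul_le_mul_right hrem.le _)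
      _ ≤ _ := by gcongr
  have hsumφ : ∫⁻ z, ‖(∑ x ∈ F, φ x) z‖ₑ ^ 2 ∂μ ≤ 2 * M * I := by
    calc _ ≤ ∫⁻ z, (∑ x ∈ F, (R x).indicator (fun _ => ‖∫ y, fD x y ∂μ‖ₑ / μ (R x)) z) ^ 2 ∂μ := by
          refine lintegral_mono fun z => ?_
          dsimp only
          gcongr
          rw [Finset.sum_apply]
          refine (enorm_sum_le _ _).trans (Finset.sum_le_sum fun x hx => ?_)
          exact (enorm_flat (hRpos x hx).ne' (hRt x) z).le
      _ ≤ 2 * M * ∑ x ∈ F, ‖∫ y, fD x y ∂μ‖ₑ :=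
          lintegral_sum_indicator_sq_le F R (fun x _ => hRm x) ρ _ M hpack
      _ ≤ 2 * M * I := by
          gcongr
          exact (Finset.sum_le_sum fun x _ => enorm_integral_le_lintegral_enorm _).trans hsumI
  refine ⟨⋃ x ∈ F, closedBall x (2 ^ 4 * r x), F, g₀ + ∑ x ∈ F, φ x, fun x => fD x - φ x,
    Finset.measurableSet_biUnion _ fun x _ => measurableSet_closedBall,
    hg₀b.add (BddSupp.sum fun x _ => hφb x), fun x _ => (hfDb x).sub (hφb x), ?_, ?_, ?_, ?_⟩
  · have h1 : ∑ x ∈ F, fD x = U.indicator f := by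
      rw [← hDU, Finset.indicator_biUnion F D hDdisj]
      ext z; simp [hfD]
    rw [Finset.sum_sub_distrib, h1, hg₀]
    have h2 := indicator_compl_add_self U f
    rw [add_add_sub_cancel, h2]
  · calc _ ≤ t * ∑ x ∈ F, μ (closedBall x (2 ^ 4 * r x)) := by
          gcongr; exact measure_biUnion_finset_le _ _
      _ = ∑ x ∈ F, t * μ (closedBall x (2 ^ 4 * r x)) := Finset.mul_sum _ _ _
      _ ≤ ∑ x ∈ F, β * ∫⁻ y in closedBall x (r x), ‖f y‖ₑ ∂μ :=
          Finset.sum_le_sum fun x hx => (hin x hx).le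
      _ = β * ∫⁻ y in ⋃ x ∈ F, closedBall x (r x), ‖f y‖ₑ ∂μ := by
          rw [← Finset.mul_sum, lintegral_biUnion_finset hdisj fun x _ => measurableSet_closedBall]
      _ ≤ β * I := by gcongr; exact setLIntegral_le_lintegral _ _
  · calc _ ≤ ∫⁻ y, 4 * (‖g₀ y‖ₑ ^ 2 + ‖(∑ x ∈ F, φ x) y‖ₑ ^ 2) ∂μ := by
          refine lintegral_mono fun y => ?_
          refine le_trans ?_ (ennreal_add_sq_le _ _)
          gcongr
          exact enorm_add_le _ _
      _ = 4 * (∫⁻ y, ‖g₀ y‖ₑ ^ 2 ∂μ + ∫⁻ y, ‖(∑ x ∈ F, φ x) y‖ₑ ^ 2 ∂μ) := by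
          rw [lintegral_const_mul' _ _ (by norm_num),
            lintegral_add_left' (hg₀b.aestronglyMeasurable.enorm.pow_const _)]
      _ ≤ 4 * (t * I + t * I + 2 * M * I) := by gcongr
      _ = _ := by rw [hM]; push_cast [ENNReal.coe_div hβ.ne']; ring
  · calc _ ≤ ∑ x ∈ F, C₃ * ∫⁻ y, ‖fD x y‖ₑ ∂μ := by
          refine Finset.sum_le_sum fun x hx => ?_
          refine le_trans (lintegral_mono_set (compl_subset_compl.2 (subset_biUnion_of_mem
            (u := fun x => closedBall x (2 ^ 4 * r x)) hx))) ?_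
          exact hC₃ x (r x) (ρ x) (fD x) (hr0 x hx) (hρr x hx) (hfDb x) (hfDsupp x) (hRpos x hx)
            (hρd x hx) (hρa x hx)
      _ = C₃ * ∑ x ∈ F, ∫⁻ y, ‖fD x y‖ₑ ∂μ := (Finset.mul_sum _ _ _).symm
      _ ≤ C₃ * I := by gcongr

/-- Calderón–Zygmund operators are of weak type `(1,1)`. -/
theorem HasStandardKernel.weak_type (hT : HasStandardKernel lam K T)
    (hX : GeometricallyDoubling X) (hμ : IsUpperDoubling μ lam) :
    ∃ C : ℝ≥0, ∀ (f : X → 𝕜) (t : ℝ≥0), BddSupp μ f → 0 < t →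
      t * μ {z | t < ‖app T f z‖ₑ} ≤ C * ∫⁻ y, ‖f y‖ₑ ∂μ := by
  obtain ⟨β, C, C', hdec⟩ := hT.exists_decomposition hX hμ
  have key : ∀ (f : X → 𝕜) (t : ℝ≥0), BddSupp μ f → 0 < t →
      t * μ {z | 2 * t < ‖app T f z‖ₑ} ≤ (β + ‖T‖₊ ^ 2 * C + C' : ℝ≥0) * ∫⁻ y, ‖f y‖ₑ ∂μ := by
    intro f t hf ht
    by_cases hI0 : ∫⁻ y, ‖f y‖ₑ ∂μ = 0
    · have h0 : f =ᵐ[μ] 0 := by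
        rw [lintegral_eq_zero_iff' hf.aestronglyMeasurable.enorm] at hI0
        filter_upwards [hI0] with z hz
        simpa using hz
      have h1 : app T f =ᵐ[μ] 0 := by
        rw [app_congr T (hf.memLp hμ 2) h0]; exact app_zero T
      have : μ {z | 2 * t < ‖app T f z‖ₑ} = 0 := by
        rw [measure_eq_zero_iff_ae_notMem]
        filter_upwards [h1] with z hz
        simp [hz]
      rw [this, mul_zero]; exact bot_le
    -- For small heights on a space of finite measure the estimate is trivial; otherwise stopping
    -- radii are bounded and the decomposition exists.
    by_cases hbig : t * μ univ ≤ β * ∫⁻ y, ‖f y‖ₑ ∂μ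
    · calc _ ≤ t * μ univ := by gcongr; exact subset_univ _
        _ ≤ _ := hbig
        _ ≤ _ := by gcongr; rw [add_assoc]; exact le_self_add
    obtain ⟨Ω, F, g, h, hΩm, hg, hh, hfgh, hΩ, hgsq, hbad⟩ :=
      hdec f t hf ht hI0 (not_le.1 hbig)
    set I := ∫⁻ y, ‖f y‖ₑ ∂μ with hI
    have ht0 : (t : ℝ≥0∞) ≠ 0 := by exact_mod_cast ht.ne'
    have hTf : app T f =ᵐ[μ] app T g + ∑ x ∈ F, app T (h x) := by
      conv_lhs => rw [hfgh]
      refine (app_add T (hg.memLp hμ 2) ((BddSupp.sum hh).memLp hμ 2)).trans ?_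
      exact (EventuallyEq.refl _ _).add (app_sum T fun x hx => (hh x hx).memLp hμ 2)
    set G := {z | (t : ℝ≥0∞) ≤ ‖app T g z‖ₑ} with hG
    set H := {z | (t : ℝ≥0∞) ≤ ∑ x ∈ F, ‖app T (h x) z‖ₑ} with hH
    have hGle : t * μ G ≤ ‖T‖ₑ ^ 2 * C * I := by
      have h1 : (t : ℝ≥0∞) ^ 2 * μ G ≤ ‖T‖ₑ ^ 2 * (t * (C * I)) := by
        calc _ ≤ t ^ 2 * μ {z | (t : ℝ≥0∞) ^ 2 ≤ ‖app T g z‖ₑ ^ 2} := by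
              gcongr
              intro z hz
              exact pow_le_pow_left' (show (t : ℝ≥0∞) ≤ ‖app T g z‖ₑ from hz) 2
          _ ≤ ∫⁻ z, ‖app T g z‖ₑ ^ 2 ∂μ :=
              mul_meas_ge_le_lintegral₀ ((memLp_app T).1.enorm.pow_const _) _
          _ ≤ ‖T‖ₑ ^ 2 * ∫⁻ z, ‖g z‖ₑ ^ 2 ∂μ := lintegral_app_sq_le T (hg.memLp hμ 2)
          _ ≤ _ := by gcongr
      refine (ENNReal.mul_le_mul_iff_right ht0 ENNReal.coe_ne_top).1 ?_
      calc (t : ℝ≥0∞) * (t * μ G) = t ^ 2 * μ G := by ring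
        _ ≤ _ := h1
        _ = _ := by ring
    have hHle : t * μ (Ωᶜ ∩ H) ≤ C' * I := by
      have hmeas : ∀ x ∈ F, AEMeasurable (fun z => ‖app T (h x) z‖ₑ) (μ.restrict Ωᶜ) :=
        fun x _ => (memLp_app T).1.enorm.restrict
      calc _ = t * (μ.restrict Ωᶜ) H := by
            rw [Measure.restrict_apply' hΩm.compl, inter_comm]
        _ ≤ ∫⁻ z in Ωᶜ, ∑ x ∈ F, ‖app T (h x) z‖ₑ ∂μ :=
            mul_meas_ge_le_lintegral₀ (Finset.aemeasurable_fun_sum _ hmeas) _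
        _ = ∑ x ∈ F, ∫⁻ z in Ωᶜ, ‖app T (h x) z‖ₑ ∂μ := lintegral_finsetSum' _ hmeas
        _ ≤ _ := hbad
    have hsub : {z | 2 * (t : ℝ≥0∞) < ‖app T f z‖ₑ} ≤ᵐ[μ] (Ω ∪ (G ∪ (Ωᶜ ∩ H)) : Set X) := by
      filter_upwards [hTf] with z hz hzt
      by_contra hcon
      have hcon' : z ∉ Ω ∪ (G ∪ (Ωᶜ ∩ H)) := hcon
      simp only [mem_union, mem_inter_iff, mem_compl_iff, not_or, not_and] at hcon'
      obtain ⟨h1, h2, h3⟩ := hcon'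
      have h4 : ‖app T g z‖ₑ < t := not_le.1 h2
      have h5 : ∑ x ∈ F, ‖app T (h x) z‖ₑ < t := not_le.1 (h3 h1)
      have h6 : 2 * (t : ℝ≥0∞) < ‖app T f z‖ₑ := hzt
      refine absurd h6 (not_lt.2 ?_)
      rw [hz, Pi.add_apply, Finset.sum_apply, two_mul]
      exact (enorm_add_le _ _).trans (add_le_add h4.le ((enorm_sum_le _ _).trans h5.le))
    calc _ ≤ t * (μ Ω + (μ G + μ (Ωᶜ ∩ H))) := by
          gcongr
          refine (measure_mono_ae hsub).trans ((measure_union_le _ _).trans ?_)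
          gcongr
          exact measure_union_le _ _
      _ = t * μ Ω + (t * μ G + t * μ (Ωᶜ ∩ H)) := by ring
      _ ≤ β * I + (‖T‖ₑ ^ 2 * C * I + C' * I) := by gcongr
      _ = _ := by push_cast; rw [← enorm_eq_nnnorm]; ring
  refine ⟨2 * (β + ‖T‖₊ ^ 2 * C + C'), fun f t hf ht => ?_⟩
  have h := key f (t / 2) hf (by positivity)
  have h2 : 2 * ((t / 2 : ℝ≥0) : ℝ≥0∞) = t := by
    rw [← ENNReal.coe_ofNat, ← ENNReal.coe_mul, mul_div_cancel₀ _ two_ne_zero]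
  rw [h2] at h
  calc t * μ {z | t < ‖app T f z‖ₑ} = 2 * (((t / 2 : ℝ≥0) : ℝ≥0∞) * μ {z | t < ‖app T f z‖ₑ}) := by
        rw [← mul_assoc, h2]
    _ ≤ _ := mul_le_mul_right h 2
    _ = _ := by push_cast; ring

end WeakType

/-! ### Truncation in space and size -/

section Truncation

variable {X : Type*} [MetricSpace X] [MeasurableSpace X] {𝕜 : Type*} [RCLike 𝕜]

/-- Truncation of `f` in space and in size. -/
noncomputable def trunc (x₀ : X) (f : X → 𝕜) (n : ℕ) : X → 𝕜 :=
  (closedBall x₀ n ∩ {z | ‖f z‖ ≤ n}).indicator f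

variable [BorelSpace X] {μ : Measure X} {f : X → 𝕜}

theorem measurableSet_trunc (x₀ : X) (hf : StronglyMeasurable f) (n : ℕ) :
    MeasurableSet (closedBall x₀ n ∩ {z | ‖f z‖ ≤ n}) :=
  measurableSet_closedBall.inter (measurableSet_le hf.norm.measurable measurable_const)

theorem stronglyMeasurable_trunc (x₀ : X) (hf : StronglyMeasurable f) (n : ℕ) :
    StronglyMeasurable (trunc x₀ f n) := hf.indicator (measurableSet_trunc x₀ hf n)

theorem bddSupp_trunc (x₀ : X) (hf : StronglyMeasurable f) (n : ℕ) : BddSupp μ (trunc x₀ f n) := by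
  refine ⟨memLp_top_of_bound (stronglyMeasurable_trunc x₀ hf n).aestronglyMeasurable n
    (Eventually.of_forall fun z => ?_), ?_⟩
  · rw [trunc]
    by_cases hz : z ∈ closedBall x₀ n ∩ {z | ‖f z‖ ≤ n}
    · rw [indicator_of_mem hz]; exact hz.2
    · rw [indicator_of_notMem hz]; simp
  · exact isBounded_closedBall.subset (Set.support_indicator_subset.trans inter_subset_left)

omit [MeasurableSpace X] [BorelSpace X] in
theorem eventually_trunc_eq (x₀ : X) (f : X → 𝕜) (z : X) : ∀ᶠ n in atTop, trunc x₀ f n z = f z := by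
  obtain ⟨N, hN⟩ := exists_nat_ge (max (dist z x₀) ‖f z‖)
  filter_upwards [eventually_ge_atTop N] with n hn
  have hn' : (N : ℝ) ≤ n := by exact_mod_cast hn
  have hz : z ∈ closedBall x₀ n ∩ {z | ‖f z‖ ≤ n} :=
    ⟨(le_max_left _ _).trans (hN.trans hn'), (le_max_right _ _).trans (hN.trans hn')⟩
  exact indicator_of_mem hz _

theorem tendsto_eLpNorm_trunc_sub (x₀ : X) (hf : StronglyMeasurable f) {p : ℝ≥0∞} (hp0 : p ≠ 0)
    (hp : p ≠ ∞) (hfp : MemLp f p μ) :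
    Tendsto (fun n => eLpNorm (trunc x₀ f n - f) p μ) atTop (𝓝 0) := by
  have hp0' : 0 < p.toReal := ENNReal.toReal_pos hp0 hp
  simp only [eLpNorm_eq_lintegral_rpow_enorm_toReal hp0 hp]
  have h : Tendsto (fun n => ∫⁻ z, ‖(trunc x₀ f n - f) z‖ₑ ^ p.toReal ∂μ) atTop
      (𝓝 (∫⁻ z, (0 : ℝ≥0∞) ∂μ)) := by
    refine tendsto_lintegral_of_dominated_convergence' (fun z => ‖f z‖ₑ ^ p.toReal)
      (fun n => ?_) (fun n => Eventually.of_forall fun z => ?_) ?_ (Eventually.of_forall fun z => ?_)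
    · exact (((stronglyMeasurable_trunc x₀ hf n).sub hf).enorm.pow_const _).aemeasurable
    · dsimp only
      gcongr
      rw [Pi.sub_apply, trunc]
      by_cases hz : z ∈ closedBall x₀ n ∩ {z | ‖f z‖ ≤ n}
      · rw [indicator_of_mem hz, sub_self]; simp
      · rw [indicator_of_notMem hz, zero_sub, enorm_neg]
    · exact (lintegral_rpow_enorm_lt_top_of_eLpNorm_lt_top hp0 hp hfp.2).ne
    · refine tendsto_const_nhds.congr' ?_
      filter_upwards [eventually_trunc_eq x₀ f z] with n hn
      simp [hn, hp0']
  rw [lintegral_zero] at h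
  have h2 := h.ennrpow_const (1 / p.toReal)
  rwa [ENNReal.zero_rpow_of_pos (by positivity)] at h2

end Truncation

/-! ### Extension from bounded functions with bounded support -/

section Extension

variable {X : Type*} [MetricSpace X] [MeasurableSpace X] [BorelSpace X] {𝕜 : Type*} [RCLike 𝕜]
  {μ : Measure X} {lam : X → ℝ → ℝ}

theorem exists_seq_app_trunc_tendsto (T : Lp 𝕜 2 μ →L[𝕜] Lp 𝕜 2 μ) (hμ : IsUpperDoubling μ lam)
    (x₀ : X) {f : X → 𝕜} (hf : StronglyMeasurable f) (hf2 : MemLp f 2 μ) :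
    TendstoInMeasure μ (fun n => app T (trunc x₀ f n)) atTop (app T f) := by
  refine tendstoInMeasure_of_tendsto_eLpNorm two_ne_zero (fun n => (memLp_app T).1)
    (memLp_app T).1 ?_
  have h := ENNReal.Tendsto.const_mul (a := ‖T‖ₑ)
    (tendsto_eLpNorm_trunc_sub x₀ hf two_ne_zero ENNReal.ofNat_ne_top hf2)
    (Or.inr enorm_ne_top)
  rw [mul_zero] at h
  refine tendsto_of_tendsto_of_tendsto_of_le_of_le tendsto_const_nhds h (fun _ => bot_le) fun n => ?_
  have hn := (bddSupp_trunc (μ := μ) x₀ hf n).memLp hμ 2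
  dsimp only
  rw [← eLpNorm_congr_ae (app_sub T hn hf2)]
  exact eLpNorm_app_le T (hn.sub hf2)

/-- The images of the truncations converge in `L²`, hence almost everywhere along a subsequence, and
Fatou's lemma carries the bound to the limit. -/
theorem eLpNorm_app_le_of_bddSupp (T : Lp 𝕜 2 μ →L[𝕜] Lp 𝕜 2 μ) (hμ : IsUpperDoubling μ lam)
    (x₀ : X) {p : ℝ≥0∞} {C : ℝ≥0}
    (hC : ∀ f : X → 𝕜, StronglyMeasurable f → BddSupp μ f →
      eLpNorm (app T f) p μ ≤ C * eLpNorm f p μ)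
    {f : X → 𝕜} (hf : StronglyMeasurable f) (hf2 : MemLp f 2 μ) :
    eLpNorm (app T f) p μ ≤ C * eLpNorm f p μ := by
  obtain ⟨ns, -, hns⟩ := (exists_seq_app_trunc_tendsto T hμ x₀ hf hf2).exists_seq_tendsto_ae
  refine (Lp.eLpNorm_lim_le_liminf_eLpNorm (fun n => (memLp_app T).1) _ hns).trans ?_
  refine liminf_le_of_le (by isBoundedDefault) fun b hb => ?_
  obtain ⟨n, hn⟩ := hb.exists
  refine hn.trans ((hC _ (stronglyMeasurable_trunc x₀ hf _) (bddSupp_trunc x₀ hf _)).trans ?_)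
  gcongr
  exact eLpNorm_indicator_le _

/-- Extension of an `L²` bounded operator to `L^p`. -/
theorem exists_extension (T : Lp 𝕜 2 μ →L[𝕜] Lp 𝕜 2 μ) (hμ : IsUpperDoubling μ lam)
    (x₀ : X) {p : ℝ≥0∞} [Fact (1 ≤ p)] (hp : p ≠ ∞) {C : ℝ≥0}
    (hC : ∀ f : X → 𝕜, StronglyMeasurable f → BddSupp μ f →
      eLpNorm (app T f) p μ ≤ C * eLpNorm f p μ) :
    ∃ S : Lp 𝕜 p μ →L[𝕜] Lp 𝕜 p μ,
      ∀ (f : Lp 𝕜 p μ) (g : Lp 𝕜 2 μ), f =ᵐ[μ] g → S f =ᵐ[μ] T g := by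
  have hp0 : p ≠ 0 := (zero_lt_one.trans_le (Fact.out : 1 ≤ p)).ne'
  -- The domain is all of `L^p ∩ L²`, so that the extension agrees with `T` there by construction;
  -- truncations show it to be dense.
  let W : Submodule 𝕜 (Lp 𝕜 p μ) :=
    { carrier := {f | MemLp f 2 μ}
      zero_mem' := (memLp_congr_ae (Lp.coeFn_zero 𝕜 p μ)).2 MemLp.zero
      add_mem' := fun {f g} hf hg => (memLp_congr_ae (Lp.coeFn_add f g)).2 (hf.add hg)
      smul_mem' := fun c f hf => (memLp_congr_ae (Lp.coeFn_smul c f)).2 (hf.const_smul c) }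
  have hbound : ∀ f : W, eLpNorm (app T (f : Lp 𝕜 p μ)) p μ ≤ C * eLpNorm (f : Lp 𝕜 p μ) p μ :=
    fun f => eLpNorm_app_le_of_bddSupp T hμ x₀ hC (Lp.stronglyMeasurable _) f.2
  have hmem : ∀ f : W, MemLp (app T (f : Lp 𝕜 p μ)) p μ := fun f =>
    ⟨(memLp_app T).1, (hbound f).trans_lt (ENNReal.mul_lt_top ENNReal.coe_lt_top
      (Lp.eLpNorm_lt_top _))⟩
  let Φ : W →ₗ[𝕜] Lp 𝕜 p μ :=
    { toFun := fun f => (hmem f).toLp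
      map_add' := fun f g => by
        rw [← MemLp.toLp_add, MemLp.toLp_eq_toLp_iff]
        rw [show app T ((f + g : W) : Lp 𝕜 p μ) = app T ((f : Lp 𝕜 p μ) + (g : Lp 𝕜 p μ) : X → 𝕜)
          from app_congr T (f + g).2 (Lp.coeFn_add _ _)]
        exact app_add T f.2 g.2
      map_smul' := fun c f => by
        rw [RingHom.id_apply, ← MemLp.toLp_const_smul, MemLp.toLp_eq_toLp_iff]
        rw [show app T ((c • f : W) : Lp 𝕜 p μ) = app T (c • (f : Lp 𝕜 p μ) : X → 𝕜)
          from app_congr T (c • f).2 (Lp.coeFn_smul _ _)]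
        exact app_const_smul T f.2 c }
  have hdense : DenseRange W.subtype := by
    intro f
    have hs := Lp.stronglyMeasurable f
    have hb := fun n => bddSupp_trunc (μ := μ) x₀ hs n
    have hlim : Tendsto (fun n => ((hb n).memLp hμ p).toLp) atTop (𝓝 f) := by
      rw [Lp.tendsto_Lp_iff_tendsto_eLpNorm']
      refine (tendsto_eLpNorm_trunc_sub x₀ hs hp0 hp (Lp.memLp f)).congr fun n => ?_
      exact eLpNorm_congr_ae (((hb n).memLp hμ p).coeFn_toLp.symm.sub (EventuallyEq.refl _ _))
    refine mem_closure_of_tendsto hlim (Eventually.of_forall fun n => ?_)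
    exact ⟨⟨((hb n).memLp hμ p).toLp,
      (memLp_congr_ae ((hb n).memLp hμ p).coeFn_toLp).2 ((hb n).memLp hμ 2)⟩, rfl⟩
  refine ⟨Φ.extendOfNorm W.subtype, fun f g hfg => ?_⟩
  have hfW : MemLp f 2 μ := (memLp_congr_ae hfg).2 (Lp.memLp g)
  have h1 : Φ.extendOfNorm W.subtype f = Φ ⟨f, hfW⟩ := by
    refine LinearMap.extendOfNorm_eq hdense ⟨C, fun w => ?_⟩ ⟨f, hfW⟩
    show ‖(hmem w).toLp‖ ≤ C * ‖(w : Lp 𝕜 p μ)‖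
    rw [Lp.norm_toLp, Lp.norm_def, ← ENNReal.coe_toReal, ← ENNReal.toReal_mul]
    exact ENNReal.toReal_mono (ENNReal.mul_ne_top ENNReal.coe_ne_top (Lp.eLpNorm_ne_top _))
      (hbound w)
  rw [h1]
  refine (hmem ⟨f, hfW⟩).coeFn_toLp.trans ?_
  rw [show app T (f : X → 𝕜) = app T (g : X → 𝕜) from app_congr T hfW hfg, app_coeFn]

end Extension

/-! ### Marcinkiewicz interpolation -/

section Marcinkiewicz

theorem setLIntegral_Ioo_rpow_le {s a : ℝ} (hs : -1 < s) (ha : 0 ≤ a) :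
    ∫⁻ t in Ioo 0 a, ENNReal.ofReal (t ^ s) ≤ ENNReal.ofReal (a ^ (s + 1) / (s + 1)) := by
  have hint : IntegrableOn (fun t : ℝ => t ^ s) (Ioc 0 a) :=
    (intervalIntegrable_iff_integrableOn_Ioc_of_le ha).1 (intervalIntegral.intervalIntegrable_rpow' hs)
  have h0 : 0 ≤ᵐ[volume.restrict (Ioc 0 a)] fun t : ℝ => t ^ s := by
    rw [EventuallyLE, ae_restrict_iff' measurableSet_Ioc]
    exact Eventually.of_forall fun t ht => Real.rpow_nonneg ht.1.le _
  calc _ ≤ ∫⁻ t in Ioc 0 a, ENNReal.ofReal (t ^ s) := lintegral_mono_set Ioo_subset_Ioc_self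
    _ = ENNReal.ofReal (∫ t in Ioc 0 a, t ^ s) := (ofReal_integral_eq_lintegral_ofReal hint h0).symm
    _ = _ := by
      rw [← intervalIntegral.integral_of_le ha, integral_rpow (Or.inl hs),
        Real.zero_rpow (by linarith), sub_zero]

theorem setLIntegral_Ici_rpow {s a : ℝ} (hs : s < -1) (ha : 0 < a) :
    ∫⁻ t in Ici a, ENNReal.ofReal (t ^ s) = ENNReal.ofReal (a ^ (s + 1) / (-(s + 1))) := by
  have hint := integrableOn_Ioi_rpow_of_lt hs ha
  have h0 : 0 ≤ᵐ[volume.restrict (Ioi a)] fun t : ℝ => t ^ s := by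
    rw [EventuallyLE, ae_restrict_iff' measurableSet_Ioi]
    exact Eventually.of_forall fun t ht => Real.rpow_nonneg (ha.trans ht).le _
  rw [setLIntegral_congr (Ioi_ae_eq_Ici (μ := volume) (a := a)).symm,
    ← ofReal_integral_eq_lintegral_ofReal hint h0, integral_Ioi_rpow_of_lt hs ha, div_neg, neg_div]

theorem enorm_rpow_eq_ofReal {E : Type*} [SeminormedAddCommGroup E] (x : E) {p : ℝ} (hp : 0 ≤ p) :
    ‖x‖ₑ ^ p = ENNReal.ofReal (‖x‖ ^ p) := by
  rw [← ofReal_norm, ENNReal.ofReal_rpow_of_nonneg (norm_nonneg _) hp]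

variable {X : Type*} [MetricSpace X] [MeasurableSpace X] [BorelSpace X] {𝕜 : Type*} [RCLike 𝕜]
  {μ : Measure X} {lam : X → ℝ → ℝ}

-- Cut `f` at height `t`: the weak type inequality is used for the large values, Chebyshev and the
-- `L²` bound for the small ones. The threshold concerns `|T f| / 2`, so each part is tested at
-- height `t`, and the weight `t ^ (p - 1)` is the one of the layer cake formula.
omit [BorelSpace X] in
theorem meas_lt_app_le (T : Lp 𝕜 2 μ →L[𝕜] Lp 𝕜 2 μ) (hμ : IsUpperDoubling μ lam) {C : ℝ≥0}
    (hC : ∀ (f : X → 𝕜) (t : ℝ≥0), BddSupp μ f → 0 < t →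
      t * μ {z | t < ‖app T f z‖ₑ} ≤ C * ∫⁻ y, ‖f y‖ₑ ∂μ)
    {f : X → 𝕜} (hfm : StronglyMeasurable f) (hf : BddSupp μ f) {p t : ℝ} (ht : 0 < t) :
    μ {z | t < ‖app T f z‖ / 2} * ENNReal.ofReal (t ^ (p - 1)) ≤
      C * (∫⁻ z, (if t < ‖f z‖ then ENNReal.ofReal (t ^ (p - 2)) * ‖f z‖ₑ else 0) ∂μ) +
      ‖T‖ₑ ^ 2 * ∫⁻ z, (if ‖f z‖ ≤ t then ENNReal.ofReal (t ^ (p - 3)) * ‖f z‖ₑ ^ 2 else 0) ∂μ := by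
  set A : Set X := {z | t < ‖f z‖} with hA
  have hAm : MeasurableSet A := measurableSet_lt measurable_const hfm.norm.measurable
  set f₁ := A.indicator f with hf₁
  set f₂ := Aᶜ.indicator f with hf₂
  have h₁ : BddSupp μ f₁ := hf.indicator hAm
  have h₂ : BddSupp μ f₂ := hf.indicator hAm.compl
  have hsum : f = f₁ + f₂ := (indicator_self_add_compl A f).symm
  have hT : app T f =ᵐ[μ] app T f₁ + app T f₂ := by
    conv_lhs => rw [hsum]
    exact app_add T (h₁.memLp hμ 2) (h₂.memLp hμ 2)
  set τ : ℝ≥0∞ := ENNReal.ofReal t with hτ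
  have hsub : {z | t < ‖app T f z‖ / 2} ≤ᵐ[μ]
      ({z | τ < ‖app T f₁ z‖ₑ} ∪ {z | τ ≤ ‖app T f₂ z‖ₑ} : Set X) := by
    filter_upwards [hT] with z hz hzt
    have hzt' : t < ‖app T f z‖ / 2 := hzt
    by_contra hcon
    have hcon' : z ∉ ({z | τ < ‖app T f₁ z‖ₑ} ∪ {z | τ ≤ ‖app T f₂ z‖ₑ} : Set X) := hcon
    simp only [mem_union, mem_ofPred_eq, not_or, not_lt, not_le, hτ, ← ofReal_norm,
      ENNReal.ofReal_le_ofReal_iff ht.le, ENNReal.ofReal_lt_ofReal_iff ht] at hcon'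
    rw [hz, Pi.add_apply] at hzt'
    linarith [norm_add_le (app T f₁ z) (app T f₂ z)]
  have e1 : ENNReal.ofReal (t ^ (p - 1)) = τ * ENNReal.ofReal (t ^ (p - 2)) := by
    rw [hτ, ← ENNReal.ofReal_mul ht.le]
    congr 1
    rw [show p - 1 = 1 + (p - 2) by ring, Real.rpow_add ht, Real.rpow_one]
  have e2 : ENNReal.ofReal (t ^ (p - 1)) = τ ^ 2 * ENNReal.ofReal (t ^ (p - 3)) := by
    rw [hτ, ← ENNReal.ofReal_pow ht.le, ← ENNReal.ofReal_mul (by positivity)]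
    congr 1
    rw [show p - 1 = (2 : ℕ) + (p - 3) by push_cast; ring, Real.rpow_add ht, Real.rpow_natCast]
  have b1 : τ * μ {z | τ < ‖app T f₁ z‖ₑ} ≤ C * ∫⁻ z, ‖f₁ z‖ₑ ∂μ :=
    hC f₁ (Real.toNNReal t) h₁ (Real.toNNReal_pos.2 ht)
  have b2 : τ ^ 2 * μ {z | τ ≤ ‖app T f₂ z‖ₑ} ≤ ‖T‖ₑ ^ 2 * ∫⁻ z, ‖f₂ z‖ₑ ^ 2 ∂μ := by
    calc _ ≤ τ ^ 2 * μ {z | τ ^ 2 ≤ ‖app T f₂ z‖ₑ ^ 2} := by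
          refine mul_le_mul_right (measure_mono fun z hz => ?_) _
          exact pow_le_pow_left' (show τ ≤ ‖app T f₂ z‖ₑ from hz) 2
      _ ≤ ∫⁻ z, ‖app T f₂ z‖ₑ ^ 2 ∂μ :=
          mul_meas_ge_le_lintegral₀ ((memLp_app T).1.enorm.pow_const _) _
      _ ≤ _ := lintegral_app_sq_le T (h₂.memLp hμ 2)
  have i1 : ∫⁻ z, (if t < ‖f z‖ then ENNReal.ofReal (t ^ (p - 2)) * ‖f z‖ₑ else 0) ∂μ =
      ENNReal.ofReal (t ^ (p - 2)) * ∫⁻ z, ‖f₁ z‖ₑ ∂μ := by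
    rw [← lintegral_const_mul' _ _ ENNReal.ofReal_ne_top]
    refine lintegral_congr fun z => ?_
    by_cases hz : t < ‖f z‖
    · rw [if_pos hz, hf₁, indicator_of_mem (show z ∈ A from hz)]
    · rw [if_neg hz, hf₁, indicator_of_notMem (show z ∉ A from hz)]; simp
  have i2 : ∫⁻ z, (if ‖f z‖ ≤ t then ENNReal.ofReal (t ^ (p - 3)) * ‖f z‖ₑ ^ 2 else 0) ∂μ =
      ENNReal.ofReal (t ^ (p - 3)) * ∫⁻ z, ‖f₂ z‖ₑ ^ 2 ∂μ := by
    rw [← lintegral_const_mul' _ _ ENNReal.ofReal_ne_top]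
    refine lintegral_congr fun z => ?_
    by_cases hz : ‖f z‖ ≤ t
    · rw [if_pos hz, hf₂, indicator_of_mem (show z ∈ Aᶜ from not_lt.2 hz)]
    · rw [if_neg hz, hf₂, indicator_of_notMem (show z ∉ Aᶜ from fun h => h (not_le.1 hz))]; simp
  calc _ ≤ (μ {z | τ < ‖app T f₁ z‖ₑ} + μ {z | τ ≤ ‖app T f₂ z‖ₑ}) *
        ENNReal.ofReal (t ^ (p - 1)) := by
        gcongr
        exact (measure_mono_ae hsub).trans (measure_union_le _ _)
    _ = (τ * μ {z | τ < ‖app T f₁ z‖ₑ}) * ENNReal.ofReal (t ^ (p - 2)) +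
        (τ ^ 2 * μ {z | τ ≤ ‖app T f₂ z‖ₑ}) * ENNReal.ofReal (t ^ (p - 3)) := by
        rw [add_mul]; nth_rewrite 1 [e1]; rw [e2]; ring
    _ ≤ (C * ∫⁻ z, ‖f₁ z‖ₑ ∂μ) * ENNReal.ofReal (t ^ (p - 2)) +
        (‖T‖ₑ ^ 2 * ∫⁻ z, ‖f₂ z‖ₑ ^ 2 ∂μ) * ENNReal.ofReal (t ^ (p - 3)) := by gcongr
    _ = _ := by rw [i1, i2]; ring

omit [BorelSpace X] in
/-- Interpolation between weak type `(1,1)` and boundedness on `L²`. -/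
theorem exists_lintegral_app_rpow_le [SigmaFinite μ] (T : Lp 𝕜 2 μ →L[𝕜] Lp 𝕜 2 μ)
    (hμ : IsUpperDoubling μ lam) {C : ℝ≥0}
    (hC : ∀ (f : X → 𝕜) (t : ℝ≥0), BddSupp μ f → 0 < t →
      t * μ {z | t < ‖app T f z‖ₑ} ≤ C * ∫⁻ y, ‖f y‖ₑ ∂μ) {p : ℝ} (hp1 : 1 < p) (hp2 : p < 2) :
    ∃ C' : ℝ≥0, ∀ f : X → 𝕜, StronglyMeasurable f → BddSupp μ f →
      ∫⁻ z, ‖app T f z‖ₑ ^ p ∂μ ≤ C' * ∫⁻ z, ‖f z‖ₑ ^ p ∂μ := by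
  have hp0 : 0 < p := by linarith
  set c₁ : ℝ≥0 := Real.toNNReal (1 / (p - 1)) with hc₁
  set c₂ : ℝ≥0 := Real.toNNReal (1 / (2 - p)) with hc₂
  refine ⟨Real.toNNReal (2 ^ p) * (Real.toNNReal p * (C * c₁ + ‖T‖₊ ^ 2 * c₂)),
    fun f hfm hf => ?_⟩
  have hnm : Measurable fun q : ℝ × X => ‖f q.2‖ := hfm.norm.measurable.comp measurable_snd
  have hem : Measurable fun q : ℝ × X => ‖f q.2‖ₑ := hfm.enorm.comp measurable_snd
  -- the two inner integrals
  have I1 : ∀ z, ∫⁻ t in Ioi (0 : ℝ), (if t < ‖f z‖ then ENNReal.ofReal (t ^ (p - 2)) * ‖f z‖ₑ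
      else 0) ≤ c₁ * ‖f z‖ₑ ^ p := by
    intro z
    calc _ ≤ ∫⁻ t in Ioi (0 : ℝ), (Iio ‖f z‖).indicator
          (fun t => ENNReal.ofReal (t ^ (p - 2)) * ‖f z‖ₑ) t := by
          refine lintegral_mono fun t => ?_
          rw [indicator_apply]
          rfl
      _ = ∫⁻ t in Ioo 0 ‖f z‖, ENNReal.ofReal (t ^ (p - 2)) * ‖f z‖ₑ := by
          rw [lintegral_indicator measurableSet_Iio, Measure.restrict_restrict measurableSet_Iio,
            inter_comm, Ioi_inter_Iio]
      _ = (∫⁻ t in Ioo 0 ‖f z‖, ENNReal.ofReal (t ^ (p - 2))) * ‖f z‖ₑ :=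
          lintegral_mul_const' _ _ enorm_ne_top
      _ ≤ ENNReal.ofReal (‖f z‖ ^ (p - 2 + 1) / (p - 2 + 1)) * ‖f z‖ₑ := by
          gcongr
          exact setLIntegral_Ioo_rpow_le (by linarith) (norm_nonneg _)
      _ = _ := by
          rw [← ofReal_norm, hc₁, ← ENNReal.ofReal_mul (by
            have : 0 < p - 2 + 1 := by linarith
            positivity), ENNReal.ofReal_rpow_of_nonneg (norm_nonneg _) hp0.le]
          change _ = ENNReal.ofReal _ * _
          rw [← ENNReal.ofReal_mul (by
            have : 0 < p - 1 := by linarith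
            positivity)]
          congr 1
          have h : ‖f z‖ ^ p = ‖f z‖ ^ (p - 2 + 1) * ‖f z‖ := by
            rw [← Real.rpow_add_one' (norm_nonneg _) (by linarith)]; ring_nf
          rw [h, show p - 2 + 1 = p - 1 by ring]
          ring
  -- This integral converges at infinity because `p < 2`, just as the one in `I1` converges at `0`
  -- because `p > 1`.
  have I2 : ∀ z, ∫⁻ t in Ioi (0 : ℝ), (if ‖f z‖ ≤ t then ENNReal.ofReal (t ^ (p - 3)) * ‖f z‖ₑ ^ 2
      else 0) ≤ c₂ * ‖f z‖ₑ ^ p := by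
    intro z
    rcases (norm_nonneg (f z)).eq_or_lt with h0 | h0
    · have : f z = 0 := norm_eq_zero.1 h0.symm
      simp [this]
    calc _ ≤ ∫⁻ t, (Ici ‖f z‖).indicator
          (fun t => ENNReal.ofReal (t ^ (p - 3)) * ‖f z‖ₑ ^ 2) t := by
          refine (setLIntegral_le_lintegral _ _).trans (lintegral_mono fun t => ?_)
          rw [indicator_apply]
          rfl
      _ = ∫⁻ t in Ici ‖f z‖, ENNReal.ofReal (t ^ (p - 3)) * ‖f z‖ₑ ^ 2 :=
          lintegral_indicator measurableSet_Ici _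
      _ = (∫⁻ t in Ici ‖f z‖, ENNReal.ofReal (t ^ (p - 3))) * ‖f z‖ₑ ^ 2 :=
          lintegral_mul_const' _ _ (by finiteness)
      _ = ENNReal.ofReal (‖f z‖ ^ (p - 3 + 1) / (-(p - 3 + 1))) * ‖f z‖ₑ ^ 2 := by
          rw [setLIntegral_Ici_rpow (by linarith) h0]
      _ = _ := by
          have h2p : 0 < 2 - p := by linarith
          rw [enorm_rpow_eq_ofReal _ hp0.le, ← ofReal_norm, ← ENNReal.ofReal_pow h0.le, hc₂]
          change _ = ENNReal.ofReal _ * _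
          rw [show -(p - 3 + 1) = 2 - p by ring, ← ENNReal.ofReal_mul (by positivity),
            ← ENNReal.ofReal_mul (by positivity)]
          congr 1
          have h : ‖f z‖ ^ p = ‖f z‖ ^ (p - 3 + 1) * ‖f z‖ ^ 2 := by
            rw [← Real.rpow_add_natCast h0.ne']; norm_num; ring_nf
          rw [h]
          ring
  have meas1 : Measurable (Function.uncurry fun (t : ℝ) (z : X) =>
      if t < ‖f z‖ then ENNReal.ofReal (t ^ (p - 2)) * ‖f z‖ₑ else 0) :=
    Measurable.ite (measurableSet_lt measurable_fst hnm)
      ((measurable_fst.pow_const _).ennreal_ofReal.mul hem) measurable_const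
  have meas2 : Measurable (Function.uncurry fun (t : ℝ) (z : X) =>
      if ‖f z‖ ≤ t then ENNReal.ofReal (t ^ (p - 3)) * ‖f z‖ₑ ^ 2 else 0) :=
    Measurable.ite (measurableSet_le hnm measurable_fst)
      ((measurable_fst.pow_const _).ennreal_ofReal.mul (hem.pow_const _)) measurable_const
  have J1 : ∫⁻ t in Ioi (0 : ℝ), ∫⁻ z, (if t < ‖f z‖ then ENNReal.ofReal (t ^ (p - 2)) * ‖f z‖ₑ
      else 0) ∂μ ≤ c₁ * ∫⁻ z, ‖f z‖ₑ ^ p ∂μ := by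
    rw [lintegral_lintegral_swap meas1.aemeasurable, ← lintegral_const_mul' _ _ ENNReal.coe_ne_top]
    exact lintegral_mono I1
  have J2 : ∫⁻ t in Ioi (0 : ℝ), ∫⁻ z, (if ‖f z‖ ≤ t then ENNReal.ofReal (t ^ (p - 3)) * ‖f z‖ₑ ^ 2
      else 0) ∂μ ≤ c₂ * ∫⁻ z, ‖f z‖ₑ ^ p ∂μ := by
    rw [lintegral_lintegral_swap meas2.aemeasurable, ← lintegral_const_mul' _ _ ENNReal.coe_ne_top]
    exact lintegral_mono I2
  have hlayer := lintegral_rpow_eq_lintegral_meas_lt_mul μ (f := fun z => ‖app T f z‖ / 2)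
    (Eventually.of_forall fun z => by simp only [Pi.zero_apply]; positivity)
    ((memLp_app T).1.norm.aemeasurable.div_const 2) hp0
  have hscale : ∀ z, ‖app T f z‖ₑ ^ p =
      Real.toNNReal (2 ^ p) * ENNReal.ofReal ((‖app T f z‖ / 2) ^ p) := by
    intro z
    rw [enorm_rpow_eq_ofReal _ hp0.le]
    change _ = ENNReal.ofReal _ * _
    rw [← ENNReal.ofReal_mul (by positivity), ← Real.mul_rpow (by norm_num) (by positivity),
      mul_div_cancel₀ _ two_ne_zero]
  calc _ = Real.toNNReal (2 ^ p) * ∫⁻ z, ENNReal.ofReal ((‖app T f z‖ / 2) ^ p) ∂μ := by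
        simp_rw [hscale]
        exact lintegral_const_mul' _ _ ENNReal.coe_ne_top
    _ ≤ Real.toNNReal (2 ^ p) * (ENNReal.ofReal p * ∫⁻ t in Ioi (0 : ℝ),
        (C * (∫⁻ z, (if t < ‖f z‖ then ENNReal.ofReal (t ^ (p - 2)) * ‖f z‖ₑ else 0) ∂μ) +
        ‖T‖ₑ ^ 2 * ∫⁻ z, (if ‖f z‖ ≤ t then ENNReal.ofReal (t ^ (p - 3)) * ‖f z‖ₑ ^ 2
          else 0) ∂μ)) := by
        rw [hlayer]
        gcongr 2
        exact setLIntegral_mono' measurableSet_Ioi fun t ht => meas_lt_app_le T hμ hC hfm hf ht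
    _ ≤ Real.toNNReal (2 ^ p) * (Real.toNNReal p * (C * (c₁ * ∫⁻ z, ‖f z‖ₑ ^ p ∂μ) +
        ‖T‖ₑ ^ 2 * (c₂ * ∫⁻ z, ‖f z‖ₑ ^ p ∂μ))) := by
        rw [lintegral_add_left ((meas1.lintegral_prod_right).const_mul _),
          lintegral_const_mul' _ _ ENNReal.coe_ne_top, lintegral_const_mul' _ _ (by finiteness)]
        rw [ENNReal.ofReal]
        gcongr
    _ = _ := by push_cast; rw [← enorm_eq_nnnorm]; ring

end Marcinkiewicz

/-! ### The adjoint operator and its kernel -/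

section Adjoint

open ComplexConjugate

variable {X : Type*} [MetricSpace X] [MeasurableSpace X] {𝕜 : Type*} [RCLike 𝕜]
  {μ : Measure X} {lam : X → ℝ → ℝ} {K : X → X → 𝕜} {T : Lp 𝕜 2 μ →L[𝕜] Lp 𝕜 2 μ}

omit [MetricSpace X] in
theorem integral_conj_mul_app_adjoint (T : Lp 𝕜 2 μ →L[𝕜] Lp 𝕜 2 μ) {f g : X → 𝕜}
    (hf : MemLp f 2 μ) (hg : MemLp g 2 μ) :
    ∫ z, app (ContinuousLinearMap.adjoint T) f z * conj (g z) ∂μ =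
      ∫ z, f z * conj (app T g z) ∂μ := by
  have h := ContinuousLinearMap.adjoint_inner_right T (hg.toLp g) (hf.toLp f)
  rw [L2.inner_def, L2.inner_def] at h
  rw [app_eq _ hf, app_eq _ hg]
  simp only [RCLike.inner_apply] at h
  refine (integral_congr_ae ?_).trans (h.trans (integral_congr_ae ?_))
  · filter_upwards [hg.coeFn_toLp] with z hz
    rw [hz]
  · filter_upwards [hf.coeFn_toLp] with z hz
    rw [hz]

/-- This is the bound behind Fubini's theorem for the adjoint. With `dist x y ≥ 1 / (n + 1)`, both
the radius `1` and `dist y x₀ ≤ n` are at most `(n + 1) ^ 2 * dist x y`, so `λ` at `y` is bounded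
below by a multiple of `λ` at `x₀`. -/
theorem exists_bound_of_separated (hμ : IsUpperDoubling μ lam) (h : ∃ C : ℝ≥0, ∀ x y, x ≠ y →
    ‖K x y‖ₑ ≤ C * (dom lam y (dist x y))⁻¹) (x₀ : X) (n : ℕ) :
    ∃ B : ℝ, ∀ x y, y ∈ closedBall x₀ n → (1 : ℝ) / (n + 1) ≤ dist x y → ‖K x y‖ ≤ B := by
  obtain ⟨C, hC⟩ := h
  obtain ⟨D, hD⟩ := hμ.dom_le (a := ((n : ℝ) + 1) ^ 2) (by positivity)
  have htop : (C : ℝ≥0∞) * (D * (dom lam x₀ 1)⁻¹) ≠ ∞ := by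
    have := ENNReal.inv_ne_top.2 (hμ.dom_ne_zero x₀ one_pos)
    finiteness
  refine ⟨(C * (D * (dom lam x₀ 1)⁻¹) : ℝ≥0∞).toReal, fun x y hy hxy => ?_⟩
  have hn : (0 : ℝ) < 1 / (n + 1) := by positivity
  have hd : 0 < dist x y := hn.trans_le hxy
  rw [← toReal_enorm]
  refine ENNReal.toReal_mono htop ((hC x y (dist_pos.1 hd)).trans ?_)
  gcongr
  rw [← div_eq_mul_inv, ENNReal.le_div_iff_mul_le (Or.inl (hμ.dom_ne_zero x₀ one_pos))
    (Or.inl dom_ne_top), mul_comm, ← div_eq_mul_inv,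
    ENNReal.div_le_iff (hμ.dom_ne_zero y hd) dom_ne_top]
  have h1 : (n : ℝ) + 1 ≤ (n + 1) ^ 2 * dist x y := by
    calc (n : ℝ) + 1 = (n + 1) ^ 2 * (1 / (n + 1)) := by field_simp
      _ ≤ _ := by gcongr
  refine hD x₀ y _ _ hd one_pos ?_ ?_
  · rw [dist_comm]
    exact (mem_closedBall.1 hy).trans (by linarith)
  · have : (0 : ℝ) ≤ n := by positivity
    linarith

variable [BorelSpace X]

/-- The adjoint of a Calderón–Zygmund operator has the transposed conjugate kernel. -/
theorem IsCZOperator.adjoint_representation [SecondCountableTopology X] [SigmaFinite μ]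
    (hμ : IsUpperDoubling μ lam) (hT : IsCZOperator lam K T) {f : X → 𝕜} (hf : BddSupp μ f) :
    ∀ᵐ x ∂μ, x ∉ tsupport f →
      app (ContinuousLinearMap.adjoint T) f x = ∫ y, conj (K y x) * f y ∂μ := by
  rcases isEmpty_or_nonempty X with hE | ⟨⟨x₀⟩⟩
  · exact Eventually.of_forall fun x => (hE.false x).elim
  set T' := ContinuousLinearMap.adjoint T with hT'
  set F := tsupport f with hF
  have hFc : IsClosed F := isClosed_tsupport f
  -- Closed bounded sets at positive distance from the support of `f` that exhaust its complement;
  -- on each of them the kernel is bounded against `f`.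
  set P : ℕ → Set X := fun n => (thickening (1 / ((n : ℝ) + 1)) F)ᶜ ∩ closedBall x₀ n with hP
  have hPc : ∀ n, IsClosed (P n) := fun n => isOpen_thickening.isClosed_compl.inter isClosed_closedBall
  have hdist : ∀ n, ∀ x ∈ P n, ∀ y ∈ F, (1 : ℝ) / (n + 1) ≤ dist y x := by
    intro n x hx y hy
    by_contra! hcon
    exact hx.1 (mem_thickening_iff.2 ⟨y, hy, by rwa [dist_comm]⟩)
  have hcover : ∀ x, x ∉ F → ∃ n, x ∈ P n := by
    intro x hx
    obtain ⟨ε, hε, hball⟩ := Metric.isOpen_iff.1 hFc.isOpen_compl x hx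
    obtain ⟨n₁, hn₁⟩ := exists_nat_one_div_lt hε
    obtain ⟨n₂, hn₂⟩ := exists_nat_ge (dist x x₀)
    refine ⟨max n₁ n₂, fun hx' => ?_, hn₂.trans (by exact_mod_cast le_max_right _ _)⟩
    obtain ⟨y, hy, hxy⟩ := mem_thickening_iff.1 hx'
    refine hball (a := y) ?_ hy
    rw [mem_ball, dist_comm]
    refine hxy.trans (lt_of_le_of_lt ?_ hn₁)
    have : (n₁ : ℝ) ≤ (max n₁ n₂ : ℕ) := by exact_mod_cast le_max_left _ _
    gcongr
  -- Local integrability of the kernel enters through its joint measurability off the diagonal.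
  have hKm : AEStronglyMeasurable (fun p : X × X => K p.1 p.2)
      ((μ.prod μ).restrict {p | p.1 ≠ p.2}) := hT.1.locallyIntegrable.aestronglyMeasurable
  have main : ∀ n, ∀ᵐ x ∂μ.restrict (P n), app T' f x = ∫ y, conj (K y x) * f y ∂μ := by
    intro n
    have hPb : Bornology.IsBounded (P n) := isBounded_closedBall.subset inter_subset_right
    have hPfin : μ (P n) < ∞ := hμ.measure_lt_top_of_isBounded hPb
    have : IsFiniteMeasure (μ.restrict (P n)) := ⟨by rwa [Measure.restrict_apply_univ]⟩
    set k : X → X → 𝕜 := fun y x => conj (K y x) * f y with hk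
    obtain ⟨B, hB⟩ := exists_bound_of_separated hμ
      (exists_enorm_le_of_size hμ hT.1.size) x₀ n
    have hrect : F ×ˢ P n ⊆ {p : X × X | p.1 ≠ p.2} := by
      rintro ⟨y, x⟩ ⟨hy, hx⟩ (rfl : y = x)
      have := hdist n y hx y hy
      rw [dist_self] at this
      exact absurd this (not_le.2 (by positivity))
    have hint : Integrable (Function.uncurry k) ((μ.restrict F).prod (μ.restrict (P n))) := by
      have hbd : Integrable (fun p : X × X => ‖f p.1‖ * B)
          ((μ.restrict F).prod (μ.restrict (P n))) :=
        ((hf.integrable hμ).norm.restrict).mul_prod (integrable_const B)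
      refine hbd.mono' ?_ ?_
      · refine AEStronglyMeasurable.mul ?_ hf.aestronglyMeasurable.restrict.comp_fst
        rw [Measure.prod_restrict]
        exact RCLike.continuous_conj.comp_aestronglyMeasurable (hKm.mono_set hrect)
      · rw [Measure.prod_restrict, ae_restrict_iff' (hFc.measurableSet.prod (hPc n).measurableSet)]
        refine Eventually.of_forall fun p hp => ?_
        simp only [Function.uncurry, hk, norm_mul, RCLike.norm_conj]
        rw [mul_comm]
        gcongr
        exact hB _ _ hp.2.2 (hdist n _ hp.2 _ hp.1)
    have hG : ∀ x, ∫ y, k y x ∂μ = ∫ y in F, k y x ∂μ := fun x =>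
      (setIntegral_eq_integral_of_forall_compl_eq_zero fun y hy => by
        simp only [hk]; rw [image_eq_zero_of_notMem_tsupport hy, mul_zero]).symm
    have hTint : Integrable (app T' f) (μ.restrict (P n)) :=
      memLp_one_iff_integrable.1 ((memLp_app T').restrict (P n) |>.mono_exponent (by norm_num))
    have hGint : Integrable (fun x => ∫ y, k y x ∂μ) (μ.restrict (P n)) := by
      simp_rw [hG]
      exact hint.integral_prod_right
    refine Integrable.ae_eq_of_forall_setIntegral_eq _ _ hTint hGint fun s hs _ => ?_
    rw [Measure.restrict_restrict hs]
    set E := s ∩ P n with hE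
    have hEm : MeasurableSet E := hs.inter (hPc n).measurableSet
    have hEP : E ⊆ P n := inter_subset_right
    set g : X → 𝕜 := E.indicator fun _ => 1 with hg
    have hgb : BddSupp μ g := BddSupp.indicator_const 1 hEm (hPb.subset hEP)
    have hgs : tsupport g ⊆ P n :=
      closure_minimal (Set.support_indicator_subset.trans hEP) (hPc n)
    -- The identity is tested against the indicator `g` of `E`, whose support is disjoint from that
    -- of `f`, so that `T g` is given by the kernel wherever `f` is nonzero.
    have hTg : ∀ᵐ y ∂μ, f y * conj (app T g y) = F.indicator
        (fun y => ∫ x in E, k y x ∂μ) y := by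
      filter_upwards [(hT.hasStandardKernel hμ).representation g hgb] with y hy
      by_cases hyF : y ∈ F
      · have hyg : y ∉ tsupport g := fun h => hrect (a := (y, y)) ⟨hyF, hgs h⟩ rfl
        rw [hy hyg, indicator_of_mem hyF]
        simp only [hk]
        rw [integral_mul_const, integral_conj, mul_comm, ← integral_indicator hEm]
        congr 3
        ext x
        by_cases hx : x ∈ E <;> simp [hg, hx]
      · rw [indicator_of_notMem hyF, image_eq_zero_of_notMem_tsupport hyF, zero_mul]
    have hintE : Integrable (Function.uncurry k) ((μ.restrict F).prod (μ.restrict E)) := by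
      refine hint.mono_measure ?_
      rw [Measure.prod_restrict, Measure.prod_restrict]
      exact Measure.restrict_mono (prod_mono Subset.rfl hEP) le_rfl
    calc ∫ x in E, app T' f x ∂μ = ∫ x, app T' f x * conj (g x) ∂μ := by
          rw [← integral_indicator hEm]
          congr 1
          ext x
          by_cases hx : x ∈ E <;> simp [hg, hx]
      _ = ∫ y, f y * conj (app T g y) ∂μ :=
          integral_conj_mul_app_adjoint T (hf.memLp hμ 2) (hgb.memLp hμ 2)
      _ = ∫ y in F, ∫ x in E, k y x ∂μ ∂μ := by
          rw [integral_congr_ae hTg, integral_indicator hFc.measurableSet]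
      _ = ∫ x in E, ∫ y in F, k y x ∂μ ∂μ := integral_integral_swap hintE
      _ = _ := integral_congr_ae (Eventually.of_forall fun x => (hG x).symm)
  have hall : ∀ᵐ x ∂μ, ∀ n, x ∈ P n → app T' f x = ∫ y, conj (K y x) * f y ∂μ :=
    ae_all_iff.2 fun n => (ae_restrict_iff' (hPc n).measurableSet).1 (main n)
  filter_upwards [hall] with x hx hxF
  obtain ⟨n, hn⟩ := hcover x hxF
  exact hx n hn

theorem IsCZOperator.adjoint_hasStandardKernel [SecondCountableTopology X] [SigmaFinite μ]
    (hμ : IsUpperDoubling μ lam) (hT : IsCZOperator lam K T) :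
    HasStandardKernel lam (fun x y => conj (K y x)) (ContinuousLinearMap.adjoint T) where
  size := by
    obtain ⟨C, hC⟩ := hT.1.size
    refine exists_enorm_le_of_size hμ ⟨C, fun x y hxy => ?_⟩
    rw [RCLike.norm_conj, min_comm, dist_comm]
    exact hC y x hxy.symm
  regularity := by
    obtain ⟨δ, C, c, h1, h2, h3, h⟩ := hT.1.regularity
    refine exists_enorm_sub_le_of_regularity hμ ⟨δ, C, c, h1, h2, h3, fun x x' y hx hx' hd => ?_⟩
    rw [← map_sub, ← map_sub, RCLike.norm_conj, RCLike.norm_conj, add_comm]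
    exact h x x' y hx hx' hd
  representation := fun _ hf => hT.adjoint_representation hμ hf

end Adjoint

/-! ### Duality and the `L^p` bounds -/

section Duality

open ComplexConjugate

variable {X : Type*} [MetricSpace X] [MeasurableSpace X] [BorelSpace X] {𝕜 : Type*} [RCLike 𝕜]
  {μ : Measure X} {lam : X → ℝ → ℝ} {K : X → X → 𝕜} {T : Lp 𝕜 2 μ →L[𝕜] Lp 𝕜 2 μ}

/-- Boundedness on `L^p` by duality. -/
theorem lintegral_app_rpow_le_of_adjoint (hμ : IsUpperDoubling μ lam) (x₀ : X)
    (T : Lp 𝕜 2 μ →L[𝕜] Lp 𝕜 2 μ) {p q : ℝ} (hpq : p.HolderConjugate q) {C : ℝ≥0}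
    (hC : ∀ f : X → 𝕜, StronglyMeasurable f → BddSupp μ f →
      ∫⁻ z, ‖app (ContinuousLinearMap.adjoint T) f z‖ₑ ^ q ∂μ ≤ C * ∫⁻ z, ‖f z‖ₑ ^ q ∂μ)
    {f : X → 𝕜} (hf : BddSupp μ f) :
    ∫⁻ z, ‖app T f z‖ₑ ^ p ∂μ ≤ (C : ℝ≥0∞) ^ (p / q) * ∫⁻ z, ‖f z‖ₑ ^ p ∂μ := by
  have hp0 : 0 < p := hpq.pos
  have hq0 : 0 < q := hpq.symm.pos
  have hp1 : 1 < p := hpq.lt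
  set h : X → 𝕜 := app T f with hh
  have hhm : StronglyMeasurable h := by
    rw [hh, app_eq T (hf.memLp hμ 2)]; exact Lp.stronglyMeasurable _
  have hn : ∀ n : ℕ, ∫⁻ z, ‖trunc x₀ h n z‖ₑ ^ p ∂μ ≤
      (C : ℝ≥0∞) ^ (p / q) * ∫⁻ z, ‖f z‖ₑ ^ p ∂μ := by
    intro n
    -- Working with a truncation of `T f` makes the integral of `|u| ^ p` finite, so that a power of
    -- it can be cancelled after Hölder's inequality.
    set u := trunc x₀ h n with hu
    have hum : StronglyMeasurable u := stronglyMeasurable_trunc x₀ hhm n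
    have hub : BddSupp μ u := bddSupp_trunc x₀ hhm n
    have hun : ∀ z, ‖u z‖ ≤ n := by
      intro z
      rw [hu, trunc]
      by_cases hz : z ∈ closedBall x₀ n ∩ {z | ‖h z‖ ≤ n}
      · rw [indicator_of_mem hz]; exact hz.2
      · rw [indicator_of_notMem hz]; simp
    have huh : ∀ z, u z = 0 ∨ u z = h z := by
      intro z
      rw [hu, trunc]
      by_cases hz : z ∈ closedBall x₀ n ∩ {z | ‖h z‖ ≤ n}
      · right; rw [indicator_of_mem hz]
      · left; rw [indicator_of_notMem hz]
    -- The extremal function for Hölder's inequality: `|g| ^ q = |u| ^ p`, and `T f` times the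
    -- conjugate of `g` is `|u| ^ p`, because `u` is everywhere `0` or `T f`.
    set g : X → 𝕜 := fun z => ((‖u z‖ ^ (p - 2) : ℝ) : 𝕜) * u z with hg
    have hgm : StronglyMeasurable g :=
      (RCLike.measurable_ofReal.comp (hum.norm.measurable.pow_const _)).stronglyMeasurable.mul hum
    have hgn : ∀ z, ‖g z‖ = ‖u z‖ ^ (p - 1) := by
      intro z
      rw [hg]
      simp only [norm_mul, RCLike.norm_ofReal, abs_of_nonneg (Real.rpow_nonneg (norm_nonneg (u z)) _)]
      rw [← Real.rpow_add_one' (norm_nonneg _) (by linarith)]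
      ring_nf
    have hgb : BddSupp μ g := by
      refine ⟨memLp_top_of_bound hgm.aestronglyMeasurable ((n : ℝ) ^ (p - 1))
        (Eventually.of_forall fun z => ?_), hub.2.subset fun z hz hz0 => hz ?_⟩
      · rw [hgn]
        exact Real.rpow_le_rpow (norm_nonneg _) (hun z) (by linarith)
      · simp [hg, hz0]
    have hgq : ∀ z, ‖g z‖ₑ ^ q = ‖u z‖ₑ ^ p := by
      intro z
      rw [enorm_rpow_eq_ofReal _ hq0.le, enorm_rpow_eq_ofReal _ hp0.le, hgn,
        ← Real.rpow_mul (norm_nonneg _), hpq.sub_one_mul_conj]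
    have hpair : ∀ z, h z * conj (g z) = ((‖u z‖ ^ p : ℝ) : 𝕜) := by
      intro z
      rcases huh z with h0 | h0
      · simp [hg, h0, Real.zero_rpow hp0.ne']
      · rw [hg, ← h0]
        simp only [map_mul, RCLike.conj_ofReal]
        rw [mul_left_comm, RCLike.mul_conj]
        rw [← RCLike.ofReal_pow, ← RCLike.ofReal_mul]
        congr 1
        rcases (norm_nonneg (u z)).eq_or_lt with h1 | h1
        · rw [← h1, Real.zero_rpow hp0.ne']; simp
        · rw [← Real.rpow_add_natCast h1.ne']; norm_num
    have huint : Integrable (fun z => ‖u z‖ ^ p) μ := by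
      have := (hub.memLp hμ (ENNReal.ofReal p)).integrable_norm_rpow
        (ENNReal.ofReal_pos.2 hp0).ne' ENNReal.ofReal_ne_top
      rwa [ENNReal.toReal_ofReal hp0.le] at this
    set A := ∫⁻ z, ‖u z‖ₑ ^ p ∂μ with hA
    have hAeq : A = ENNReal.ofReal (∫ z, ‖u z‖ ^ p ∂μ) := by
      rw [ofReal_integral_eq_lintegral_ofReal huint (Eventually.of_forall fun z => by positivity)]
      exact lintegral_congr fun z => enorm_rpow_eq_ofReal _ hp0.le
    have hAtop : A ≠ ∞ := by rw [hAeq]; exact ENNReal.ofReal_ne_top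
    have hI0 : 0 ≤ ∫ z, ‖u z‖ ^ p ∂μ := integral_nonneg fun z => by positivity
    have hAle : A ≤ ∫⁻ z, ‖f z‖ₑ * ‖app (ContinuousLinearMap.adjoint T) g z‖ₑ ∂μ := by
      calc A = ‖∫ z, h z * conj (g z) ∂μ‖ₑ := by
            simp_rw [hpair]
            rw [integral_ofReal, ← ofReal_norm, RCLike.norm_ofReal, abs_of_nonneg hI0, hAeq]
        _ = ‖∫ z, f z * conj (app (ContinuousLinearMap.adjoint T) g z) ∂μ‖ₑ := by
            rw [← integral_conj_mul_app_adjoint _ (hf.memLp hμ 2) (hgb.memLp hμ 2),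
              ContinuousLinearMap.adjoint_adjoint]
        _ ≤ _ := enorm_integral_le_lintegral_enorm _
        _ = _ := by simp only [enorm_mul, RCLike.enorm_conj]
    set Φ := ∫⁻ z, ‖f z‖ₑ ^ p ∂μ with hΦ
    have hHolder : A ≤ Φ ^ (1 / p) * (C * A) ^ (1 / q) := by
      refine hAle.trans ((ENNReal.lintegral_mul_le_Lp_mul_Lq μ hpq hf.aestronglyMeasurable.enorm
        (memLp_app _).1.enorm).trans ?_)
      gcongr
      refine (hC g hgm hgb).trans (le_of_eq ?_)
      congr 1
      exact lintegral_congr hgq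
    by_cases hA0 : A = 0
    · rw [hA0]; exact bot_le
    have h1q : A ^ (1 / q) ≠ 0 := (ENNReal.rpow_pos (pos_iff_ne_zero.2 hA0) hAtop).ne'
    have h1qt : A ^ (1 / q) ≠ ∞ := ENNReal.rpow_ne_top_of_nonneg (by positivity) hAtop
    have hroot : A ^ (1 / p) ≤ Φ ^ (1 / p) * C ^ (1 / q) := by
      refine (ENNReal.mul_le_mul_iff_left h1q h1qt).1 ?_
      rw [← ENNReal.rpow_add _ _ hA0 hAtop]
      have : 1 / p + 1 / q = 1 := by simpa [one_div] using hpq.inv_add_inv_eq_one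
      rw [this, ENNReal.rpow_one]
      refine hHolder.trans (le_of_eq ?_)
      rw [ENNReal.mul_rpow_of_nonneg _ _ (by positivity)]
      ring
    calc A = (A ^ (1 / p)) ^ p := by
          rw [← ENNReal.rpow_mul, one_div_mul_cancel hp0.ne', ENNReal.rpow_one]
      _ ≤ (Φ ^ (1 / p) * C ^ (1 / q)) ^ p := by gcongr
      _ = _ := by
          rw [ENNReal.mul_rpow_of_nonneg _ _ hp0.le, ← ENNReal.rpow_mul, ← ENNReal.rpow_mul,
            one_div_mul_cancel hp0.ne', ENNReal.rpow_one, mul_comm]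
          congr 2
          ring
  -- Fatou's lemma removes the truncation.
  calc ∫⁻ z, ‖h z‖ₑ ^ p ∂μ = ∫⁻ z, liminf (fun n => ‖trunc x₀ h n z‖ₑ ^ p) atTop ∂μ := by
        refine lintegral_congr fun z => ?_
        refine (Tendsto.liminf_eq ?_).symm
        refine tendsto_const_nhds.congr' ?_
        filter_upwards [eventually_trunc_eq x₀ h z] with n hn
        rw [hn]
    _ ≤ liminf (fun n => ∫⁻ z, ‖trunc x₀ h n z‖ₑ ^ p ∂μ) atTop :=
        lintegral_liminf_le fun n => (stronglyMeasurable_trunc x₀ hhm n).enorm.pow_const _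
    _ ≤ _ := by
        refine liminf_le_of_le (by isBoundedDefault) fun b hb => ?_
        obtain ⟨n, hbn⟩ := hb.exists
        exact hbn.trans (hn n)

omit [MetricSpace X] [BorelSpace X] in
theorem eLpNorm_le_of_lintegral_rpow_le {f g : X → 𝕜} {p : ℝ≥0∞} (hp0 : p ≠ 0) (hp : p ≠ ∞)
    {C : ℝ≥0} (h : ∫⁻ z, ‖f z‖ₑ ^ p.toReal ∂μ ≤ C * ∫⁻ z, ‖g z‖ₑ ^ p.toReal ∂μ) :
    eLpNorm f p μ ≤ (C ^ (1 / p.toReal) : ℝ≥0) * eLpNorm g p μ := by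
  rw [eLpNorm_eq_lintegral_rpow_enorm_toReal hp0 hp, eLpNorm_eq_lintegral_rpow_enorm_toReal hp0 hp,
    ENNReal.coe_rpow_of_nonneg _ (by positivity), ← ENNReal.mul_rpow_of_nonneg _ _ (by positivity)]
  gcongr

/-- Calderón–Zygmund operators are bounded on `L^p` for `1 < p < ∞`. -/
theorem IsCZOperator.exists_Lp_extension [Nonempty X] (hX : GeometricallyDoubling X)
    (hμ : IsUpperDoubling μ lam) (hT : IsCZOperator lam K T) (p : ℝ≥0∞) [Fact (1 ≤ p)]
    (hp1 : 1 < p) (hp : p < ∞) :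
    ∃ S : Lp 𝕜 p μ →L[𝕜] Lp 𝕜 p μ,
      ∀ (f : Lp 𝕜 p μ) (g : Lp 𝕜 2 μ), f =ᵐ[μ] g → S f =ᵐ[μ] T g := by
  have := hX.secondCountableTopology
  have := hμ.isLocallyFiniteMeasure
  obtain ⟨x₀⟩ := ‹Nonempty X›
  have hp0 : p ≠ 0 := (zero_lt_one.trans hp1).ne'
  have hr1 : 1 < p.toReal := by
    rw [← ENNReal.toReal_one]
    exact (ENNReal.toReal_lt_toReal ENNReal.one_ne_top hp.ne).2 hp1
  rcases lt_trichotomy p.toReal 2 with h2 | h2 | h2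
  · obtain ⟨C, hC⟩ := (hT.hasStandardKernel hμ).weak_type hX hμ
    obtain ⟨C', hC'⟩ := exists_lintegral_app_rpow_le T hμ hC hr1 h2
    exact exists_extension T hμ x₀ hp.ne fun f hfm hf =>
      eLpNorm_le_of_lintegral_rpow_le hp0 hp.ne (hC' f hfm hf)
  · have hp2 : p = 2 := by
      rw [← ENNReal.ofReal_toReal hp.ne, h2]; norm_num
    subst hp2
    exact ⟨T, fun f g hfg => by rw [Lp.ext hfg]⟩
  · have hpq := Real.HolderConjugate.conjExponent hr1
    have hq1 : 1 < p.toReal.conjExponent := hpq.symm.lt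
    have hq2 : p.toReal.conjExponent < 2 := by
      rw [Real.conjExponent, div_lt_iff₀ (by linarith)]
      linarith
    obtain ⟨C, hC⟩ := (hT.adjoint_hasStandardKernel hμ).weak_type hX hμ
    obtain ⟨C', hC'⟩ := exists_lintegral_app_rpow_le _ hμ hC hq1 hq2
    refine exists_extension T hμ x₀ hp.ne fun f hfm hf =>
      eLpNorm_le_of_lintegral_rpow_le (C := C' ^ (p.toReal / p.toReal.conjExponent)) hp0 hp.ne ?_
    have h := lintegral_app_rpow_le_of_adjoint hμ x₀ T hpq hC' hf
    rwa [ENNReal.coe_rpow_of_nonneg _ (by positivity [hpq.pos, hpq.symm.pos])]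

end Duality

theorem Lp_coeFn_sum {X E ι : Type*} [MeasurableSpace X] {μ : Measure X} [NormedAddCommGroup E]
    {p : ℝ≥0∞} (s : Finset ι) (F : ι → Lp E p μ) :
    (∑ i ∈ s, F i : Lp E p μ) =ᵐ[μ] ∑ i ∈ s, (F i : X → E) := by
  classical
  induction s using Finset.induction_on with
  | empty => simpa using Lp.coeFn_zero E p μ
  | insert a s ha ih =>
    rw [Finset.sum_insert ha, Finset.sum_insert ha]
    exact (Lp.coeFn_add _ _).trans ((EventuallyEq.refl _ _).add ih)

/-! ### The closed graph of the extension to `L¹` -/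

section Graph

variable {X : Type*} [MetricSpace X] [MeasurableSpace X] {𝕜 : Type*} [RCLike 𝕜]
  {μ : Measure X} {lam : X → ℝ → ℝ} {T : Lp 𝕜 2 μ →L[𝕜] Lp 𝕜 2 μ} {f f' h h' : X → 𝕜}

/-- `h` is the image of `f` under the extension of `T` by continuity from `L¹(μ)` to
convergence in measure. -/
def IsWeakImage (T : Lp 𝕜 2 μ →L[𝕜] Lp 𝕜 2 μ) (f h : X → 𝕜) : Prop :=
  ∀ ε : ℝ≥0, 0 < ε → ∃ g : X → 𝕜, BddSupp μ g ∧ ∫⁻ z, ‖(f - g) z‖ₑ ∂μ ≤ ε ∧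
    μ {z | ε < ‖(h - app T g) z‖ₑ} ≤ ε

omit [MetricSpace X] in
theorem measure_lt_enorm_add_le (u v : X → 𝕜) (a b : ℝ≥0∞) :
    μ {z | a + b < ‖(u + v) z‖ₑ} ≤ μ {z | a < ‖u z‖ₑ} + μ {z | b < ‖v z‖ₑ} := by
  refine (measure_mono fun z hz => ?_).trans (measure_union_le _ _)
  by_contra hcon
  have hcon' : z ∉ ({z | a < ‖u z‖ₑ} ∪ {z | b < ‖v z‖ₑ} : Set X) := hcon
  simp only [mem_union, mem_ofPred_eq, not_or, not_lt] at hcon'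
  exact absurd (show a + b < ‖u z + v z‖ₑ from hz)
    (not_lt.2 ((enorm_add_le _ _).trans (add_le_add hcon'.1 hcon'.2)))

omit [MetricSpace X] in
theorem measure_lt_enorm_congr {u v : X → 𝕜} (huv : u =ᵐ[μ] v) (a : ℝ≥0∞) :
    μ {z | a < ‖u z‖ₑ} = μ {z | a < ‖v z‖ₑ} := by
  refine measure_congr ?_
  filter_upwards [huv] with z hz
  exact propext (show a < ‖u z‖ₑ ↔ a < ‖v z‖ₑ by rw [hz])

namespace IsWeakImage

theorem of_bddSupp (hf : BddSupp μ f) : IsWeakImage T f (app T f) := fun ε _ =>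
  ⟨f, hf, by simp, by simp⟩

theorem congr (H : IsWeakImage T f h) (hf : f =ᵐ[μ] f') (hh : h =ᵐ[μ] h') :
    IsWeakImage T f' h' := by
  intro ε hε
  obtain ⟨g, hg, h1, h2⟩ := H ε hε
  refine ⟨g, hg, ?_, ?_⟩
  · refine (le_of_eq (lintegral_congr_ae ?_)).trans h1
    filter_upwards [hf] with z hz
    simp [hz]
  · rwa [measure_lt_enorm_congr (hh.symm.sub (EventuallyEq.refl _ _))]

/-- The graph is closed under approximation. -/
theorem of_forall (hfm : AEStronglyMeasurable f μ) (hhm : AEStronglyMeasurable h μ)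
    (H : ∀ ε : ℝ≥0, 0 < ε → ∃ f' h' : X → 𝕜, IsWeakImage T f' h' ∧
      AEStronglyMeasurable f' μ ∧ AEStronglyMeasurable h' μ ∧
      ∫⁻ z, ‖(f - f') z‖ₑ ∂μ ≤ ε ∧ ∫⁻ z, ‖(h - h') z‖ₑ ∂μ ≤ ε) : IsWeakImage T f h := by
  intro ε hε
  have hε2 : (0 : ℝ≥0) < ε / 2 := by positivity
  have hsum : ((ε / 2 : ℝ≥0) : ℝ≥0∞) + (ε / 2 : ℝ≥0) = ε := by
    rw [← ENNReal.coe_add, add_halves]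
  -- The product `ε / 2 * (ε / 2)` is what Chebyshev's inequality needs to give measure `ε / 2` at
  -- height `ε / 2`.
  obtain ⟨f', h', H', hfm', hhm', hf', hh'⟩ := H (min (ε / 2) (ε / 2 * (ε / 2))) (by positivity)
  obtain ⟨g, hg, h1, h2⟩ := H' (ε / 2) hε2
  refine ⟨g, hg, ?_, ?_⟩
  · calc ∫⁻ z, ‖(f - g) z‖ₑ ∂μ ≤ ∫⁻ z, (‖(f - f') z‖ₑ + ‖(f' - g) z‖ₑ) ∂μ := by
          refine lintegral_mono fun z => ?_
          have : (f - g) z = (f - f') z + (f' - g) z := by simp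
          rw [this]
          exact enorm_add_le _ _
      _ = ∫⁻ z, ‖(f - f') z‖ₑ ∂μ + ∫⁻ z, ‖(f' - g) z‖ₑ ∂μ :=
          lintegral_add_left' (hfm.sub hfm').enorm _
      _ ≤ (ε / 2 : ℝ≥0) + (ε / 2 : ℝ≥0) :=
          add_le_add (hf'.trans (by exact_mod_cast min_le_left _ _)) h1
      _ = ε := hsum
  · rw [← hsum, show h - app T g = (h - h') + (h' - app T g) by abel]
    refine (measure_lt_enorm_add_le _ _ _ _).trans (add_le_add ?_ h2)
    have hne : ((ε / 2 : ℝ≥0) : ℝ≥0∞) ≠ 0 := by exact_mod_cast hε2.ne'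
    refine (ENNReal.mul_le_mul_iff_right hne ENNReal.coe_ne_top).1 ?_
    calc ((ε / 2 : ℝ≥0) : ℝ≥0∞) * μ {z | ((ε / 2 : ℝ≥0) : ℝ≥0∞) < ‖(h - h') z‖ₑ}
        ≤ (ε / 2 : ℝ≥0) * μ {z | ((ε / 2 : ℝ≥0) : ℝ≥0∞) ≤ ‖(h - h') z‖ₑ} := by
          refine mul_le_mul_right (measure_mono fun z hz => ?_) _
          exact (show ((ε / 2 : ℝ≥0) : ℝ≥0∞) < ‖(h - h') z‖ₑ from hz).le
      _ ≤ ∫⁻ z, ‖(h - h') z‖ₑ ∂μ := mul_meas_ge_le_lintegral₀ (hhm.sub hhm').enorm _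
      _ ≤ _ := hh'.trans (by exact_mod_cast min_le_right _ _)

theorem add (hμ : IsUpperDoubling μ lam) (hfm : AEStronglyMeasurable f μ) (H : IsWeakImage T f h)
    (H' : IsWeakImage T f' h') : IsWeakImage T (f + f') (h + h') := by
  intro ε hε
  have hε2 : (0 : ℝ≥0) < ε / 2 := by positivity
  have hsum : ((ε / 2 : ℝ≥0) : ℝ≥0∞) + (ε / 2 : ℝ≥0) = ε := by
    rw [← ENNReal.coe_add, add_halves]
  obtain ⟨g, hg, h1, h2⟩ := H (ε / 2) hε2
  obtain ⟨g', hg', h1', h2'⟩ := H' (ε / 2) hε2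
  refine ⟨g + g', hg.add hg', ?_, ?_⟩
  · calc _ ≤ ∫⁻ z, (‖(f - g) z‖ₑ + ‖(f' - g') z‖ₑ) ∂μ := by
          refine lintegral_mono fun z => ?_
          have : (f + f' - (g + g')) z = (f - g) z + (f' - g') z := by
            simp only [Pi.sub_apply, Pi.add_apply]; ring
          rw [this]
          exact enorm_add_le _ _
      _ = ∫⁻ z, ‖(f - g) z‖ₑ ∂μ + ∫⁻ z, ‖(f' - g') z‖ₑ ∂μ :=
          lintegral_add_left' (hfm.sub hg.aestronglyMeasurable).enorm _
      _ ≤ (ε / 2 : ℝ≥0) + (ε / 2 : ℝ≥0) := add_le_add h1 h1'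
      _ = ε := hsum
  · have hae : h + h' - app T (g + g') =ᵐ[μ] (h - app T g) + (h' - app T g') := by
      filter_upwards [app_add T (hg.memLp hμ 2) (hg'.memLp hμ 2)] with z hz
      simp only [Pi.sub_apply, Pi.add_apply] at hz ⊢
      rw [hz]; ring
    rw [measure_lt_enorm_congr hae, ← hsum]
    exact (measure_lt_enorm_add_le _ _ _ _).trans (add_le_add h2 h2')

theorem const_smul (hμ : IsUpperDoubling μ lam) (H : IsWeakImage T f h) (c : 𝕜) :
    IsWeakImage T (c • f) (c • h) := by
  intro ε hε
  -- Adding `1` makes `k ≥ 1`, so the measure bound `ε / k` is at most `ε`; it also covers `c = 0`.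
  set k : ℝ≥0 := ‖c‖₊ + 1 with hk
  have hk1 : 1 ≤ k := by simp [hk]
  have hk0 : 0 < k := zero_lt_one.trans_le hk1
  have hck : ‖c‖ₑ ≤ k := by rw [enorm_eq_nnnorm]; exact_mod_cast le_self_add
  have hεk : (k : ℝ≥0∞) * (ε / k : ℝ≥0) = ε := by
    rw [← ENNReal.coe_mul, mul_div_cancel₀ _ hk0.ne']
  obtain ⟨g, hg, h1, h2⟩ := H (ε / k) (by positivity)
  refine ⟨c • g, hg.const_smul c, ?_, ?_⟩
  · calc ∫⁻ z, ‖(c • f - c • g) z‖ₑ ∂μ = ∫⁻ z, ‖c‖ₑ * ‖(f - g) z‖ₑ ∂μ := by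
          refine lintegral_congr fun z => ?_
          rw [← smul_sub, Pi.smul_apply, enorm_smul]
      _ = ‖c‖ₑ * ∫⁻ z, ‖(f - g) z‖ₑ ∂μ := lintegral_const_mul' _ _ enorm_ne_top
      _ ≤ k * (ε / k : ℝ≥0) := by gcongr
      _ = ε := hεk
  · have hae : c • h - app T (c • g) =ᵐ[μ] c • (h - app T g) := by
      filter_upwards [app_const_smul T (hg.memLp hμ 2) c] with z hz
      simp only [Pi.sub_apply, Pi.smul_apply] at hz ⊢
      rw [hz, smul_sub]
    rw [measure_lt_enorm_congr hae]
    refine (measure_mono fun z hz => ?_).trans (h2.trans ?_)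
    · have hz' : (ε : ℝ≥0∞) < ‖(c • (h - app T g)) z‖ₑ := hz
      show ((ε / k : ℝ≥0) : ℝ≥0∞) < ‖(h - app T g) z‖ₑ
      rw [Pi.smul_apply, enorm_smul, ← hεk] at hz'
      by_contra! hcon
      exact absurd hz' (not_lt.2 (by gcongr))
    · exact_mod_cast div_le_self bot_le hk1

/-- The approximants `g` of `0` are small in `L¹`, so by weak type their images are small in
measure. This is the closability that makes the extension single valued. -/
theorem eq_zero {C : ℝ≥0}
    (hC : ∀ (f : X → 𝕜) (t : ℝ≥0), BddSupp μ f → 0 < t →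
      t * μ {z | t < ‖app T f z‖ₑ} ≤ C * ∫⁻ y, ‖f y‖ₑ ∂μ)
    (H : IsWeakImage T (0 : X → 𝕜) h) : h =ᵐ[μ] 0 := by
  have key : ∀ s : ℝ≥0, 0 < s → μ {z | (s : ℝ≥0∞) + s < ‖h z‖ₑ} = 0 := by
    intro s hs
    have hs0 : (s : ℝ≥0∞) ≠ 0 := by exact_mod_cast hs.ne'
    have hle : ∀ ε : ℝ≥0, 0 < ε → s * μ {z | (s : ℝ≥0∞) + s < ‖h z‖ₑ} ≤ ((s + C) * ε : ℝ≥0) := by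
      intro ε hε
      -- `ε` controls the masses, while `s` keeps the threshold in measure below the fixed height.
      obtain ⟨g, hg, h1, h2⟩ := H (min ε s) (by positivity)
      have hI : ∫⁻ z, ‖g z‖ₑ ∂μ ≤ ε := by
        simp only [zero_sub, Pi.neg_apply, enorm_neg] at h1
        exact h1.trans (by exact_mod_cast min_le_left _ _)
      calc s * μ {z | (s : ℝ≥0∞) + s < ‖h z‖ₑ}
          = s * μ {z | (s : ℝ≥0∞) + s < ‖((h - app T g) + app T g) z‖ₑ} := by simp
        _ ≤ s * (μ {z | s < ‖(h - app T g) z‖ₑ} + μ {z | s < ‖app T g z‖ₑ}) := by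
            gcongr; exact measure_lt_enorm_add_le _ _ _ _
        _ = s * μ {z | s < ‖(h - app T g) z‖ₑ} + s * μ {z | s < ‖app T g z‖ₑ} := mul_add _ _ _
        _ ≤ s * ε + C * ε := by
            refine add_le_add (mul_le_mul_right ?_ _) ((hC g s hg hs).trans (by gcongr))
            · refine (measure_mono fun z hz => ?_).trans
                (h2.trans (by exact_mod_cast min_le_left _ _))
              exact lt_of_le_of_lt (by exact_mod_cast min_le_right _ _)
                (show (s : ℝ≥0∞) < ‖(h - app T g) z‖ₑ from hz)
        _ = _ := by push_cast; ring
    have h0 : s * μ {z | (s : ℝ≥0∞) + s < ‖h z‖ₑ} = 0 := by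
      refine le_antisymm (ENNReal.le_of_forall_pos_le_add fun ε hε _ => ?_) bot_le
      rw [zero_add]
      refine (hle (ε / (s + C)) (by positivity)).trans (le_of_eq ?_)
      rw [mul_div_cancel₀ _ (by positivity)]
    exact (mul_eq_zero.1 h0).resolve_left hs0
  have hall : ∀ᵐ z ∂μ, ∀ n : ℕ, ¬ (((1 / ((n : ℝ≥0) + 1) : ℝ≥0) : ℝ≥0∞) +
      (1 / ((n : ℝ≥0) + 1) : ℝ≥0) < ‖h z‖ₑ) :=
    ae_all_iff.2 fun n => measure_eq_zero_iff_ae_notMem.1 (key _ (by positivity))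
  filter_upwards [hall] with z hz
  by_contra hne
  have hpos : 0 < ‖h z‖ := norm_pos_iff.2 hne
  obtain ⟨n, hn⟩ := exists_nat_one_div_lt (half_pos hpos)
  refine hz n ?_
  rw [← ENNReal.coe_add, enorm_eq_nnnorm, ENNReal.coe_lt_coe, ← NNReal.coe_lt_coe]
  push_cast
  linarith

end IsWeakImage

/-- The graph of the extension of `T`, as a subspace of `L¹ × L¹`. -/
noncomputable def weakGraph (T : Lp 𝕜 2 μ →L[𝕜] Lp 𝕜 2 μ) (hμ : IsUpperDoubling μ lam) :
    Submodule 𝕜 (Lp 𝕜 1 μ × Lp 𝕜 1 μ) where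
  carrier := {v | IsWeakImage T v.1 v.2}
  zero_mem' := (IsWeakImage.of_bddSupp BddSupp.zero).congr (Lp.coeFn_zero 𝕜 1 μ).symm
    ((app_zero T).trans (Lp.coeFn_zero 𝕜 1 μ).symm)
  add_mem' := fun hv hw => (hv.add hμ (Lp.aestronglyMeasurable _) hw).congr
    (Lp.coeFn_add _ _).symm (Lp.coeFn_add _ _).symm
  smul_mem' := fun c _ hv => (IsWeakImage.const_smul hμ hv c).congr
    (Lp.coeFn_smul _ _).symm (Lp.coeFn_smul _ _).symm

/-- Convergence in `L¹` of the second coordinate implies convergence in measure, so this is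
`IsWeakImage.of_forall` read in `L¹ × L¹`. -/
theorem isClosed_weakGraph (hμ : IsUpperDoubling μ lam) :
    IsClosed (weakGraph T hμ : Set (Lp 𝕜 1 μ × Lp 𝕜 1 μ)) := by
  refine isClosed_of_closure_subset fun v hv => ?_
  refine IsWeakImage.of_forall (Lp.aestronglyMeasurable _) (Lp.aestronglyMeasurable _)
    fun ε hε => ?_
  obtain ⟨w, hw, hvw⟩ := EMetric.mem_closure_iff.1 hv ε (by exact_mod_cast hε)
  rw [Prod.edist_eq, max_lt_iff, Lp.edist_def, Lp.edist_def, eLpNorm_one_eq_lintegral_enorm,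
    eLpNorm_one_eq_lintegral_enorm] at hvw
  exact ⟨w.1, w.2, hw, Lp.aestronglyMeasurable _, Lp.aestronglyMeasurable _, hvw.1.le, hvw.2.le⟩

/-- The extension agrees with `T` on `L¹ ∩ L²`. -/
theorem IsWeakImage.of_memLp [BorelSpace X] (hμ : IsUpperDoubling μ lam) (x₀ : X)
    (hf : StronglyMeasurable f) (hf1 : MemLp f 1 μ) (hf2 : MemLp f 2 μ) :
    IsWeakImage T f (app T f) := by
  intro ε hε
  have hε' : (0 : ℝ≥0∞) < ε := by exact_mod_cast hε
  have h1 := tendsto_eLpNorm_trunc_sub x₀ hf one_ne_zero ENNReal.one_ne_top hf1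
  have h2 := tendstoInMeasure_iff_enorm.1 (exists_seq_app_trunc_tendsto T hμ x₀ hf hf2) ε hε'
    ENNReal.coe_ne_top
  obtain ⟨n, hn1, hn2⟩ := ((h1.eventually (gt_mem_nhds hε')).and
    (h2.eventually (gt_mem_nhds hε'))).exists
  refine ⟨trunc x₀ f n, bddSupp_trunc x₀ hf n, ?_, ?_⟩
  · rw [eLpNorm_one_eq_lintegral_enorm] at hn1
    refine (lintegral_mono fun z => ?_).trans hn1.le
    rw [Pi.sub_apply, Pi.sub_apply, enorm_sub_rev]
  · refine (measure_mono fun z hz => ?_).trans hn2.le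
    have hz' : (ε : ℝ≥0∞) < ‖(app T f - app T (trunc x₀ f n)) z‖ₑ := hz
    rw [Pi.sub_apply, enorm_sub_rev] at hz'
    exact hz'.le

end Graph

/-! ### Images of atoms and atomic blocks -/

section Atoms

variable {X : Type*} [MetricSpace X] [MeasurableSpace X] {𝕜 : Type*} [RCLike 𝕜]
  {μ : Measure X} {lam : X → ℝ → ℝ} {K : X → X → 𝕜} {T : Lp 𝕜 2 μ →L[𝕜] Lp 𝕜 2 μ}

theorem one_le_coeffK (x : X) (r R : ℝ) : 1 ≤ coeffK μ lam x r R := le_self_add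

/-- An inequality rather than an equality, to include `V = 0`, where the left side is `∞ * 0 = 0`.
-/
theorem inv_mul_coeffK_mul_le {V κ : ℝ≥0∞} (hV : V ≠ ∞) (hκ : 1 ≤ κ) :
    (V * κ)⁻¹ * V ≤ κ⁻¹ := by
  rcases eq_or_ne V 0 with rfl | hV0
  · simp
  · have hκ0 : κ ≠ 0 := (zero_lt_one.trans_le hκ).ne'
    rw [ENNReal.mul_inv (Or.inl hV0) (Or.inl hV), mul_comm, ← mul_assoc,
      ENNReal.mul_inv_cancel hV0 hV, one_mul]

omit [MetricSpace X] in
/-- The `L^p` norms of a bounded function supported on a set. -/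
theorem eLpNorm_le_of_support_subset {a : X → 𝕜} {s : Set X} (ha : AEStronglyMeasurable a μ)
    (hs : Function.support a ⊆ s) (p : ℝ≥0∞) :
    eLpNorm a p μ ≤ eLpNorm a ∞ μ * μ s ^ (1 / p.toReal) := by
  rw [← eLpNorm_restrict_eq_of_support_subset hs]
  refine (eLpNorm_le_eLpNorm_mul_rpow_measure_univ le_top ha.restrict).trans ?_
  rw [Measure.restrict_apply_univ]
  simp only [ENNReal.toReal_top, div_zero, sub_zero]
  gcongr ?_ * _
  exact eLpNorm_mono_measure a Measure.restrict_le_self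

variable [BorelSpace X]

/-- The normalisation gives the atom `L¹` norm at most `1 / κ`, with `κ` its coefficient. Away from
the atom its image is at most a constant times `1 / (κ λ)`, and the integral of `1 / λ` up to
distance `r` is at most `κ`, so the coefficient cancels; distances between `r` and `(2 ^ m + 1) * r`
add only a bounded amount. On the dilated ball of the atom the `L²` bound suffices. -/
theorem HasStandardKernel.lintegral_app_atom_le (hT : HasStandardKernel lam K T)
    (hμ : IsUpperDoubling μ lam) (m : ℕ) {ρ : ℝ} (hρ : 1 < ρ) :
    ∃ C : ℝ≥0, ∀ (x y : X) (r s : ℝ) (a : X → 𝕜), 0 < r → 0 < s → ball y s ⊆ ball x r →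
      BddSupp μ a → Function.support a ⊆ ball y s →
      eLpNorm a ∞ μ ≤ (μ (ball y (ρ * s)) * coeffK μ lam y s r)⁻¹ →
      ∫⁻ z, ‖a z‖ₑ ∂μ ≤ 1 ∧ ∫⁻ z in closedBall x (2 ^ m * r), ‖app T a z‖ₑ ∂μ ≤ C := by
  obtain ⟨C₂, h₂⟩ := hT.enorm_app_le hμ hρ
  obtain ⟨D, hD⟩ := hμ.measure_closedBall_le (a := 2 ^ m + 1) (by positivity)
  refine ⟨‖T‖₊ + C₂ * (1 + D), fun x y r s a hr hs hsub ha hsupp hN => ?_⟩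
  set V := μ (ball y (ρ * s)) with hV
  set κ := coeffK μ lam y s r with hκ
  have hκ1 : 1 ≤ κ := one_le_coeffK y s r
  have hVt : V ≠ ∞ := (hμ.measure_lt_top_of_isBounded isBounded_ball).ne
  have hball : ball y s ⊆ ball y (ρ * s) := ball_subset_ball (by nlinarith)
  have hsuppV : Function.support a ⊆ ball y (ρ * s) := hsupp.trans hball
  have hNV : eLpNorm a ∞ μ * V ≤ κ⁻¹ := (by gcongr : _ ≤ (V * κ)⁻¹ * V).trans
    (inv_mul_coeffK_mul_le hVt hκ1)
  have hI : ∫⁻ z, ‖a z‖ₑ ∂μ ≤ κ⁻¹ := by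
    rw [← eLpNorm_one_eq_lintegral_enorm]
    have := eLpNorm_le_of_support_subset ha.aestronglyMeasurable hsuppV 1
    refine this.trans ?_
    simpa using hNV
  have hIt : ∫⁻ z, ‖a z‖ₑ ∂μ ≠ ∞ := (ha.integrable hμ).2.ne
  refine ⟨hI.trans (ENNReal.inv_le_one.2 hκ1), ?_⟩
  -- the part near the support of the atom
  have near : ∫⁻ z in ball y (ρ * s), ‖app T a z‖ₑ ∂μ ≤ ‖T‖ₑ := by
    refine (HasStandardKernel.setLIntegral_app_le T (ha.memLp hμ 2) _).trans ?_
    calc ‖T‖ₑ * eLpNorm a 2 μ * V ^ (1 / 2 : ℝ)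
        ≤ ‖T‖ₑ * (eLpNorm a ∞ μ * V ^ (1 / 2 : ℝ)) * V ^ (1 / 2 : ℝ) := by
          gcongr
          simpa using eLpNorm_le_of_support_subset ha.aestronglyMeasurable hsuppV 2
      _ = ‖T‖ₑ * (eLpNorm a ∞ μ * (V ^ (1 / 2 : ℝ) * V ^ (1 / 2 : ℝ))) := by ring
      _ = ‖T‖ₑ * (eLpNorm a ∞ μ * V) := by
          rw [← ENNReal.rpow_add_of_nonneg _ _ (by norm_num) (by norm_num)]
          norm_num
      _ ≤ ‖T‖ₑ * 1 := by
          gcongr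
          exact hNV.trans (ENNReal.inv_le_one.2 hκ1)
      _ = _ := mul_one _
  -- the part away from the support of the atom
  set S := {z | s ≤ dist z y ∧ dist z y ≤ r} with hS
  set S' := {z | r ≤ dist z y ∧ dist z y ≤ (2 ^ m + 1) * r} with hS'
  set Z := (ball y (ρ * s))ᶜ ∩ closedBall x (2 ^ m * r) with hZ
  have hZm : MeasurableSet Z := measurableSet_ball.compl.inter measurableSet_closedBall
  have hyx : dist y x < r := hsub (mem_ball_self hs)
  have hZsub : Z ⊆ S ∪ S' := by
    rintro z ⟨hz1, hz2⟩
    rw [mem_compl_iff, mem_ball, not_lt] at hz1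
    rw [mem_closedBall] at hz2
    have h3 : dist z y ≤ (2 ^ m + 1) * r := by
      linarith [dist_triangle_right z y x]
    rcases le_total (dist z y) r with h | h
    · exact Or.inl ⟨le_trans (by nlinarith) hz1, h⟩
    · exact Or.inr ⟨h, h3⟩
  have hdom : ∫⁻ z in Z, (dom lam y (dist z y))⁻¹ ∂μ ≤ (1 + D) * κ := by
    calc _ ≤ _ := lintegral_mono_set hZsub
      _ ≤ _ := lintegral_union_le _ _ _
      _ ≤ κ + D := by
        refine add_le_add ?_ ?_
        · refine le_trans (le_of_eq ?_) (le_add_self : _ ≤ κ)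
          refine setLIntegral_congr_fun (measurableSet_annulus y s r) fun z hz => ?_
          exact (hμ.ofReal_one_div y (hs.trans_le hz.1)).symm
        · refine (lintegral_annulus_le hμ y hr).trans ?_
          rw [← div_eq_mul_inv, ENNReal.div_le_iff (hμ.dom_ne_zero y hr) dom_ne_top]
          refine hD y y r _ hr ?_ le_rfl
          rw [dist_self]; positivity
      _ ≤ κ + D * κ := by
        gcongr
        calc (D : ℝ≥0∞) = D * 1 := (mul_one _).symm
          _ ≤ D * κ := by gcongr
      _ = _ := by ring
  have far : ∫⁻ z in Z, ‖app T a z‖ₑ ∂μ ≤ C₂ * (1 + D) := by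
    calc _ ≤ ∫⁻ z in Z, C₂ * (∫⁻ y, ‖a y‖ₑ ∂μ) * (dom lam y (dist z y))⁻¹ ∂μ := by
          refine lintegral_mono_ae ?_
          rw [ae_restrict_iff' hZm]
          filter_upwards [h₂ y s a hs ha (hsupp.trans ball_subset_closedBall)] with z hz hzZ
          refine hz ?_
          have := hzZ.1
          rwa [mem_compl_iff, mem_ball, not_lt] at this
      _ = C₂ * (∫⁻ y, ‖a y‖ₑ ∂μ) * ∫⁻ z in Z, (dom lam y (dist z y))⁻¹ ∂μ :=
          lintegral_const_mul' _ _ (ENNReal.mul_ne_top ENNReal.coe_ne_top hIt)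
      _ ≤ C₂ * κ⁻¹ * ((1 + D) * κ) := by gcongr
      _ = C₂ * (1 + D) * (κ⁻¹ * κ) := by ring
      _ ≤ C₂ * (1 + D) * 1 := by gcongr; exact ENNReal.inv_mul_le_one _
      _ = _ := mul_one _
  have hcov : closedBall x (2 ^ m * r) ⊆ ball y (ρ * s) ∪ Z := by
    intro z hz
    by_cases h : z ∈ ball y (ρ * s)
    · exact Or.inl h
    · exact Or.inr ⟨h, hz⟩
  calc _ ≤ _ := lintegral_mono_set hcov
    _ ≤ _ := lintegral_union_le _ _ _
    _ ≤ ‖T‖ₑ + C₂ * (1 + D) := add_le_add near far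
    _ = _ := by push_cast; rw [← enorm_eq_nnnorm]

/-- The image of an atomic block. -/
theorem HasStandardKernel.exists_image_atomicBlock (hT : HasStandardKernel lam K T)
    (hμ : IsUpperDoubling μ lam) {ρ : ℝ} (hρ : 1 < ρ) :
    ∃ C : ℝ≥0, ∀ (b : Lp 𝕜 1 μ) (c : ℕ → 𝕜), IsAtomicBlock lam ρ b c → ∑' j, ‖c j‖ₑ < ∞ →
      ∃ h : Lp 𝕜 1 μ, (b, h) ∈ weakGraph T hμ ∧ ‖h‖ₑ ≤ C * ∑' j, ‖c j‖ₑ := by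
  obtain ⟨m, C₁, h₁⟩ := hT.lintegral_app_compl_le hμ
  obtain ⟨C₂, h₂⟩ := hT.lintegral_app_atom_le hμ m hρ
  refine ⟨C₁ + C₂, fun b c hb hc => ?_⟩
  obtain ⟨x, r, hr, hbsupp, hbint, a, y, s, ha, hsum⟩ := hb
  rcases eq_or_ne (μ (ball x r)) 0 with hB0 | hB0
  · have hb0 : b = 0 := by
      refine Lp.ext ((?_ : (b : X → 𝕜) =ᵐ[μ] 0).trans (Lp.coeFn_zero 𝕜 1 μ).symm)
      filter_upwards [hbsupp, measure_eq_zero_iff_ae_notMem.1 hB0] with z h1 h2 using h1 h2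
    refine ⟨0, ?_, by simp⟩
    rw [hb0]
    exact (weakGraph T hμ).zero_mem
  set R := closedBall x r with hR
  have hRm : MeasurableSet R := measurableSet_closedBall
  have hR0 : μ R ≠ 0 := fun h => hB0 (measure_mono_null ball_subset_closedBall h)
  have hRt : μ R ≠ ∞ := (hμ.measure_closedBall_lt_top x r).ne
  set P := closedBall x (2 ^ m * r) with hP
  have hPm : MeasurableSet P := measurableSet_closedBall
  have hPt : μ P ≠ ∞ := (hμ.measure_closedBall_lt_top x _).ne
  -- a normalised bump on the ball
  set θ : X → 𝕜 := R.indicator fun _ => (((μ.real R)⁻¹ : ℝ) : 𝕜) with hθ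
  have hθb : BddSupp μ θ := BddSupp.indicator_const _ hRm isBounded_closedBall
  have hθs : Function.support θ ⊆ R := Set.support_indicator_subset
  have hθint : ∫ z, θ z ∂μ = 1 := by
    have hr0 : μ.real R ≠ 0 := (ENNReal.toReal_pos hR0 hRt).ne'
    rw [hθ, integral_indicator_const _ hRm, RCLike.real_smul_eq_coe_mul, ← RCLike.ofReal_mul,
      mul_inv_cancel₀ hr0, RCLike.ofReal_one]
  -- atoms with genuine supports
  set a' : ℕ → X → 𝕜 := fun j => (ball (y j) (s j)).indicator (a j) with ha'
  have haa' : ∀ j, a' j =ᵐ[μ] a j := by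
    intro j
    filter_upwards [(ha j).2.2.1] with z hz
    by_cases hzb : z ∈ ball (y j) (s j)
    · exact indicator_of_mem hzb _
    · rw [hz hzb]; exact indicator_of_notMem hzb _
  have ha's : ∀ j, Function.support (a' j) ⊆ ball (y j) (s j) := fun j =>
    Set.support_indicator_subset
  have ha'm : ∀ j, AEStronglyMeasurable (a' j) μ := fun j =>
    (Lp.aestronglyMeasurable (a j)).congr (haa' j).symm
  have ha'N : ∀ j, eLpNorm (a' j) ∞ μ ≤
      (μ (ball (y j) (ρ * s j)) * coeffK μ lam (y j) (s j) r)⁻¹ := fun j => by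
    rw [eLpNorm_congr_ae (haa' j)]; exact (ha j).2.2.2
  have ha'b : ∀ j, BddSupp μ (a' j) := by
    intro j
    refine ⟨⟨ha'm j, ?_⟩, isBounded_ball.subset (ha's j)⟩
    -- On a null ball the prescribed bound is `∞` and says nothing, but there the atom vanishes
    -- almost everywhere.
    rcases eq_or_ne (μ (ball (y j) (ρ * s j))) 0 with h0 | h0
    · have hz : a' j =ᵐ[μ] 0 := by
        filter_upwards [measure_eq_zero_iff_ae_notMem.1 h0] with z hz
        refine Function.notMem_support.1 fun h => hz (ball_subset_ball ?_ (ha's j h))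
        nlinarith [(ha j).1]
      rw [eLpNorm_congr_ae hz]; simp
    · refine (ha'N j).trans_lt (ENNReal.inv_lt_top.2 ?_)
      exact pos_iff_ne_zero.2 (mul_ne_zero h0 (zero_lt_one.trans_le (one_le_coeffK _ _ _)).ne')
  have hatom : ∀ j, ∫⁻ z, ‖a' j z‖ₑ ∂μ ≤ 1 ∧ ∫⁻ z in P, ‖app T (a' j) z‖ₑ ∂μ ≤ C₂ := fun j =>
    h₂ x (y j) r (s j) (a' j) hr (ha j).1 (ha j).2.1 (ha'b j) (ha's j) (ha'N j)
  -- atoms corrected to have integral zero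
  set ι : ℕ → 𝕜 := fun j => ∫ z, a' j z ∂μ with hι
  have hι1 : ∀ j, ‖ι j‖ₑ ≤ 1 := fun j => (enorm_integral_le_lintegral_enorm _).trans (hatom j).1
  set α : ℕ → X → 𝕜 := fun j => a' j - ι j • θ with hα
  have hαb : ∀ j, BddSupp μ (α j) := fun j => (ha'b j).sub (hθb.const_smul _)
  -- The cost of the bump is finite, but no uniform bound is claimed: `P` may be much heavier than
  -- `R`. Finiteness is enough, since its coefficient tends to zero.
  set Q : ℝ≥0∞ := C₁ * ∫⁻ z, ‖θ z‖ₑ ∂μ + ∫⁻ z in P, ‖app T θ z‖ₑ ∂μ with hQ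
  have hQt : Q ≠ ∞ := by
    refine ENNReal.add_ne_top.2 ⟨ENNReal.mul_ne_top ENNReal.coe_ne_top (hθb.integrable hμ).2.ne, ?_⟩
    refine ne_top_of_le_ne_top ?_ (HasStandardKernel.setLIntegral_app_le T (hθb.memLp hμ 2) P)
    exact ENNReal.mul_ne_top (ENNReal.mul_ne_top enorm_ne_top (hθb.memLp hμ 2).2.ne)
      (ENNReal.rpow_ne_top_of_nonneg (by norm_num) hPt)
  -- Outside `P` the mean zero of the whole combination is used, inside `P` the atoms are estimated
  -- one by one. The error is kept in terms of the total integral of the combination, not the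
  -- separate integrals, so that it can vanish in the limit.
  have est : ∀ (J : Finset ℕ) (d : ℕ → 𝕜), ∫⁻ z, ‖app T (∑ j ∈ J, d j • α j) z‖ₑ ∂μ ≤
      (C₁ + C₂) * ∑ j ∈ J, ‖d j‖ₑ + Q * ‖∑ j ∈ J, d j * ι j‖ₑ := by
    intro J d
    set p : X → 𝕜 := ∑ j ∈ J, d j • a' j with hp
    set M : 𝕜 := ∑ j ∈ J, d j * ι j with hM
    have hpb : BddSupp μ p := BddSupp.sum fun j _ => (ha'b j).const_smul _
    have hq : ∑ j ∈ J, d j • α j = p - M • θ := by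
      simp only [hα, smul_sub, Finset.sum_sub_distrib, smul_smul, hp, hM, Finset.sum_smul]
    rw [hq]
    have hMb : BddSupp μ (M • θ) := hθb.const_smul _
    have hpint : ∫ z, p z ∂μ = M := by
      simp only [hp, Finset.sum_apply, Pi.smul_apply]
      rw [integral_finsetSum (f := fun j z => d j • a' j z) _ fun j _ =>
        ((ha'b j).integrable hμ).smul (d j)]
      simp only [integral_smul, hM, hι]
      simp only [smul_eq_mul]
    have hp1 : ∫⁻ z, ‖p z‖ₑ ∂μ ≤ ∑ j ∈ J, ‖d j‖ₑ := by
      calc _ ≤ ∫⁻ z, ∑ j ∈ J, ‖d j‖ₑ * ‖a' j z‖ₑ ∂μ := by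
            refine lintegral_mono fun z => ?_
            rw [hp, Finset.sum_apply]
            refine (enorm_sum_le _ _).trans (le_of_eq ?_)
            simp only [Pi.smul_apply, enorm_smul]
        _ = ∑ j ∈ J, ∫⁻ z, ‖d j‖ₑ * ‖a' j z‖ₑ ∂μ :=
            lintegral_finsetSum' _ fun j _ => (ha'm j).enorm.const_mul _
        _ ≤ ∑ j ∈ J, ‖d j‖ₑ := by
            refine Finset.sum_le_sum fun j _ => ?_
            rw [lintegral_const_mul' _ _ enorm_ne_top]
            exact mul_le_of_le_one_right' (hatom j).1
    have hfar : ∫⁻ z in Pᶜ, ‖app T (p - M • θ) z‖ₑ ∂μ ≤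
        C₁ * (∑ j ∈ J, ‖d j‖ₑ + ‖M‖ₑ * ∫⁻ z, ‖θ z‖ₑ ∂μ) := by
      refine (h₁ x r _ hr (hpb.sub hMb) ?_ ?_).trans ?_
      · refine (Function.support_sub _ _).trans (union_subset ?_ ?_)
        · intro z hz
          by_contra hzR
          refine hz ?_
          rw [hp, Finset.sum_apply]
          refine Finset.sum_eq_zero fun j _ => ?_
          have : a' j z = 0 := Function.notMem_support.1 fun h =>
            hzR (ball_subset_closedBall ((ha j).2.1 (ha's j h)))
          simp [this]
        · exact (Function.support_const_smul_subset _ _).trans hθs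
      · rw [integral_sub' (hpb.integrable hμ) (hMb.integrable hμ), hpint]
        simp only [Pi.smul_apply]
        rw [integral_smul, hθint, smul_eq_mul, mul_one, sub_self]
      · gcongr
        calc _ ≤ ∫⁻ z, (‖p z‖ₑ + ‖M‖ₑ * ‖θ z‖ₑ) ∂μ := by
              refine lintegral_mono fun z => ?_
              rw [Pi.sub_apply, Pi.smul_apply, ← enorm_smul]
              exact enorm_sub_le
          _ = ∫⁻ z, ‖p z‖ₑ ∂μ + ‖M‖ₑ * ∫⁻ z, ‖θ z‖ₑ ∂μ := by
              rw [lintegral_add_left' hpb.aestronglyMeasurable.enorm,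
                lintegral_const_mul' _ _ enorm_ne_top]
          _ ≤ _ := by gcongr
    have hnear : ∫⁻ z in P, ‖app T (p - M • θ) z‖ₑ ∂μ ≤
        C₂ * ∑ j ∈ J, ‖d j‖ₑ + ‖M‖ₑ * ∫⁻ z in P, ‖app T θ z‖ₑ ∂μ := by
      have hae : app T (p - M • θ) =ᵐ[μ] ∑ j ∈ J, app T (d j • a' j) - app T (M • θ) :=
        (app_sub T (hpb.memLp hμ 2) (hMb.memLp hμ 2)).trans
          ((app_sum T fun j _ => ((ha'b j).const_smul (d j)).memLp hμ 2).sub (EventuallyEq.refl _ _))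
      have hae2 : ∀ᵐ z ∂μ, ∀ j, app T (d j • a' j) z = d j • app T (a' j) z :=
        ae_all_iff.2 fun j => app_const_smul T ((ha'b j).memLp hμ 2) (d j)
      calc _ ≤ ∫⁻ z in P, (∑ j ∈ J, ‖d j‖ₑ * ‖app T (a' j) z‖ₑ + ‖M‖ₑ * ‖app T θ z‖ₑ) ∂μ := by
            refine lintegral_mono_ae (ae_restrict_of_ae ?_)
            filter_upwards [hae, hae2, app_const_smul T (hθb.memLp hμ 2) M] with z h1 h2 h3
            rw [h1, Pi.sub_apply, Finset.sum_apply, h3]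
            refine enorm_sub_le.trans (add_le_add ((enorm_sum_le _ _).trans (le_of_eq ?_)) ?_)
            · simp only [h2, enorm_smul]
            · rw [Pi.smul_apply, enorm_smul]
        _ = ∑ j ∈ J, ∫⁻ z in P, ‖d j‖ₑ * ‖app T (a' j) z‖ₑ ∂μ +
            ‖M‖ₑ * ∫⁻ z in P, ‖app T θ z‖ₑ ∂μ := by
            rw [lintegral_add_right' _ ((memLp_app T).1.enorm.restrict.const_mul _),
              lintegral_finsetSum' _ fun j _ => (memLp_app T).1.enorm.restrict.const_mul _,
              lintegral_const_mul' _ _ enorm_ne_top]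
        _ ≤ _ := by
            gcongr
            rw [Finset.mul_sum]
            refine Finset.sum_le_sum fun j _ => ?_
            rw [lintegral_const_mul' _ _ enorm_ne_top, mul_comm]
            gcongr
            exact (hatom j).2
    rw [← lintegral_add_compl _ hPm]
    refine (add_le_add hnear hfar).trans (le_of_eq ?_)
    rw [hQ]; ring
  -- passage to the limit
  have hαT : ∀ j, MemLp (app T (α j)) 1 μ := by
    intro j
    refine ⟨(memLp_app T).1, ?_⟩
    rw [eLpNorm_one_eq_lintegral_enorm]
    have := est {j} fun _ => 1
    simp only [Finset.sum_singleton, one_smul, one_mul] at this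
    refine this.trans_lt ?_
    have h1 := hι1 j
    have h2 : ‖ι j‖ₑ ≠ ∞ := enorm_ne_top
    have h3 : ‖(1 : 𝕜)‖ₑ ≠ ∞ := enorm_ne_top
    finiteness
  have hnorm : ∀ j, eLpNorm (app T (α j)) 1 μ ≤ C₁ + C₂ + Q := by
    intro j
    rw [eLpNorm_one_eq_lintegral_enorm]
    have := est {j} fun _ => 1
    simp only [Finset.sum_singleton, one_smul, one_mul] at this
    refine this.trans ?_
    have h1 : ‖(1 : 𝕜)‖ₑ = 1 := by simp
    rw [h1, mul_one]
    gcongr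
    exact mul_le_of_le_one_right' (hι1 j)
  set w : ℕ → Lp 𝕜 1 μ := fun j => ((hαb j).memLp hμ 1).toLp with hw
  set v : ℕ → Lp 𝕜 1 μ := fun j => (hαT j).toLp with hv
  set e : Lp 𝕜 1 μ := (hθb.memLp hμ 1).toLp with he
  have hwv : ∀ j, (w j, v j) ∈ weakGraph T hμ := fun j =>
    (IsWeakImage.of_bddSupp (hαb j)).congr ((hαb j).memLp hμ 1).coeFn_toLp.symm
      (hαT j).coeFn_toLp.symm
  have hwa : ∀ j, w j = a j - ι j • e := by
    intro j
    refine Lp.ext ?_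
    filter_upwards [((hαb j).memLp hμ 1).coeFn_toLp, Lp.coeFn_sub (a j) (ι j • e),
      Lp.coeFn_smul (ι j) e, (hθb.memLp hμ 1).coeFn_toLp, haa' j] with z h1 h2 h3 h4 h5
    rw [hw, h1, h2, Pi.sub_apply, h3, Pi.smul_apply, he, h4, ← h5]
    rfl
  -- The cancellation of the block: integration is continuous on `L¹`, and `b` has integral zero.
  have hιsum : HasSum (fun j => c j * ι j) 0 := by
    have h := (L1.integralCLM (E := 𝕜) (μ := μ)).hasSum hsum
    have hI : ∀ f : Lp 𝕜 1 μ, L1.integralCLM f = ∫ z, f z ∂μ := fun f =>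
      (L1.integral_eq f).symm.trans (L1.integral_eq_integral f)
    simp only [hI] at h
    rw [hbint] at h
    refine h.congr_fun fun j => ?_
    rw [integral_congr_ae (Lp.coeFn_smul (c j) (a j))]
    simp only [Pi.smul_apply]
    rw [integral_smul, smul_eq_mul, ← integral_congr_ae (haa' j)]
  have hwsum : HasSum (fun j => c j • w j) b := by
    have h := hsum.sub (hιsum.smul_const e)
    rw [zero_smul, sub_zero] at h
    refine h.congr_fun fun j => ?_
    rw [hwa, smul_sub, mul_smul]
  have hvsummable : Summable fun j => c j • v j := by
    refine Summable.of_norm ((tsum_enorm_ne_top_iff_summable_norm).1 ?_)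
    refine ne_top_of_le_ne_top (b := (∑' j, ‖c j‖ₑ) * (C₁ + C₂ + Q)) ?_ ?_
    · finiteness
    · rw [← ENNReal.tsum_mul_right]
      refine ENNReal.tsum_le_tsum fun j => ?_
      rw [enorm_smul, hv, Lp.enorm_toLp]
      gcongr
      exact hnorm j
  refine ⟨∑' j, c j • v j, ?_, ?_⟩
  · refine (isClosed_weakGraph hμ).mem_of_tendsto (hwsum.prodMk hvsummable.hasSum)
      (Eventually.of_forall fun J => ?_)
    exact (weakGraph T hμ).sum_mem fun j _ => (weakGraph T hμ).smul_mem (c j) (hwv j)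
  · have hbound : ∀ J : Finset ℕ, ‖∑ j ∈ J, c j • v j‖ₑ ≤
        (C₁ + C₂) * ∑' j, ‖c j‖ₑ + Q * ‖∑ j ∈ J, c j * ι j‖ₑ := by
      intro J
      refine le_trans (le_of_eq ?_) ((est J c).trans ?_)
      · rw [Lp.enorm_def, eLpNorm_one_eq_lintegral_enorm]
        refine lintegral_congr_ae ?_
        have h1 : ∀ᵐ z ∂μ, ∀ j, (c j • v j : Lp 𝕜 1 μ) z = app T (c j • α j) z := by
          refine ae_all_iff.2 fun j => ?_
          filter_upwards [Lp.coeFn_smul (c j) (v j), (hαT j).coeFn_toLp,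
            app_const_smul T ((hαb j).memLp hμ 2) (c j)] with z h1 h2 h3
          rw [h1, h3, Pi.smul_apply, Pi.smul_apply, hv, h2]
        filter_upwards [Lp_coeFn_sum J fun j => c j • v j, h1,
          app_sum (s := J) T fun j _ => ((hαb j).const_smul (c j)).memLp hμ 2] with z h1 h2 h3
        rw [h1, h3, Finset.sum_apply, Finset.sum_apply]
        simp only [h2]
      · gcongr
        exact ENNReal.sum_le_tsum J
    have hlim := ENNReal.Tendsto.const_mul (a := Q)
      ((continuous_enorm.tendsto (0 : 𝕜)).comp hιsum) (Or.inr hQt)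
    rw [enorm_zero, mul_zero] at hlim
    have hlim' := (tendsto_const_nhds (x := ((C₁ : ℝ≥0∞) + C₂) * ∑' j, ‖c j‖ₑ)).add hlim
    rw [add_zero] at hlim'
    have := le_of_tendsto_of_tendsto ((continuous_enorm.tendsto _).comp hvsummable.hasSum) hlim'
      (Eventually.of_forall hbound)
    rw [ENNReal.coe_add]
    exact this

end Atoms

/-! ### Boundedness on the Hardy space -/

section Hardy

variable {X : Type*} [MetricSpace X] [MeasurableSpace X] [BorelSpace X]
  {𝕜 : Type*} [RCLike 𝕜] {μ : Measure X} {lam : X → ℝ → ℝ} {K : X → X → 𝕜}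
  {T : Lp 𝕜 2 μ →L[𝕜] Lp 𝕜 2 μ}

/-- The images of the blocks are absolutely summable in `L¹`, and the graph is closed. -/
theorem HasStandardKernel.exists_image_decomposition (hT : HasStandardKernel lam K T)
    (hμ : IsUpperDoubling μ lam) {ρ : ℝ} (hρ : 1 < ρ) :
    ∃ C : ℝ≥0, ∀ (f : Lp 𝕜 1 μ) (b : ℕ → Lp 𝕜 1 μ) (c : ℕ → ℕ → 𝕜),
      IsAtomicDecomposition lam ρ f b c → ∑' i, ∑' j, ‖c i j‖ₑ < ∞ →
      ∃ h : Lp 𝕜 1 μ, (f, h) ∈ weakGraph T hμ ∧ ‖h‖ₑ ≤ C * ∑' i, ∑' j, ‖c i j‖ₑ := by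
  obtain ⟨C, hC⟩ := hT.exists_image_atomicBlock hμ hρ
  refine ⟨C, fun f b c hf hc => ?_⟩
  choose h hbh hle using fun i =>
    hC (b i) (c i) (hf.1 i) (ENNReal.ne_top_of_tsum_ne_top hc.ne i).lt_top
  have hle' : ∑' i, ‖h i‖ₑ ≤ C * ∑' i, ∑' j, ‖c i j‖ₑ := by
    rw [← ENNReal.tsum_mul_left]
    exact ENNReal.tsum_le_tsum hle
  have hs : Summable h := Summable.of_norm (tsum_enorm_ne_top_iff_summable_norm.1
    (ne_top_of_le_ne_top (ENNReal.mul_ne_top ENNReal.coe_ne_top hc.ne) hle'))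
  refine ⟨∑' i, h i, ?_, enorm_tsum_le_tsum_enorm.trans hle'⟩
  exact (isClosed_weakGraph hμ).mem_of_tendsto (hf.2.prodMk hs.hasSum)
    (Eventually.of_forall fun J => (weakGraph T hμ).sum_mem fun i _ => hbh i)

/-- The difference of two images is an image of `0`. Hence the extension does not depend on the
atomic decomposition and is linear. -/
theorem HasStandardKernel.isWeakImage_unique (hT : HasStandardKernel lam K T)
    (hX : GeometricallyDoubling X) (hμ : IsUpperDoubling μ lam) {f h h' : X → 𝕜}
    (hf : AEStronglyMeasurable f μ) (H : IsWeakImage T f h) (H' : IsWeakImage T f h') :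
    h =ᵐ[μ] h' := by
  obtain ⟨C, hC⟩ := hT.weak_type hX hμ
  have h0 := H.add hμ hf (H'.const_smul hμ (-1))
  rw [neg_one_smul, neg_one_smul, add_neg_cancel] at h0
  filter_upwards [h0.eq_zero hC] with z hz
  exact add_neg_eq_zero.1 hz

/-- Calderón–Zygmund operators are bounded from the atomic Hardy space into `L¹(μ)`. -/
theorem IsCZOperator.exists_hardySpace_extension [Nonempty X] (hX : GeometricallyDoubling X)
    (hμ : IsUpperDoubling μ lam) (hT : IsCZOperator lam K T) {ρ : ℝ} (hρ : 1 < ρ) :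
    ∃ (S : hardySpace 𝕜 μ lam ρ →ₗ[𝕜] Lp 𝕜 1 μ) (C : ℝ≥0),
      (∀ f, ‖S f‖ₑ ≤ C * hardyNorm lam ρ (f : Lp 𝕜 1 μ)) ∧
      ∀ (f : hardySpace 𝕜 μ lam ρ) (g : Lp 𝕜 2 μ),
        (f : Lp 𝕜 1 μ) =ᵐ[μ] g → S f =ᵐ[μ] T g := by
  have hT' := hT.hasStandardKernel hμ
  obtain ⟨C, hC⟩ := hT'.exists_image_decomposition hμ hρ
  have huniq : ∀ {f h h' : Lp 𝕜 1 μ}, (f, h) ∈ weakGraph T hμ → (f, h') ∈ weakGraph T hμ →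
      h = h' := fun {f _ _} H H' =>
    Lp.ext (hT'.isWeakImage_unique hX hμ (Lp.aestronglyMeasurable f) H H')
  have hex : ∀ f : hardySpace 𝕜 μ lam ρ, ∃ h : Lp 𝕜 1 μ, ((f : Lp 𝕜 1 μ), h) ∈ weakGraph T hμ := by
    intro f
    obtain ⟨b, c, hbc, hc⟩ := hardyNorm_lt_top_iff.1 f.2
    obtain ⟨h, hh, -⟩ := hC f b c hbc hc
    exact ⟨h, hh⟩
  choose S hS using hex
  refine ⟨{ toFun := S
            map_add' := fun f g => huniq (hS (f + g)) ((weakGraph T hμ).add_mem (hS f) (hS g))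
            map_smul' := fun k f =>
              huniq (hS (k • f)) ((weakGraph T hμ).smul_mem k (hS f)) }, C + 1, ?_, ?_⟩
  · intro f
    show ‖S f‖ₑ ≤ _
    -- The constant `C + 1` is nonzero, so it can be moved across before the infimum is taken and
    -- decompositions of infinite size give no constraint.
    rw [← ENNReal.div_le_iff' (by simp) ENNReal.coe_ne_top]
    refine le_iInf fun b => le_iInf fun c => le_iInf fun hbc => ?_
    rw [ENNReal.div_le_iff' (by simp) ENNReal.coe_ne_top]
    rcases eq_or_ne (∑' i, ∑' j, ‖c i j‖ₑ) ∞ with hc | hc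
    · rw [hc, ENNReal.mul_top (by simp)]
      exact le_top
    · obtain ⟨h, hh, hle⟩ := hC f b c hbc hc.lt_top
      rw [huniq (hS f) hh]
      refine hle.trans ?_
      gcongr
      exact le_self_add
  · intro f g hfg
    obtain ⟨x₀⟩ := ‹Nonempty X›
    have hf2 : MemLp (f : Lp 𝕜 1 μ) 2 μ := (memLp_congr_ae hfg).2 (Lp.memLp g)
    have H := IsWeakImage.of_memLp (T := T) hμ x₀ (Lp.stronglyMeasurable (f : Lp 𝕜 1 μ))
      (Lp.memLp _) hf2
    rw [app_congr T hf2 hfg, app_coeFn] at H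
    exact hT'.isWeakImage_unique hX hμ (Lp.aestronglyMeasurable _) (hS f) H

end Hardy

end NonHomogeneous

theorem mainTheorem3 {𝕜 : Type*} [RCLike 𝕜] {X : Type*} [MetricSpace X] [Nonempty X]
    [MeasurableSpace X] [BorelSpace X] (hX : NonHomogeneous.GeometricallyDoubling X)
    (μ : Measure X) (lam : X → ℝ → ℝ) (hμ : NonHomogeneous.IsUpperDoubling μ lam)
    (K : X → X → 𝕜) (T : Lp 𝕜 2 μ →L[𝕜] Lp 𝕜 2 μ)
    (hT : NonHomogeneous.IsCZOperator lam K T) (ρ : ℝ) (hρ : 1 < ρ) :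
    -- `T` is bounded from the atomic Hardy space into `L¹(μ)`
    (∃ (S : NonHomogeneous.hardySpace 𝕜 μ lam ρ →ₗ[𝕜] Lp 𝕜 1 μ) (C : ℝ≥0),
      (∀ f, ‖S f‖ₑ ≤ C * NonHomogeneous.hardyNorm lam ρ (f : Lp 𝕜 1 μ)) ∧
      ∀ (f : NonHomogeneous.hardySpace 𝕜 μ lam ρ) (g : Lp 𝕜 2 μ),
        (f : Lp 𝕜 1 μ) =ᵐ[μ] g → S f =ᵐ[μ] T g) ∧
    -- `T` is bounded on `L^p(μ)` for `1 < p < ∞`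
    (∀ (p : ℝ≥0∞) [Fact (1 ≤ p)], 1 < p → p < ∞ →
      ∃ S : Lp 𝕜 p μ →L[𝕜] Lp 𝕜 p μ,
        ∀ (f : Lp 𝕜 p μ) (g : Lp 𝕜 2 μ), f =ᵐ[μ] g → S f =ᵐ[μ] T g) :=
  ⟨hT.exists_hardySpace_extension hX hμ hρ,
    fun p _ hp1 hp => hT.exists_Lp_extension hX hμ p hp1 hp⟩
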